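/- For each $n$ let $X_1,\dots,X_n$ be independent random variables uniformly distributed on $[0,1]$, with order statistics $X_{(1)}\le\dots\le X_{(n)}$, and let $r_n\ge 0$. Let $\hat G_{n,r_n}$ be the ordered graph: its nodes are $1,\dots,n$, and distinct nodes $i,j$ are joined by an edge iff $|X_{(i)}-X_{(j)}|\le r_n$. For $2\le i\le n$ let $L_i$ be the number of neighbours $j<i$ of node $i$ in $\hat G_{n,r_n}$. Let $H$ denote (conditional) Shannon entropy in bits. Then, for all $n\ge 2$, $$\frac1n H(\hat G_{n,r_n})\;\le\; B_n:=\frac1n H(L_2)+\frac1n\sum_{i=2}^{n-1}H(L_{i+1}\mid L_i),$$ and, as $n\to\infty$, $$B_n\sim\begin{cases} h_{\mathrm U}(n r_n), & \text{if } r_n=O(1/n),\\ 2, & \text{if } r_n=\omega(1/n)\text{ and } r_n=o(1),\\ 2(1-r), & \text{if } r_n=r\in(0,1)\text{ for all } n.\end{cases}$$ Here $u_n\sim v_n$ means $u_n-v_n=o(v_n)$, and $h_{\mathrm U}:[0,\infty)\to[0,\infty)$ is given by the convergent series (with the convention $0\log_2 0=0$) $$h_{\mathrm U}(x)=\frac{x\,e^{-x}}{\ln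 2}-\sum_{a=0}^{\infty}\frac{x^a e^{-x}}{a!}\sum_{k=0}^{a}\frac{x}{a+1}M(k+1,a+2,-x)\,\log_2\!\Big(\frac{x}{a+1}M(k+1,a+2,-x)\Big),$$ where $M$ is Kummer's confluent hypergeometric function, for $0<\alpha<\beta$ given by $$M(\alpha,\beta,z)=\frac{\Gamma(\beta)}{\Gamma(\alpha)\,\Gamma(\beta-\alpha)}\int_0^1 t^{\alpha-1}(1-t)^{\beta-\alpha-1}e^{zt}\,\mathrm dt.$$ -/

import Mathlib

open MeasureTheory ProbabilityTheory Filter Asymptotics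

namespace RGG

noncomputable section

/-- The `k`-th smallest value (with `k` counted from `0`) of the locations `x`. -/
def orderStat {n : ℕ} (x : Fin n → ℝ) (k : Fin n) : ℝ :=
  x (Tuple.sort x k)

/-- The ordered geometric graph of the locations `x` with connection range `r`: the nodes are
indexed from left to right, and two distinct nodes are adjacent iff the corresponding order
statistics are at distance at most `r`. -/
def orderedGraph {n : ℕ} (x : Fin n → ℝ) (r : ℝ) : SimpleGraph (Fin n) where
  Adj i j := i ≠ j ∧ |orderStat x i - orderStat x j| ≤ r
  symm := ⟨fun i j h => ⟨h.1.symm, by rw [abs_sub_comm]; exact h.2⟩⟩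
  loopless := ⟨fun _ h => h.1 rfl⟩

/-- The number of neighbours to the left of node `i` of `G`. Here nodes are counted
`1, …, n`, so that node `i` is the element of `Fin n` with value `i - 1`. -/
def leftNeighbors {n : ℕ} (G : SimpleGraph (Fin n)) (i : ℕ) : ℕ :=
  {j : Fin n | ∃ v : Fin n, (v : ℕ) + 1 = i ∧ j < v ∧ G.Adj j v}.ncard

variable {Ω : Type*} [MeasurableSpace Ω]

/-- Shannon entropy, in bits, of a discrete random variable `Y` under `μ`. -/
def entropy {S : Type*} (μ : Measure Ω) (Y : Ω → S) : ℝ :=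
  -∑' s : S, μ.real (Y ⁻¹' {s}) * Real.logb 2 (μ.real (Y ⁻¹' {s}))

/-- Conditional Shannon entropy `H(Y | Z) = ∑ Pr(Z = z) H(Y | Z = z)`, in bits. -/
def condEntropy {S T : Type*} (μ : Measure Ω) (Y : Ω → S) (Z : Ω → T) : ℝ :=
  ∑' z : T, μ.real (Z ⁻¹' {z}) * entropy (μ[|Z ⁻¹' {z}]) Y

/-- For a random graph `G` on the nodes `1, …, n` with left-neighbour counts `L i`:
`H(L 2) + ∑_{i=2}^{n-1} H(L (i+1) | L i)`. -/
def chainBound {n : ℕ} (μ : Measure Ω) (G : Ω → SimpleGraph (Fin n)) : ℝ :=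
  entropy μ (fun ω => leftNeighbors (G ω) 2) +
    ∑ i ∈ Finset.Icc 2 (n - 1),
      condEntropy μ (fun ω => leftNeighbors (G ω) (i + 1)) (fun ω => leftNeighbors (G ω) i)

/-- Kummer's confluent hypergeometric function `M(α, β, z)`, for `0 < α < β`. -/
def kummerM (α β z : ℝ) : ℝ :=
  Real.Gamma β / (Real.Gamma α * Real.Gamma (β - α)) *
    ∫ t in (0 : ℝ)..1, t ^ (α - 1) * (1 - t) ^ (β - α - 1) * Real.exp (z * t)

/-- The `a`-th term of the series in `hU`. -/
def hUTerm (x : ℝ) (a : ℕ) : ℝ :=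
  x ^ a * Real.exp (-x) / (a.factorial : ℝ) *
    ∑ k ∈ Finset.range (a + 1),
      x / ((a : ℝ) + 1) * kummerM ((k : ℝ) + 1) ((a : ℝ) + 2) (-x) *
        Real.logb 2 (x / ((a : ℝ) + 1) * kummerM ((k : ℝ) + 1) ((a : ℝ) + 2) (-x))

/-- The limiting function `h_U`. -/
def hU (x : ℝ) : ℝ :=
  x * Real.exp (-x) / Real.log 2 - ∑' a : ℕ, hUTerm x a

end

end RGG

/-! Read from left to right, the left neighbours of a node form a block of consecutive nodes ending
just before it. Hence the graph on the first `i + 1` nodes is determined by the graph on the first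
`i` nodes and the single number `L (i+1)`. The chain rule, with conditioning on the whole past
weakened to conditioning on `L i`, gives the entropy bound (`entropy_le_add_condEntropy`,
`entropy_firstNodes_le`).

The asymptotics rest on the joint law of `(L i, L (i+1))`. Reversing the spacings to the left of
node `i + 1` preserves the uniform law of the order statistics, and turns the two counts into the
numbers of points in a window starting at the first point and in a window starting at the origin
(`cubeMeasure_leftNeighbors_pair`). So `i` enters only through truncation. Without truncation `L i =
a` has a binomial weight, and given this `L (i+1)` is `a + 1 - k` with probability `binomMix
(gapDensity n r a) a k` and `0` with the remaining mass. Summing over `i` writes the bound as a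
weighted sum of step entropies plus `H(L 2)` and truncation terms (`chainBound_eq`).

Sparse regime: binomial weights tend to Poisson weights and the gap density to an exponential one,
with relative errors uniform over `n r ≤ C`, while `hU` is exactly the Poisson average of the
limiting step entropies (`hU_eq_tsum`). Since `x = n r` may tend to `0`, or vanish, every error has
to be small relative to `hU x`. The bound `x * exp (-x) ≤ hU x` absorbs errors of order `x`; the
term `a = 0` of the series absorbs `H(L 2)`, which is of order `x log (1/x)`.

Dense regimes (`n r → ∞`, `r → ρ < 1`): the number of neighbours lost in one step becomes geometric
with parameter `1/2`, whose entropy is 2 bits. Binomial concentration at `a ≈ n r` leaves about `(1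
- ρ) n` indices `i` in the untruncated range, which gives the lower bound. For the upper bound,
Gibbs' inequality is applied with a geometric kernel of ratio `θ` (`condEntropy_le_geometric`): its
logarithm is affine in `L i + 1 - L (i+1)`, so only the probability that `Bin(n, r) < i` enters. The
choice `θ = 1/2` bounds every step by 2, and a small `θ` makes the steps well below `n r`
negligible. -/

namespace RGG

/-! ### The entropy summand and Gibbs' inequality -/

/-- The summand `-t log₂ t` of the Shannon entropy. -/
noncomputable def bits (t : ℝ) : ℝ := -(t * Real.logb 2 t)

lemma bits_zero : bits 0 = 0 := by simp [bits]

lemma bits_one : bits 1 = 0 := by simp [bits]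

lemma bits_nonneg {t : ℝ} (h0 : 0 ≤ t) (h1 : t ≤ 1) : 0 ≤ bits t := by
  have : Real.logb 2 t ≤ 0 := Real.logb_nonpos (by norm_num) h0 h1
  unfold bits; nlinarith

lemma log_two_gt_half : (1 / 2 : ℝ) < Real.log 2 := by
  have := Real.log_two_gt_d9; linarith

/-- This is `log t ≥ 1 - 1/t` multiplied by `t`. The bound is linear in `1 - t`, so it stays useful
for `t` near `1`. -/
lemma bits_le {t : ℝ} (h0 : 0 ≤ t) : bits t ≤ (1 - t) / Real.log 2 := by
  have hl : 0 < Real.log 2 := Real.log_pos (by norm_num)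
  rcases h0.eq_or_lt with rfl | h
  · rw [bits_zero]; simp only [sub_zero]; positivity
  · have h1 := Real.one_sub_inv_le_log_of_pos h
    have h2 : -(t * Real.log t) ≤ 1 - t := by
      have := mul_le_mul_of_nonneg_left h1 h0
      rw [mul_sub, mul_inv_cancel₀ h.ne'] at this
      linarith
    have h3 : bits t = -(t * Real.log t) / Real.log 2 := by
      unfold bits Real.logb; ring
    rw [h3]; gcongr

lemma bits_le_two {t : ℝ} (h0 : 0 ≤ t) : bits t ≤ 2 := by
  refine (bits_le h0).trans ?_
  rw [div_le_iff₀ (by linarith [log_two_gt_half])]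
  linarith [log_two_gt_half]

lemma continuous_bits : Continuous bits := by
  have : bits = fun t => Real.negMulLog t / Real.log 2 := by
    funext t; unfold bits Real.logb Real.negMulLog; ring
  rw [this]; exact Real.continuous_negMulLog.div_const _

lemma mul_bits_div {p q : ℝ} (h : p = 0 → q = 0) :
    p * bits (q / p) = -(q * Real.logb 2 (q / p)) := by
  rcases eq_or_ne p 0 with hp | hp
  · simp [hp, h hp]
  · unfold bits; field_simp

/-- Gibbs' inequality for finite sums. -/
lemma gibbs_sum {ι : Type*} (s : Finset ι) (p c : ι → ℝ) (hp : ∀ i ∈ s, 0 ≤ p i)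
    (hc : ∀ i ∈ s, 0 < p i → 0 < c i)
    (hsum : ∑ i ∈ s with 0 < p i, c i ≤ ∑ i ∈ s, p i) :
    ∑ i ∈ s, bits (p i) ≤ ∑ i ∈ s, -(p i * Real.logb 2 (c i)) := by
  have hl : 0 < Real.log 2 := Real.log_pos (by norm_num)
  have h1 : ∀ i ∈ s, bits (p i) - -(p i * Real.logb 2 (c i)) ≤
      ((if 0 < p i then c i else 0) - p i) / Real.log 2 := by
    intro i hi
    rcases (hp i hi).eq_or_lt with h | h
    · simp [← h, bits_zero]
    · have hci := hc i hi h
      rw [if_pos h]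
      have h2 := Real.log_le_sub_one_of_pos (div_pos hci h)
      rw [Real.log_div hci.ne' h.ne'] at h2
      have h3 := mul_le_mul_of_nonneg_left h2 h.le
      have h4 : p i * (c i / p i - 1) = c i - p i := by field_simp
      rw [h4] at h3
      have : bits (p i) - -(p i * Real.logb 2 (c i)) =
          (p i * (Real.log (c i) - Real.log (p i))) / Real.log 2 := by
        unfold bits Real.logb; ring
      rw [this]; gcongr
  have h2 := Finset.sum_le_sum h1
  rw [Finset.sum_sub_distrib, ← Finset.sum_div, Finset.sum_sub_distrib, ← Finset.sum_filter] at h2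
  have : (∑ i ∈ s with 0 < p i, c i - ∑ i ∈ s, p i) / Real.log 2 ≤ 0 :=
    div_nonpos_of_nonpos_of_nonneg (by linarith) hl.le
  linarith

/-! ### Entropy of finitely valued variables and the chain rule -/

section Finite

variable {Ω : Type*} [MeasurableSpace Ω] {S T : Type*}

lemma entropy_eq_sum (μ : Measure Ω) (Y : Ω → S) (F : Finset S) (hF : ∀ ω, Y ω ∈ F) :
    entropy μ Y = ∑ s ∈ F, bits (μ.real (Y ⁻¹' {s})) := by
  unfold entropy bits
  rw [tsum_eq_sum (s := F), Finset.sum_neg_distrib]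
  intro b hb
  have : Y ⁻¹' {b} = ∅ := by
    ext ω; simp only [Set.mem_preimage, Set.mem_singleton_iff, Set.mem_empty_iff_false, iff_false]
    rintro rfl; exact hb (hF ω)
  simp [this]

lemma condEntropy_eq_sum (μ : Measure Ω) [IsFiniteMeasure μ] (Y : Ω → S) (Z : Ω → T)
    (F : Finset S) (G : Finset T) (hF : ∀ ω, Y ω ∈ F) (hG : ∀ ω, Z ω ∈ G)
    (hZ : ∀ z, MeasurableSet (Z ⁻¹' {z})) :
    condEntropy μ Y Z = ∑ z ∈ G, ∑ s ∈ F,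
      μ.real (Z ⁻¹' {z}) * bits (μ.real (Z ⁻¹' {z} ∩ Y ⁻¹' {s}) / μ.real (Z ⁻¹' {z})) := by
  unfold condEntropy
  rw [tsum_eq_sum (s := G)]
  · refine Finset.sum_congr rfl fun z _ => ?_
    rw [entropy_eq_sum _ Y F hF, Finset.mul_sum]
    refine Finset.sum_congr rfl fun s _ => ?_
    rw [measureReal_def (μ[|Z ⁻¹' {z}]), cond_apply (hZ z), ENNReal.toReal_mul, ENNReal.toReal_inv, div_eq_inv_mul]
    rfl
  · intro b hb
    have : Z ⁻¹' {b} = ∅ := by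
      ext ω
      simp only [Set.mem_preimage, Set.mem_singleton_iff, Set.mem_empty_iff_false, iff_false]
      rintro rfl; exact hb (hG ω)
    simp [this]

lemma real_preimage_comp [Fintype S] [DecidableEq T] (μ : Measure Ω) [IsFiniteMeasure μ]
    (W : Ω → S) (hW : ∀ s, MeasurableSet (W ⁻¹' {s})) (f : S → T) (t : T) :
    μ.real ((fun ω => f (W ω)) ⁻¹' {t}) = ∑ s with f s = t, μ.real (W ⁻¹' {s}) := by
  have : (fun ω => f (W ω)) ⁻¹' {t} = ⋃ s ∈ ({s | f s = t} : Finset S), W ⁻¹' {s} := by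
    ext ω; simp
  rw [this, measureReal_biUnion_finset]
  · intro s _ s' _ h
    refine Set.disjoint_left.2 fun ω h1 h2 => h ?_
    simp only [Set.mem_preimage, Set.mem_singleton_iff] at h1 h2
    rw [← h1, ← h2]
  · exact fun s _ => hW s

/-- Rewrites expectations of functions of `f W` as sums over the values of `W`, so that all
entropies in the chain rule become sums over one index set. -/
lemma sum_real_preimage_comp_mul [Fintype S] [DecidableEq T] (μ : Measure Ω) [IsFiniteMeasure μ]
    (W : Ω → S) (hW : ∀ s, MeasurableSet (W ⁻¹' {s})) (f : S → T) (F : Finset T)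
    (hF : ∀ s, f s ∈ F) (h : T → ℝ) :
    ∑ t ∈ F, μ.real ((fun ω => f (W ω)) ⁻¹' {t}) * h t =
      ∑ s, μ.real (W ⁻¹' {s}) * h (f s) := by
  rw [← Finset.sum_fiberwise_of_maps_to (s := Finset.univ) (t := F) (g := f) (fun s _ => hF s)]
  refine Finset.sum_congr rfl fun t _ => ?_
  rw [real_preimage_comp μ W hW, Finset.sum_mul]
  refine Finset.sum_congr rfl fun s hs => ?_
  rw [(Finset.mem_filter.1 hs).2]

lemma sum_real_preimage [Fintype S] (μ : Measure Ω) [IsProbabilityMeasure μ]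
    (W : Ω → S) (hW : ∀ s, MeasurableSet (W ⁻¹' {s})) :
    ∑ s, μ.real (W ⁻¹' {s}) = 1 := by
  classical
  have := real_preimage_comp μ W hW (fun _ => ()) ()
  simpa using this.symm

lemma real_preimage_inter_eq (μ : Measure Ω) {R : Type*} (Z : Ω → T) (Y : Ω → R) (z : T) (y : R) :
    μ.real (Z ⁻¹' {z} ∩ Y ⁻¹' {y}) = μ.real ((fun ω => (Z ω, Y ω)) ⁻¹' {(z, y)}) := by
  congr 1; ext ω; simp

lemma measurableSet_preimage_comp [Finite S] (W : Ω → S)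
    (hW : ∀ s, MeasurableSet (W ⁻¹' {s})) (f : S → T) (t : T) :
    MeasurableSet ((fun ω => f (W ω)) ⁻¹' {t}) := by
  have : (fun ω => f (W ω)) ⁻¹' {t} = ⋃ s ∈ {s | f s = t}, W ⁻¹' {s} := by
    ext ω; simp
  rw [this]; exact (Set.toFinite _).measurableSet_biUnion fun s _ => hW s

lemma real_preimage_le_comp (μ : Measure Ω) [IsFiniteMeasure μ] (W : Ω → S) (f : S → T) (s : S) :
    μ.real (W ⁻¹' {s}) ≤ μ.real ((fun ω => f (W ω)) ⁻¹' {f s}) := by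
  refine measureReal_mono ?_
  intro ω hω
  simp only [Set.mem_preimage, Set.mem_singleton_iff] at hω ⊢
  rw [hω]

/-- One step of the chain rule, with conditioning on the past replaced by conditioning on a
function of the past. -/
lemma entropy_le_add_condEntropy {S' : Type*} [Fintype S] [Fintype S'] (μ : Measure Ω)
    [IsProbabilityMeasure μ] (W' : Ω → S') (hW' : ∀ s, MeasurableSet (W' ⁻¹' {s}))
    (π : S' → S) (y : S' → ℕ) (ζ : S → ℕ)
    (hinj : ∀ ω ω', π (W' ω) = π (W' ω') → y (W' ω) = y (W' ω') → W' ω = W' ω') :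
    entropy μ W' ≤ entropy μ (fun ω => π (W' ω)) +
      condEntropy μ (fun ω => y (W' ω)) (fun ω => ζ (π (W' ω))) := by
  classical
  set p : S' → ℝ := fun s => μ.real (W' ⁻¹' {s}) with hp
  set PW : S → ℝ := fun w => μ.real ((fun ω => π (W' ω)) ⁻¹' {w}) with hPW
  set PZ : ℕ → ℝ := fun z => μ.real ((fun ω => ζ (π (W' ω))) ⁻¹' {z}) with hPZ
  set PZY : ℕ × ℕ → ℝ := fun v => μ.real ((fun ω => (ζ (π (W' ω)), y (W' ω))) ⁻¹' {v}) with hPZY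
  set FY : Finset ℕ := Finset.univ.image y
  set FZ : Finset ℕ := Finset.univ.image (fun s => ζ (π s))
  have hzero : ∀ z b, PZ z = 0 → PZY (z, b) = 0 := by
    intro z b h
    refine le_antisymm (le_trans ?_ h.le) measureReal_nonneg
    refine measureReal_mono ?_
    intro ω hω
    simp only [Set.mem_preimage, Set.mem_singleton_iff, Prod.mk.injEq] at hω ⊢
    exact hω.1
  have e1 : entropy μ (fun ω => π (W' ω)) = ∑ s, -(p s * Real.logb 2 (PW (π s))) := by
    rw [entropy_eq_sum μ _ Finset.univ (fun _ => Finset.mem_univ _)]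
    have := sum_real_preimage_comp_mul μ W' hW' π Finset.univ (fun _ => Finset.mem_univ _)
      (fun w => Real.logb 2 (PW w))
    rw [Finset.sum_neg_distrib, ← this, ← Finset.sum_neg_distrib]
    rfl
  have e2 : condEntropy μ (fun ω => y (W' ω)) (fun ω => ζ (π (W' ω))) =
      ∑ s, -(p s * Real.logb 2 (PZY (ζ (π s), y s) / PZ (ζ (π s)))) := by
    rw [condEntropy_eq_sum μ _ _ (Finset.univ.image y) (Finset.univ.image (fun s => ζ (π s)))
      (fun ω => Finset.mem_image_of_mem y (Finset.mem_univ _))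
      (fun ω => Finset.mem_image_of_mem (fun s => ζ (π s)) (Finset.mem_univ _))
      (fun z => measurableSet_preimage_comp W' hW' (fun s => ζ (π s)) z)]
    have := sum_real_preimage_comp_mul μ W' hW' (fun s => (ζ (π s), y s)) (FZ ×ˢ FY)
      (fun s => Finset.mem_product.2 ⟨Finset.mem_image_of_mem (fun s => ζ (π s)) (Finset.mem_univ s),
        Finset.mem_image_of_mem y (Finset.mem_univ s)⟩)
      (fun v => Real.logb 2 (PZY v / PZ v.1))
    rw [Finset.sum_neg_distrib, ← this, ← Finset.sum_neg_distrib, Finset.sum_product]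
    refine Finset.sum_congr rfl fun z _ => Finset.sum_congr rfl fun b _ => ?_
    rw [real_preimage_inter_eq]
    exact mul_bits_div (hzero z b)
  have e3 : entropy μ W' = ∑ s, bits (p s) := entropy_eq_sum μ _ Finset.univ (by simp)
  -- The comparison weights: draw the past from its true law, then `y` from its conditional law
  -- given only the function `ζ` of the past. The cross entropy against `c` is the right-hand side,
  -- so Gibbs' inequality finishes the proof.
  set c : S' → ℝ := fun s => PW (π s) * (PZY (ζ (π s), y s) / PZ (ζ (π s))) with hc
  have hpos : ∀ s, 0 < p s → 0 < PW (π s) ∧ 0 < PZY (ζ (π s), y s) ∧ 0 < PZ (ζ (π s)) :=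
    fun s h => ⟨h.trans_le (real_preimage_le_comp μ W' π s), h.trans_le (real_preimage_le_comp μ W' (fun s => (ζ (π s), y s)) s),
      h.trans_le (real_preimage_le_comp μ W' (fun s => ζ (π s)) s)⟩
  have e4 : ∑ s, bits (p s) ≤ ∑ s, -(p s * Real.logb 2 (c s)) := by
    refine gibbs_sum _ _ _ (fun _ _ => measureReal_nonneg) (fun s _ h => ?_) ?_
    · obtain ⟨h1, h2, h3⟩ := hpos s h
      exact mul_pos h1 (div_pos h2 h3)
    · rw [sum_real_preimage μ W' hW']
      -- The pair `(π, y)` need only separate values that `W'` attains; an arbitrary graph is not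
      -- determined by its left-neighbour counts.
      have hinj' : Set.InjOn (fun s => (π s, y s)) ({s ∈ Finset.univ | 0 < p s} : Finset S') := by
        have ex : ∀ s, 0 < p s → ∃ ω, W' ω = s := by
          intro s h
          by_contra hne
          push Not at hne
          have : W' ⁻¹' {s} = ∅ := by ext ω; simpa using hne ω
          simp [hp, this] at h
        intro s hs s' hs' h
        simp only [Finset.coe_filter, Finset.mem_univ, true_and, Set.mem_ofPred_eq] at hs hs'
        obtain ⟨ω, rfl⟩ := ex s hs
        obtain ⟨ω', rfl⟩ := ex s' hs'
        simp only [Prod.mk.injEq] at h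
        exact hinj ω ω' h.1 h.2
      have : ∑ s with 0 < p s, c s =
          ∑ v ∈ ({s ∈ Finset.univ | 0 < p s} : Finset S').image (fun s => (π s, y s)),
            PW v.1 * (PZY (ζ v.1, v.2) / PZ (ζ v.1)) := by
        rw [Finset.sum_image hinj']
      rw [this]
      calc _ ≤ ∑ v ∈ (Finset.univ : Finset S) ×ˢ FY, PW v.1 * (PZY (ζ v.1, v.2) / PZ (ζ v.1)) := by
            refine Finset.sum_le_sum_of_subset_of_nonneg ?_ ?_
            · intro v hv
              obtain ⟨s, -, rfl⟩ := Finset.mem_image.1 hv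
              exact Finset.mem_product.2 ⟨Finset.mem_univ _, Finset.mem_image_of_mem y (Finset.mem_univ s)⟩
            · intro v _ _
              exact mul_nonneg measureReal_nonneg (div_nonneg measureReal_nonneg measureReal_nonneg)
        _ = ∑ w, PW w * ((∑ b ∈ FY, PZY (ζ w, b)) / PZ (ζ w)) := by
            rw [Finset.sum_product]
            refine Finset.sum_congr rfl fun w _ => ?_
            rw [Finset.sum_div, Finset.mul_sum]
        -- Only an inequality: when `PZ` vanishes the quotient is `0` by convention, not `1`.
        _ ≤ ∑ w, PW w * 1 := by
            refine Finset.sum_le_sum fun w _ => mul_le_mul_of_nonneg_left ?_ measureReal_nonneg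
            refine div_le_one_of_le₀ ?_ measureReal_nonneg
            have hd : ∑ b ∈ FY, PZY (ζ w, b) = μ.real (⋃ b ∈ FY,
                (fun ω => (ζ (π (W' ω)), y (W' ω))) ⁻¹' {(ζ w, b)}) := by
              rw [measureReal_biUnion_finset]
              · intro b _ b' _ hb
                refine Set.disjoint_left.2 fun ω h1 h2 => hb ?_
                simp only [Set.mem_preimage, Set.mem_singleton_iff, Prod.mk.injEq] at h1 h2
                rw [← h1.2, ← h2.2]
              · exact fun b _ => measurableSet_preimage_comp W' hW' (fun s => (ζ (π s), y s)) (ζ w, b)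
            rw [hd]
            refine measureReal_mono ?_
            intro ω hω
            simp only [Set.mem_iUnion, Set.mem_preimage, Set.mem_singleton_iff, Prod.mk.injEq] at hω ⊢
            obtain ⟨_, _, h, _⟩ := hω
            exact h
        _ = 1 := by
            simp only [mul_one]
            exact sum_real_preimage μ _ (fun w => measurableSet_preimage_comp W' hW' π w)
  rw [e1, e2, e3, ← Finset.sum_add_distrib]
  refine e4.trans (le_of_eq (Finset.sum_congr rfl fun s _ => ?_))
  rcases (measureReal_nonneg (μ := μ) (s := W' ⁻¹' {s})).eq_or_lt with h | h
  · have : p s = 0 := h.symm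
    simp [this]
  · obtain ⟨h1, h2, h3⟩ := hpos s h
    rw [hc, Real.logb_mul h1.ne' (div_pos h2 h3).ne']
    ring

/-- Gibbs' inequality for conditional entropies. -/
lemma condEntropy_le_of_kernel (μ : Measure Ω) [IsProbabilityMeasure μ] (Y Z : Ω → ℕ) (N : ℕ)
    (hY : ∀ ω, Y ω < N) (hZ : ∀ ω, Z ω < N)
    (mZ : ∀ z, MeasurableSet (Z ⁻¹' {z})) (mY : ∀ z, MeasurableSet (Y ⁻¹' {z}))
    (q : ℕ → ℕ → ℝ) (hq0 : ∀ a b, 0 ≤ q a b) (hq : ∀ a, ∑ b ∈ Finset.range N, q a b ≤ 1)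
    (hpos : ∀ a b, 0 < μ.real (Z ⁻¹' {a} ∩ Y ⁻¹' {b}) → 0 < q a b) :
    condEntropy μ Y Z ≤ ∑ a ∈ Finset.range N, ∑ b ∈ Finset.range N,
      -(μ.real (Z ⁻¹' {a} ∩ Y ⁻¹' {b}) * Real.logb 2 (q a b)) := by
  have hle : ∀ a b, μ.real (Z ⁻¹' {a} ∩ Y ⁻¹' {b}) ≤ μ.real (Z ⁻¹' {a}) :=
    fun a b => measureReal_mono Set.inter_subset_left
  have hmarg : ∀ a, ∑ b ∈ Finset.range N, μ.real (Z ⁻¹' {a} ∩ Y ⁻¹' {b}) = μ.real (Z ⁻¹' {a}) := by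
    intro a
    rw [← measureReal_biUnion_finset]
    · congr 1; ext ω; simp [hY ω]
    · intro b _ b' _ hb
      refine Set.disjoint_left.2 fun ω h1 h2 => hb ?_
      simp only [Set.mem_inter_iff, Set.mem_preimage, Set.mem_singleton_iff] at h1 h2
      rw [← h1.2, ← h2.2]
    · exact fun b _ => (mZ a).inter (mY b)
  rw [condEntropy_eq_sum μ Y Z (Finset.range N) (Finset.range N) (by simpa using hY)
    (by simpa using hZ) mZ]
  refine Finset.sum_le_sum fun a _ => ?_
  -- Gibbs is applied to the unnormalized joint weights, with the kernel scaled by the probability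
  -- of `Z = a`. Dividing out that probability adds the same logarithm to both sides, which is what
  -- `h1` and `h2` record.
  have key := gibbs_sum (Finset.range N) (fun b => μ.real (Z ⁻¹' {a} ∩ Y ⁻¹' {b}))
    (fun b => μ.real (Z ⁻¹' {a}) * q a b) (fun _ _ => measureReal_nonneg)
    (fun b _ h => mul_pos (h.trans_le (hle a b)) (hpos a b h)) (by
      rw [hmarg]
      calc _ ≤ ∑ b ∈ Finset.range N, μ.real (Z ⁻¹' {a}) * q a b :=
            Finset.sum_le_sum_of_subset_of_nonneg (Finset.filter_subset _ _)
              fun b _ _ => mul_nonneg measureReal_nonneg (hq0 a b)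
        _ ≤ μ.real (Z ⁻¹' {a}) * 1 := by
            rw [← Finset.mul_sum]
            exact mul_le_mul_of_nonneg_left (hq a) measureReal_nonneg
        _ = _ := mul_one _)
  have h1 : ∀ b, μ.real (Z ⁻¹' {a}) * bits (μ.real (Z ⁻¹' {a} ∩ Y ⁻¹' {b}) / μ.real (Z ⁻¹' {a})) =
      bits (μ.real (Z ⁻¹' {a} ∩ Y ⁻¹' {b})) +
        μ.real (Z ⁻¹' {a} ∩ Y ⁻¹' {b}) * Real.logb 2 (μ.real (Z ⁻¹' {a})) := by
    intro b
    rw [mul_bits_div (fun h => le_antisymm (h ▸ hle a b) measureReal_nonneg)]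
    rcases (measureReal_nonneg (μ := μ) (s := Z ⁻¹' {a} ∩ Y ⁻¹' {b})).eq_or_lt with h | h
    · simp [← h, bits_zero]
    · rw [Real.logb_div h.ne' (h.trans_le (hle a b)).ne']
      unfold bits; ring
  have h2 : ∀ b, -(μ.real (Z ⁻¹' {a} ∩ Y ⁻¹' {b}) * Real.logb 2 (q a b)) =
      -(μ.real (Z ⁻¹' {a} ∩ Y ⁻¹' {b}) * Real.logb 2 (μ.real (Z ⁻¹' {a}) * q a b)) +
        μ.real (Z ⁻¹' {a} ∩ Y ⁻¹' {b}) * Real.logb 2 (μ.real (Z ⁻¹' {a})) := by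
    intro b
    rcases (measureReal_nonneg (μ := μ) (s := Z ⁻¹' {a} ∩ Y ⁻¹' {b})).eq_or_lt with h | h
    · simp [← h]
    · rw [Real.logb_mul (h.trans_le (hle a b)).ne' (hpos a b h).ne']
      ring
  rw [Finset.sum_congr rfl fun b _ => h1 b, Finset.sum_congr rfl fun b _ => h2 b,
    Finset.sum_add_distrib, Finset.sum_add_distrib]
  gcongr

end Finite

/-! ### Left-neighbour counts determine the ordered graph -/

section Graph

variable {n : ℕ}

lemma monotone_orderStat (x : Fin n → ℝ) : Monotone (orderStat x) := Tuple.monotone_sort x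

/-- Sorting permutes the coordinates, so it does not change how many are at most `c`. Expressing the
order statistics through such counts makes them visibly measurable. -/
lemma orderStat_le_iff (x : Fin n → ℝ) (k : Fin n) (c : ℝ) :
    orderStat x k ≤ c ↔ (k : ℕ) < ({l | x l ≤ c} : Finset (Fin n)).card := by
  have h := Tuple.lt_card_le_iff_apply_le_of_monotone (j := k) (a := c) (monotone_orderStat x)
  rw [← h, ← Finset.card_map (Tuple.sort x).toEmbedding]
  have : Finset.map (Tuple.sort x).toEmbedding (Finset.univ.filter fun i => orderStat x i ≤ c) =
      Finset.univ.filter fun l => x l ≤ c := by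
    ext l
    rw [Finset.mem_map, Finset.mem_filter_univ]
    constructor
    · rintro ⟨a, ha, rfl⟩; exact (Finset.mem_filter.1 ha).2
    · intro hl; exact ⟨(Tuple.sort x).symm l, Finset.mem_filter.2 ⟨Finset.mem_univ _, by simpa [orderStat] using hl⟩, by simp⟩
  rw [this]

lemma measurable_orderStat (k : Fin n) : Measurable (fun x : Fin n → ℝ => orderStat x k) := by
  refine measurable_of_Iic fun c => ?_
  have : (fun x : Fin n → ℝ => orderStat x k) ⁻¹' Set.Iic c =
      {x | (k : ℕ) < ∑ l, if x l ≤ c then 1 else 0} := by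
    ext x
    simp only [Set.mem_preimage, Set.mem_Iic, orderStat_le_iff, Finset.card_filter]
    rfl
  rw [this]
  refine measurableSet_lt measurable_const ?_
  refine Finset.measurable_sum _ fun l _ => ?_
  exact Measurable.ite (measurableSet_le (measurable_pi_apply l) measurable_const)
    measurable_const measurable_const

lemma measurableSet_orderedGraph_eq (r : ℝ) (g : SimpleGraph (Fin n)) :
    MeasurableSet ((fun x : Fin n → ℝ => orderedGraph x r) ⁻¹' {g}) := by
  have : (fun x : Fin n → ℝ => orderedGraph x r) ⁻¹' {g} =
      ⋂ i, ⋂ j, {x : Fin n → ℝ | (i ≠ j ∧ |orderStat x i - orderStat x j| ≤ r) ↔ g.Adj i j} := by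
    ext x
    simp only [Set.mem_preimage, Set.mem_singleton_iff, Set.mem_iInter]
    constructor
    · rintro rfl i j; exact Iff.rfl
    · intro h; ext i j; exact h i j
  rw [this]
  refine MeasurableSet.iInter fun i => MeasurableSet.iInter fun j => ?_
  have hm : MeasurableSet {x : Fin n → ℝ | |orderStat x i - orderStat x j| ≤ r} := by
    refine measurableSet_le ?_ measurable_const
    exact ((measurable_orderStat i).sub (measurable_orderStat j)).abs
  by_cases hg : g.Adj i j
  · simp only [hg, iff_true, hg.ne, ne_eq, not_false_eq_true, true_and]; exact hm
  · by_cases hij : i = j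
    · simp [hij]
    · simp only [hg, iff_false, hij, ne_eq, not_false_eq_true, true_and]; exact hm.compl

lemma leftNeighbors_eq_card (G : SimpleGraph (Fin n)) [DecidableRel G.Adj] (v : Fin n) :
    leftNeighbors G (v + 1) = ({j | j < v ∧ G.Adj j v} : Finset (Fin n)).card := by
  unfold leftNeighbors
  rw [← Set.ncard_coe_finset]
  congr 1; ext j
  simp only [Finset.coe_filter, Finset.mem_univ, true_and]
  constructor
  · rintro ⟨w, hw, h⟩
    have : w = v := Fin.ext (by omega)
    exact this ▸ h
  · intro h; exact ⟨v, rfl, h⟩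

lemma leftNeighbors_lt (G : SimpleGraph (Fin n)) (i : ℕ) : leftNeighbors G i < n + 1 := by
  refine Nat.lt_succ_of_le ?_
  unfold leftNeighbors
  exact (Set.ncard_le_ncard (Set.subset_univ _)).trans (by simp [Set.ncard_univ])

/-- The graph obtained from `G` by keeping only the edges between the first `i` nodes. -/
def firstNodes (i : ℕ) (G : SimpleGraph (Fin n)) : SimpleGraph (Fin n) where
  Adj u v := G.Adj u v ∧ (u : ℕ) < i ∧ (v : ℕ) < i
  symm := ⟨fun _ _ h => ⟨h.1.symm, h.2.2, h.2.1⟩⟩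
  loopless := ⟨fun _ h => h.1.ne rfl⟩

lemma firstNodes_self (G : SimpleGraph (Fin n)) : firstNodes n G = G := by
  ext u v; simp [firstNodes]

lemma firstNodes_firstNodes {i j : ℕ} (h : i ≤ j) (G : SimpleGraph (Fin n)) :
    firstNodes i (firstNodes j G) = firstNodes i G := by
  ext u v; simp only [firstNodes]; constructor
  · rintro ⟨⟨h1, _⟩, h2⟩; exact ⟨h1, h2⟩
  · rintro ⟨h1, h2, h3⟩; exact ⟨⟨h1, by omega, by omega⟩, h2, h3⟩

lemma leftNeighbors_firstNodes {i j : ℕ} (h : i ≤ j) (G : SimpleGraph (Fin n)) :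
    leftNeighbors (firstNodes j G) i = leftNeighbors G i := by
  unfold leftNeighbors
  congr 1; ext u
  constructor
  · rintro ⟨v, hv, huv, h1⟩; exact ⟨v, hv, huv, h1.1⟩
  · rintro ⟨v, hv, huv, h1⟩
    have := Fin.lt_def.1 huv
    exact ⟨v, hv, huv, h1, by omega, by omega⟩

lemma orderedGraph_adj_of_lt (x : Fin n → ℝ) (r : ℝ) {u v : Fin n} (h : u < v) :
    (orderedGraph x r).Adj u v ↔ orderStat x v - orderStat x u ≤ r := by
  have := monotone_orderStat x h.le
  simp only [orderedGraph, ne_eq, h.ne, not_false_eq_true, true_and]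
  rw [abs_sub_comm, abs_of_nonneg (by linarith)]

/-- In either graph the left neighbours of `v` are the indices from some cutoff up to `v - 1`. If
`u` were a neighbour for `x` but not for `x'`, the block for `x'` would be strictly contained in
that for `x`, contradicting equal counts. -/
lemma orderedGraph_adj_iff_of_leftNeighbors_eq (x x' : Fin n → ℝ) (r : ℝ) {u v : Fin n}
    (huv : u < v)
    (h : leftNeighbors (orderedGraph x r) (v + 1) = leftNeighbors (orderedGraph x' r) (v + 1)) :
    (orderedGraph x r).Adj u v → (orderedGraph x' r).Adj u v := by
  classical
  intro hu
  by_contra hu'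
  rw [leftNeighbors_eq_card, leftNeighbors_eq_card] at h
  refine h.not_gt (Finset.card_lt_card ?_)
  rw [Finset.ssubset_iff_of_subset]
  · refine ⟨u, ?_, ?_⟩
    · simp [huv, hu]
    · simp [hu']
  · intro w hw
    simp only [Finset.mem_filter, Finset.mem_univ, true_and] at hw ⊢
    refine ⟨hw.1, ?_⟩
    rw [orderedGraph_adj_of_lt _ _ huv] at hu hu'
    have hw2 := hw.2
    rw [orderedGraph_adj_of_lt _ _ hw.1] at hw2 ⊢
    rcases le_total u w with h1 | h1
    · have := monotone_orderStat x h1; linarith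
    · have := monotone_orderStat x' h1; linarith

/-- The injectivity hypothesis of the chain rule: an edge among the first `m + 1` nodes either lies
among the first `m`, or ends at the new node, where the count determines it. -/
lemma firstNodes_succ_orderedGraph_inj (x x' : Fin n → ℝ) (r : ℝ) (m : ℕ)
    (h : firstNodes m (orderedGraph x r) = firstNodes m (orderedGraph x' r))
    (hL : leftNeighbors (orderedGraph x r) (m + 1) = leftNeighbors (orderedGraph x' r) (m + 1)) :
    firstNodes (m + 1) (orderedGraph x r) = firstNodes (m + 1) (orderedGraph x' r) := by
  have key : ∀ u v : Fin n, u < v → ((firstNodes (m + 1) (orderedGraph x r)).Adj u v ↔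
      (firstNodes (m + 1) (orderedGraph x' r)).Adj u v) := by
    intro u v huv
    have huv' := Fin.lt_def.1 huv
    simp only [firstNodes]
    rcases lt_trichotomy (v : ℕ) m with hv | hv | hv
    · have h1 : (firstNodes m (orderedGraph x r)).Adj u v ↔
        (firstNodes m (orderedGraph x' r)).Adj u v := by rw [h]
      simp only [firstNodes, show (u : ℕ) < m by omega, hv, and_self, and_true] at h1
      simp only [h1]
    · subst hv
      have : (orderedGraph x r).Adj u v ↔ (orderedGraph x' r).Adj u v :=
        ⟨orderedGraph_adj_iff_of_leftNeighbors_eq x x' r huv hL,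
          orderedGraph_adj_iff_of_leftNeighbors_eq x' x r huv hL.symm⟩
      simp only [this]
    · have : ¬ (v : ℕ) < m + 1 := by omega
      simp [this]
  ext u v
  rcases lt_trichotomy u v with h1 | h1 | h1
  · exact key u v h1
  · simp [h1]
  · rw [SimpleGraph.adj_comm, key v u h1, SimpleGraph.adj_comm]

end Graph

/-! ### The entropy bound by iterating the chain rule -/

section Chain

variable {Ω : Type*} [MeasurableSpace Ω] {n : ℕ}

/-- Lets the term `H(L 2)` arise from the same chain-rule step as the others, with a trivial past.
-/
lemma condEntropy_const {S : Type*} (μ : Measure Ω) [IsProbabilityMeasure μ] (Y : Ω → S) (c : ℕ) :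
    condEntropy μ Y (fun _ => c) = entropy μ Y := by
  unfold condEntropy
  rw [tsum_eq_single c]
  · simp
  · intro b hb
    simp [Set.preimage_const_of_notMem, hb.symm]

lemma entropy_firstNodes_le (μ : Measure Ω) [IsProbabilityMeasure μ] (X : Ω → Fin n → ℝ)
    (hX : Measurable X) (r : ℝ) (m : ℕ) :
    entropy μ (fun ω => firstNodes (m + 2) (orderedGraph (X ω) r)) ≤
      entropy μ (fun ω => leftNeighbors (orderedGraph (X ω) r) 2) +
        ∑ i ∈ Finset.Icc 2 (m + 1), condEntropy μ
          (fun ω => leftNeighbors (orderedGraph (X ω) r) (i + 1))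
          (fun ω => leftNeighbors (orderedGraph (X ω) r) i) := by
  classical
  have hG : ∀ g, MeasurableSet ((fun ω => orderedGraph (X ω) r) ⁻¹' {g}) :=
    fun g => hX (measurableSet_orderedGraph_eq r g)
  have hW : ∀ k g, MeasurableSet ((fun ω => firstNodes k (orderedGraph (X ω) r)) ⁻¹' {g}) :=
    fun k g => measurableSet_preimage_comp _ hG (firstNodes k) g
  induction m with
  | zero =>
    -- The past is a one-point type: the graph on the first node has no edges, so `L 2` alone
    -- determines the graph on two nodes.
    have h := entropy_le_add_condEntropy μ (fun ω => firstNodes 2 (orderedGraph (X ω) r))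
      (hW 2) (fun _ => ()) (fun G => leftNeighbors G 2) (fun _ => 0) (by
        intro ω ω' _ h
        simp only [leftNeighbors_firstNodes le_rfl] at h
        refine firstNodes_succ_orderedGraph_inj _ _ r 1 ?_ h
        ext u v
        simp only [firstNodes, Nat.lt_one_iff]
        constructor <;>
        · rintro ⟨h1, h2, h3⟩
          exact absurd (Fin.ext (h2.trans h3.symm)) h1.ne)
    rw [condEntropy_const] at h
    simp only [leftNeighbors_firstNodes le_rfl] at h
    have h0 : entropy μ (fun _ : Ω => ()) = 0 := by
      rw [entropy_eq_sum μ _ Finset.univ (by simp)]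
      simp [bits_one]
    rw [h0] at h
    simpa using h
  | succ m ih =>
    have h := entropy_le_add_condEntropy μ (fun ω => firstNodes (m + 3) (orderedGraph (X ω) r))
      (hW _) (firstNodes (m + 2)) (fun G => leftNeighbors G (m + 3))
      (fun G => leftNeighbors G (m + 2)) (by
        intro ω ω' h1 h
        simp only [leftNeighbors_firstNodes le_rfl] at h
        rw [firstNodes_firstNodes (by omega), firstNodes_firstNodes (by omega)] at h1
        exact firstNodes_succ_orderedGraph_inj _ _ r (m + 2) h1 h)
    simp only [leftNeighbors_firstNodes le_rfl, firstNodes_firstNodes (show m + 2 ≤ m + 3 by omega)] at h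
    rw [Finset.sum_Icc_succ_top (by omega), ← add_assoc]
    exact h.trans (by gcongr)

lemma entropy_le_chainBound (μ : Measure Ω) [IsProbabilityMeasure μ] (X : Ω → Fin n → ℝ)
    (hX : Measurable X) (r : ℝ) (hn : 2 ≤ n) :
    entropy μ (fun ω => orderedGraph (X ω) r) ≤ chainBound μ (fun ω => orderedGraph (X ω) r) := by
  have h := entropy_firstNodes_le μ X hX r (n - 2)
  rw [show n - 2 + 2 = n by omega, show n - 2 + 1 = n - 1 by omega] at h
  simp only [firstNodes_self] at h
  exact h

end Chain

/-! ### Law of the order statistics and reversal of spacings -/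

section OrderStatLaw

variable {n : ℕ}

/-- Lebesgue measure on the open unit cube. -/
noncomputable def cubeMeasure (n : ℕ) : Measure (Fin n → ℝ) :=
  volume.restrict (Set.univ.pi fun _ => Set.Ioo (0 : ℝ) 1)

lemma measurableSet_cube : MeasurableSet (Set.univ.pi fun _ : Fin n => Set.Ioo (0 : ℝ) 1) :=
  MeasurableSet.univ_pi fun _ => measurableSet_Ioo

instance : IsProbabilityMeasure (cubeMeasure n) :=
  ⟨by rw [cubeMeasure, Measure.restrict_apply_univ, Real.volume_pi_Ioo]; simp⟩

lemma cubeMeasure_eq_pi :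
    cubeMeasure n = Measure.pi fun _ => volume.restrict (Set.Icc (0 : ℝ) 1) := by
  rw [cubeMeasure, volume_pi, Measure.restrict_pi_pi]
  congr 1; funext _; exact Measure.restrict_congr_set Ioo_ae_eq_Icc

lemma volume_coord_eq_null {i j : Fin n} (h : i ≠ j) :
    volume {x : Fin n → ℝ | x i = x j} = 0 := by
  let f : (Fin n → ℝ) →ₗ[ℝ] ℝ :=
    LinearMap.proj (R := ℝ) (φ := fun _ : Fin n => ℝ) i - LinearMap.proj (R := ℝ) j
  have hf : ∀ x, f x = x i - x j := fun x => rfl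
  have := Measure.addHaar_submodule (volume : Measure (Fin n → ℝ)) (LinearMap.ker f) (by
    intro htop
    have h1 : (Pi.single i 1 : Fin n → ℝ) ∈ LinearMap.ker f := by rw [htop]; trivial
    simp [hf, h.symm] at h1)
  convert this using 2
  ext x; simp [hf, sub_eq_zero]

lemma ae_injective : ∀ᵐ x : Fin n → ℝ, Function.Injective x := by
  have : ∀ᵐ x : Fin n → ℝ, ∀ i j, i ≠ j → x i ≠ x j := by
    rw [ae_all_iff]; intro i
    rw [ae_all_iff]; intro j
    by_cases h : i = j
    · simp [h]
    · have := volume_coord_eq_null h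
      filter_upwards [compl_mem_ae_iff.2 this] with x hx _
      exact hx
  filter_upwards [this] with x hx i j hij
  by_contra hne
  exact hx i j hne hij

/-- The strictly increasing sequences in the open unit interval. -/
def openSimplex (n : ℕ) : Set (Fin n → ℝ) := {y | StrictMono y ∧ ∀ i, y i ∈ Set.Ioo (0 : ℝ) 1}

lemma measurableSet_openSimplex : MeasurableSet (openSimplex n) := by
  have : openSimplex n = (⋂ i, ⋂ j, {y | i < j → y i < y j}) ∩
      (Set.univ.pi fun _ => Set.Ioo (0 : ℝ) 1) := by
    ext y; simp only [openSimplex, Set.mem_inter_iff, Set.mem_iInter, StrictMono]; simp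
  rw [this]
  refine MeasurableSet.inter (MeasurableSet.iInter fun i => MeasurableSet.iInter fun j => ?_)
    measurableSet_cube
  by_cases h : i < j
  · simp only [h, forall_const]
    exact measurableSet_lt (measurable_pi_apply i) (measurable_pi_apply j)
  · simp [h]

lemma orderStat_eq_comp_of_monotone (x : Fin n → ℝ) (σ : Equiv.Perm (Fin n))
    (h : Monotone (x ∘ σ)) : orderStat x = x ∘ σ :=
  (Tuple.comp_sort_eq_comp_iff_monotone.2 h).symm

/-- Up to the null set of points with a repeated coordinate, the cube is the disjoint union of the
`n!` coordinate permutations of the simplex, and on each piece sorting is a single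
measure-preserving permutation. -/
lemma cubeMeasure_orderStat_mem {P : Set (Fin n → ℝ)} (hP : MeasurableSet P) :
    cubeMeasure n {x | orderStat x ∈ P} = n.factorial * volume (openSimplex n ∩ P) := by
  have hmeas : MeasurableSet {x : Fin n → ℝ | orderStat x ∈ P} :=
    (measurable_pi_lambda _ fun k => measurable_orderStat k) hP
  have hmp : ∀ σ : Equiv.Perm (Fin n),
      MeasurePreserving (fun x : Fin n → ℝ => x ∘ σ) volume volume := by
    intro σ
    have := volume_measurePreserving_piCongrLeft (fun _ : Fin n => ℝ) σ.symm
    convert this using 1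
    ext x i
    have := MeasurableEquiv.coe_piCongrLeft (π := fun _ : Fin n => ℝ) σ.symm
    rw [this]
    have h2 := Equiv.piCongrLeft_apply_apply (fun _ : Fin n => ℝ) σ.symm x (σ i)
    rw [Equiv.symm_apply_apply] at h2
    rw [h2]; rfl
  have hΔ := measurableSet_openSimplex (n := n)
  rw [cubeMeasure, Measure.restrict_apply hmeas]
  have key : ({x : Fin n → ℝ | orderStat x ∈ P} ∩ Set.univ.pi fun _ => Set.Ioo (0 : ℝ) 1 :
        Set (Fin n → ℝ)) =ᵐ[volume]
      (⋃ σ : Equiv.Perm (Fin n), (fun x : Fin n → ℝ => x ∘ σ) ⁻¹' (openSimplex n ∩ P) :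
        Set (Fin n → ℝ)) := by
    filter_upwards [ae_injective] with x hx
    apply propext
    change (orderStat x ∈ P ∧ x ∈ Set.univ.pi fun _ => Set.Ioo (0 : ℝ) 1) ↔
      x ∈ (⋃ σ : Equiv.Perm (Fin n), (fun x : Fin n → ℝ => x ∘ σ) ⁻¹' (openSimplex n ∩ P))
    simp only [Set.mem_iUnion, Set.mem_preimage, Set.mem_inter_iff]
    constructor
    · rintro ⟨h1, h2⟩
      refine ⟨Tuple.sort x, ⟨?_, fun i => h2 _ trivial⟩, h1⟩
      exact (Tuple.monotone_sort x).strictMono_of_injective (hx.comp (Equiv.injective _))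
    · rintro ⟨σ, ⟨h1, h2⟩, h3⟩
      rw [orderStat_eq_comp_of_monotone x σ h1.monotone]
      refine ⟨h3, fun i _ => ?_⟩
      simpa using h2 (σ.symm i)
  rw [measure_congr key, measure_iUnion]
  · simp only [(hmp _).measure_preimage (hΔ.inter hP).nullMeasurableSet, tsum_fintype]
    simp [Fintype.card_perm]
  · intro σ τ hστ
    refine Set.disjoint_left.2 fun x hx hx' => hστ ?_
    have h1 : x ∘ σ = x ∘ τ := by
      rw [← orderStat_eq_comp_of_monotone x σ hx.1.1.monotone,
        orderStat_eq_comp_of_monotone x τ hx'.1.1.monotone]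
    have hinj : Function.Injective x := by
      have := hx.1.1.injective
      intro i j hij
      have h2 := @this (σ.symm i) (σ.symm j) (by simpa using hij)
      exact σ.symm.injective h2
    ext i
    exact congrArg Fin.val (hinj (congrFun h1 i))
  · exact fun σ => (hmp σ).measurable (hΔ.inter hP)

/-- The linear involution which reverses the spacings before the point with index `p`. -/
def reverseFirst (p : Fin n) : (Fin n → ℝ) →ₗ[ℝ] (Fin n → ℝ) where
  toFun y m := if (m : ℕ) < p then y p - y ⟨p - 1 - m, by omega⟩ else y m
  map_add' y z := by
    ext m; simp only [Pi.add_apply]; split_ifs <;> ring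
  map_smul' c y := by
    ext m; simp only [Pi.smul_apply, smul_eq_mul, RingHom.id_apply]; split_ifs <;> ring

lemma reverseFirst_apply (p : Fin n) (y : Fin n → ℝ) (m : Fin n) :
    reverseFirst p y m = if (m : ℕ) < p then y p - y ⟨p - 1 - m, by omega⟩ else y m := rfl

lemma reverseFirst_reverseFirst (p : Fin n) (y : Fin n → ℝ) :
    reverseFirst p (reverseFirst p y) = y := by
  ext m
  simp only [reverseFirst_apply, lt_irrefl, if_false]
  split_ifs with h1 h2
  · rw [sub_sub_cancel]; congr 1; ext; simp only; omega
  · omega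
  · rfl

/-- A linear involution has determinant `1` or `-1`. -/
lemma measurePreserving_reverseFirst (p : Fin n) :
    MeasurePreserving (reverseFirst p) volume volume := by
  have hcomp : (reverseFirst p) ∘ₗ (reverseFirst p) = LinearMap.id :=
    LinearMap.ext fun y => reverseFirst_reverseFirst p y
  have hdet : LinearMap.det (reverseFirst p) * LinearMap.det (reverseFirst p) = 1 := by
    rw [← LinearMap.det_comp, hcomp, LinearMap.det_id]
  have habs : |(LinearMap.det (reverseFirst p))⁻¹| = 1 := by
    have h1 : |LinearMap.det (reverseFirst p)| * |LinearMap.det (reverseFirst p)| = 1 := by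
      rw [← abs_mul, hdet, abs_one]
    have h2 : |LinearMap.det (reverseFirst p)| = 1 := by nlinarith [abs_nonneg (LinearMap.det (reverseFirst p))]
    rw [abs_inv, h2, inv_one]
  refine ⟨(reverseFirst p).continuous_of_finiteDimensional.measurable, ?_⟩
  rw [Real.map_linearMap_volume_pi_eq_smul_volume_pi (by intro h; simp [h] at hdet), habs]
  simp

/-- The point `y p` stays fixed and the positive spacings from the origin up to it are merely listed
in reverse order. -/
lemma reverseFirst_mem_openSimplex (p : Fin n) {y : Fin n → ℝ} (hy : y ∈ openSimplex n) :
    reverseFirst p y ∈ openSimplex n := by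
  obtain ⟨h1, h2⟩ := hy
  constructor
  · intro m m' hmm
    have hmm' := Fin.lt_def.1 hmm
    simp only [reverseFirst_apply]
    split_ifs with ha hb hb
    · have : y ⟨p - 1 - m', by omega⟩ < y ⟨p - 1 - m, by omega⟩ := h1 (by
        rw [Fin.lt_def]; simp only; omega)
      linarith
    · have := h1.monotone (show p ≤ m' from Fin.le_def.2 (by omega))
      have := (h2 ⟨p - 1 - m, by omega⟩).1
      linarith
    · omega
    · exact h1 hmm
  · intro m
    simp only [reverseFirst_apply]
    split_ifs with ha
    · have : y ⟨p - 1 - m, by omega⟩ < y p := h1 (by rw [Fin.lt_def]; simp only; omega)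
      have h3 := (h2 ⟨p - 1 - m, by omega⟩).1
      have h4 := (h2 p).2
      exact ⟨by linarith, by linarith⟩
    · exact h2 m

lemma volume_openSimplex_inter_preimage (p : Fin n) {P : Set (Fin n → ℝ)} (hP : MeasurableSet P) :
    volume (openSimplex n ∩ reverseFirst p ⁻¹' P) = volume (openSimplex n ∩ P) := by
  rw [← (measurePreserving_reverseFirst p).measure_preimage
    (measurableSet_openSimplex.inter hP).nullMeasurableSet, Set.preimage_inter]
  congr 2
  ext y
  refine ⟨fun h => reverseFirst_mem_openSimplex p h, fun h => ?_⟩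
  have := reverseFirst_mem_openSimplex p (y := reverseFirst p y) h
  rwa [reverseFirst_reverseFirst] at this

/-- The number of coordinates of `x` which are at most `c`. -/
noncomputable def countLE (x : Fin n → ℝ) (c : ℝ) : ℕ := ({l | x l ≤ c} : Finset (Fin n)).card

lemma countLE_orderStat (x : Fin n → ℝ) (c : ℝ) : countLE (orderStat x) c = countLE x c := by
  unfold countLE
  rw [← Finset.card_map (Tuple.sort x).toEmbedding]
  congr 1
  ext l
  rw [Finset.mem_map, Finset.mem_filter_univ]
  constructor
  · rintro ⟨a, ha, rfl⟩; exact (Finset.mem_filter.1 ha).2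
  · intro hl
    exact ⟨(Tuple.sort x).symm l, Finset.mem_filter.2 ⟨Finset.mem_univ _, by simpa [orderStat] using hl⟩,
      by simp⟩

lemma countLE_le (x : Fin n → ℝ) (c : ℝ) : countLE x c ≤ n :=
  (Finset.card_le_univ _).trans (by simp)

lemma lt_countLE_iff {y : Fin n → ℝ} (hy : Monotone y) (k : Fin n) (c : ℝ) :
    (k : ℕ) < countLE y c ↔ y k ≤ c :=
  Tuple.lt_card_le_iff_apply_le_of_monotone (j := k) (a := c) hy

lemma measurable_countLE {f : (Fin n → ℝ) → ℝ} (hf : Measurable f) :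
    Measurable (fun x : Fin n → ℝ => countLE x (f x)) := by
  simp only [countLE, Finset.card_filter]
  refine Finset.measurable_sum _ fun l _ => ?_
  exact Measurable.ite (measurableSet_le (measurable_pi_apply l) hf)
    measurable_const measurable_const

lemma leftNeighbors_orderedGraph_succ (x : Fin n → ℝ) (r : ℝ) (v : Fin n) :
    leftNeighbors (orderedGraph x r) (v + 1) =
      ({j | j < v ∧ orderStat x v - orderStat x j ≤ r} : Finset (Fin n)).card := by
  classical
  rw [leftNeighbors_eq_card]
  congr 1; ext j
  simp only [Finset.mem_filter_univ]
  exact and_congr_right fun h => orderedGraph_adj_of_lt x r h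

/-- The number of `j < v` with `y v - y j ≤ r`. -/
noncomputable def leftCount (r : ℝ) (v : Fin n) (y : Fin n → ℝ) : ℕ :=
  ({j | j < v ∧ y v - y j ≤ r} : Finset (Fin n)).card

lemma measurable_leftCount (r : ℝ) (v : Fin n) : Measurable (leftCount r v) := by
  have : leftCount r v = fun y : Fin n → ℝ => ∑ j, if j < v ∧ y v - y j ≤ r then 1 else 0 := by
    funext y; simp only [leftCount, Finset.card_filter]
  rw [this]
  refine Finset.measurable_sum _ fun j _ => ?_
  refine Measurable.ite ?_ measurable_const measurable_const
  by_cases h : j < v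
  · simp only [h, true_and]
    exact measurableSet_le ((measurable_pi_apply v).sub (measurable_pi_apply j)) measurable_const
  · simp [h]

lemma card_filter_fin_lt_lt (p q : ℕ) (hp : p ≤ n) :
    ({j | (j : ℕ) < p ∧ (j : ℕ) < q} : Finset (Fin n)).card = min p q := by
  have : ({j | (j : ℕ) < p ∧ (j : ℕ) < q} : Finset (Fin n)) =
      Finset.univ.filter fun j : Fin n => (j : ℕ) < min p q := by
    ext j; simp
  rw [this, Fin.card_filter_val_lt]
  omega

lemma card_filter_reverse (p : Fin n) (Q : Fin n → Prop) [DecidablePred Q]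
    (Q' : Fin n → Prop) [DecidablePred Q']
    (h : ∀ m : Fin n, ∀ hm : (m : ℕ) < p, Q m ↔ Q' ⟨p - 1 - m, by omega⟩) :
    ({j | (j : ℕ) < p ∧ Q j} : Finset (Fin n)).card =
      ({j | (j : ℕ) < p ∧ Q' j} : Finset (Fin n)).card := by
  refine Finset.card_bij' (fun j _ => ⟨p - 1 - j, by omega⟩) (fun j _ => ⟨p - 1 - j, by omega⟩)
    ?_ ?_ ?_ ?_
  · intro j hj
    simp only [Finset.mem_filter_univ] at hj ⊢
    exact ⟨by omega, (h j hj.1).1 hj.2⟩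
  · intro j hj
    simp only [Finset.mem_filter_univ] at hj ⊢
    refine ⟨by omega, (h ⟨p - 1 - j, by omega⟩ (by simp only; omega)).2 ?_⟩
    convert hj.2 using 1
    ext; simp only; omega
  · intro j hj
    simp only [Finset.mem_filter_univ] at hj
    ext; simp only; omega
  · intro j hj
    simp only [Finset.mem_filter_univ] at hj
    ext; simp only; omega

/-- After the reversal the distance from point `p` to point `m < p` is `y (p - 1 - m)`, the distance
of a point from the origin. The minimum appears because only indices below `p` are counted. -/
lemma leftCount_reverseFirst (r : ℝ) (p : Fin n) {y : Fin n → ℝ} (hy : y ∈ openSimplex n) :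
    leftCount r p (reverseFirst p y) = min (p : ℕ) (countLE y r) := by
  rw [← card_filter_fin_lt_lt _ _ p.2.le]
  unfold leftCount
  simp only [Fin.lt_def]
  refine card_filter_reverse p _ _ fun m hm => ?_
  rw [lt_countLE_iff hy.1.monotone]
  simp [reverseFirst_apply, hm]

/-- The reversal sends point `q = p - 1` to `y p - y 0`, so its distances to earlier points become
distances from the first point. The subtracted `1` removes the first point from its own window. -/
lemma leftCount_pred_reverseFirst {r : ℝ} (hr : 0 ≤ r) (p q z : Fin n) (hq : (q : ℕ) + 1 = p)
    (hz : (z : ℕ) = 0) {y : Fin n → ℝ} (hy : y ∈ openSimplex n) :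
    leftCount r q (reverseFirst p y) = min (q : ℕ) (countLE y (y z + r) - 1) := by
  have hpos : 0 < countLE y (y z + r) := by
    have := (lt_countLE_iff hy.1.monotone z (y z + r)).2 (by linarith)
    omega
  rw [← card_filter_fin_lt_lt _ _ q.2.le]
  unfold leftCount
  simp only [Fin.lt_def]
  refine card_filter_reverse q _ _ fun m hm => ?_
  have h1 := lt_countLE_iff hy.1.monotone ⟨p - 1 - m, by omega⟩ (y z + r)
  have h2 : (⟨p - 1 - q, by omega⟩ : Fin n) = z := by ext; simp only; omega
  have hqp : (q : ℕ) < p := by omega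
  have hmp : (m : ℕ) < p := by omega
  simp only [reverseFirst_apply, hqp, hmp, if_true, h2]
  have h3 : y p - y z - (y p - y ⟨p - 1 - m, by omega⟩) ≤ r ↔ y ⟨p - 1 - m, by omega⟩ ≤ y z + r := by
    constructor <;> intro h <;> linarith
  rw [h3, ← h1]
  simp only
  omega

/-- The joint law of two consecutive left-neighbour counts: up to truncation, it is the law of the
numbers of points in the windows which start at the first point and at the origin. -/
lemma cubeMeasure_leftNeighbors_pair {r : ℝ} (hr : 0 ≤ r) (p z : Fin n) (hp : 0 < (p : ℕ))
    (hz : (z : ℕ) = 0) (U : Set (ℕ × ℕ)) :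
    cubeMeasure n {x | (leftNeighbors (orderedGraph x r) p,
        leftNeighbors (orderedGraph x r) (p + 1)) ∈ U} =
      cubeMeasure n {x | (min ((p : ℕ) - 1) (countLE x (orderStat x z + r) - 1),
        min (p : ℕ) (countLE x r)) ∈ U} := by
  -- Counting from one, node `p` is the index `q` and node `p + 1` is the index `p`.
  obtain ⟨q, hq⟩ : ∃ q : Fin n, (q : ℕ) + 1 = p := ⟨⟨p - 1, by omega⟩, by simp only; omega⟩
  have hU : MeasurableSet U := U.to_countable.measurableSet
  have m1 : MeasurableSet {y : Fin n → ℝ | (leftCount r q y, leftCount r p y) ∈ U} :=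
    ((measurable_leftCount r q).prodMk (measurable_leftCount r p)) hU
  have m2 : MeasurableSet {y : Fin n → ℝ | (min ((p : ℕ) - 1) (countLE y (y z + r) - 1),
      min (p : ℕ) (countLE y r)) ∈ U} := by
    have h0 : Measurable fun y : Fin n → ℝ => y z + r := by fun_prop
    have h1 : Measurable fun y : Fin n → ℝ => countLE y (y z + r) := measurable_countLE h0
    have h2 : Measurable fun y : Fin n → ℝ => countLE y r :=
      measurable_countLE (f := fun _ => r) measurable_const
    exact (((measurable_from_nat (f := fun k => min ((p : ℕ) - 1) (k - 1))).comp h1).prodMk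
      ((measurable_from_nat (f := fun k => min (p : ℕ) k)).comp h2)) hU
  have e1 : {x : Fin n → ℝ | (leftNeighbors (orderedGraph x r) p,
        leftNeighbors (orderedGraph x r) (p + 1)) ∈ U} =
      {x | orderStat x ∈ {y : Fin n → ℝ | (leftCount r q y, leftCount r p y) ∈ U}} := by
    ext x
    change (leftNeighbors _ _, leftNeighbors _ _) ∈ U ↔
      (leftCount r q (orderStat x), leftCount r p (orderStat x)) ∈ U
    rw [leftNeighbors_orderedGraph_succ, ← hq, leftNeighbors_orderedGraph_succ]
    rfl
  have e2 : {x : Fin n → ℝ | (min ((p : ℕ) - 1) (countLE x (orderStat x z + r) - 1),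
        min (p : ℕ) (countLE x r)) ∈ U} =
      {x | orderStat x ∈ {y : Fin n → ℝ | (min ((p : ℕ) - 1) (countLE y (y z + r) - 1),
      min (p : ℕ) (countLE y r)) ∈ U}} := by
    ext x
    change (min _ _, min _ _) ∈ U ↔ (min _ (countLE (orderStat x) _ - 1), min _ _) ∈ U
    rw [countLE_orderStat, countLE_orderStat]
  rw [e1, e2, cubeMeasure_orderStat_mem m1, cubeMeasure_orderStat_mem m2,
    ← volume_openSimplex_inter_preimage p m1]
  congr 2
  ext y
  refine and_congr_right fun hy => ?_
  change (leftCount r q _, leftCount r p _) ∈ U ↔ (min _ _, min _ _) ∈ U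
  rw [leftCount_reverseFirst r p hy, leftCount_pred_reverseFirst hr p q z hq hz hy, ← hq,
    Nat.add_sub_cancel]

lemma leftNeighbors_le (x : Fin n → ℝ) (r : ℝ) {i : ℕ} (hi : i < n) :
    leftNeighbors (orderedGraph x r) (i + 1) ≤ i := by
  have := leftNeighbors_orderedGraph_succ x r ⟨i, hi⟩
  simp only at this
  rw [this]
  refine (Finset.card_le_card (t := Finset.univ.filter fun j : Fin n => (j : ℕ) < i) ?_).trans ?_
  · intro j hj
    exact Finset.mem_filter.2 ⟨Finset.mem_univ _, Fin.lt_def.1 (Finset.mem_filter.1 hj).2.1⟩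
  · rw [Fin.card_filter_val_lt]; exact min_le_right _ _

/-- A left neighbour of node `i + 1` other than node `i` is even closer to node `i`. Thus one step
gains at most one neighbour. -/
lemma leftNeighbors_succ_le (x : Fin n → ℝ) (r : ℝ) {i : ℕ} (hi0 : 1 ≤ i) (hi : i < n) :
    leftNeighbors (orderedGraph x r) (i + 1) ≤ leftNeighbors (orderedGraph x r) i + 1 := by
  obtain ⟨m, rfl⟩ : ∃ m, i = m + 1 := ⟨i - 1, by omega⟩
  have h1 := leftNeighbors_orderedGraph_succ x r ⟨m + 1, hi⟩
  have h2 := leftNeighbors_orderedGraph_succ x r ⟨m, by omega⟩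
  simp only at h1 h2
  rw [h1, h2]
  refine (Finset.card_le_card (t := insert ⟨m, by omega⟩ _) ?_).trans (Finset.card_insert_le _ _)
  intro j hj
  obtain ⟨-, hj1, hj2⟩ := Finset.mem_filter.1 hj
  rw [Finset.mem_insert, Finset.mem_filter]
  by_cases hjm : (j : ℕ) = m
  · exact Or.inl (Fin.ext hjm)
  · have := Fin.lt_def.1 hj1
    simp only at this
    refine Or.inr ⟨Finset.mem_univ _, Fin.lt_def.2 (by simp only; omega), ?_⟩
    have := monotone_orderStat x (show (⟨m, by omega⟩ : Fin n) ≤ ⟨m + 1, hi⟩ from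
      Fin.le_def.2 (by simp))
    linarith

end OrderStatLaw

/-! ### Exact laws of the window counts -/

section WindowCounts

lemma cubeMeasure_countLE {n : ℕ} {r : ℝ} (h0 : 0 ≤ r) (h1 : r ≤ 1) (b : ℕ) :
    (cubeMeasure n).real {x | countLE x r = b} = n.choose b * r ^ b * (1 - r) ^ (n - b) := by
  classical
  have hset : ∀ S : Finset (Fin n), {x : Fin n → ℝ | (Finset.univ.filter fun l => x l ≤ r) = S} =
      Set.univ.pi fun l => if l ∈ S then Set.Iic r else Set.Ioi r := by
    intro S
    ext x
    simp only [Set.mem_pi, Set.mem_univ, forall_const]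
    change (Finset.univ.filter fun l => x l ≤ r) = S ↔ _
    rw [Finset.ext_iff]
    refine forall_congr' fun l => ?_
    by_cases h : l ∈ S <;> simp [h]
  have hI : ∀ l : Fin n, ∀ S : Finset (Fin n),
      MeasurableSet (if l ∈ S then Set.Iic r else Set.Ioi r) := by
    intro l S; split_ifs
    · exact measurableSet_Iic
    · exact measurableSet_Ioi
  have hvol : ∀ S : Finset (Fin n), (cubeMeasure n).real
      {x : Fin n → ℝ | (Finset.univ.filter fun l => x l ≤ r) = S} =
        r ^ S.card * (1 - r) ^ (n - S.card) := by
    intro S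
    have e1 : ∀ l, (volume.restrict (Set.Icc (0 : ℝ) 1)) (if l ∈ S then Set.Iic r else Set.Ioi r) =
        ENNReal.ofReal (if l ∈ S then r else 1 - r) := by
      intro l
      rw [Measure.restrict_apply (hI l S)]
      split_ifs
      · have : Set.Iic r ∩ Set.Icc (0 : ℝ) 1 = Set.Icc 0 r := by
          ext t; simp only [Set.mem_inter_iff, Set.mem_Iic, Set.mem_Icc]
          constructor
          · rintro ⟨a, b, c⟩; exact ⟨b, a⟩
          · rintro ⟨a, b⟩; exact ⟨b, a, b.trans h1⟩
        rw [this, Real.volume_Icc, sub_zero]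
      · have : Set.Ioi r ∩ Set.Icc (0 : ℝ) 1 = Set.Ioc r 1 := by
          ext t; simp only [Set.mem_inter_iff, Set.mem_Ioi, Set.mem_Icc, Set.mem_Ioc]
          constructor
          · rintro ⟨a, b, c⟩; exact ⟨a, c⟩
          · rintro ⟨a, b⟩; exact ⟨a, h0.trans a.le, b⟩
        rw [this, Real.volume_Ioc]
    rw [measureReal_def, hset S, cubeMeasure_eq_pi, Measure.pi_pi, Finset.prod_congr rfl fun l _ => e1 l,
      ENNReal.toReal_prod, Finset.prod_congr rfl fun l _ => ENNReal.toReal_ofReal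
        (show 0 ≤ if l ∈ S then r else 1 - r by split_ifs <;> linarith)]
    rw [Finset.prod_ite, Finset.prod_const, Finset.prod_const]
    congr 2
    · simp
    · rw [Finset.filter_not, Finset.card_sdiff]; simp
  have hU : {x : Fin n → ℝ | countLE x r = b} = ⋃ S ∈ Finset.powersetCard b Finset.univ,
      {x : Fin n → ℝ | (Finset.univ.filter fun l => x l ≤ r) = S} := by
    ext x
    simp only [Set.mem_iUnion, Finset.mem_powersetCard, exists_prop]
    constructor
    · intro h; exact ⟨_, ⟨Finset.subset_univ _, h⟩, rfl⟩
    · rintro ⟨S, ⟨-, h⟩, h2⟩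
      change (Finset.univ.filter fun l => x l ≤ r) = S at h2
      change (Finset.univ.filter fun l => x l ≤ r).card = b
      rw [h2, h]
  rw [hU, measureReal_biUnion_finset]
  · rw [Finset.sum_congr rfl (g := fun _ => r ^ b * (1 - r) ^ (n - b))]
    · rw [Finset.sum_const, Finset.card_powersetCard]; simp [mul_assoc]
    · intro S hS
      rw [hvol S, (Finset.mem_powersetCard.1 hS).2]
  · intro S _ S' _ h
    refine Set.disjoint_left.2 fun x h1 h2 => h ?_
    exact Eq.trans (Eq.symm h1) h2
  · intro S _
    rw [hset S]
    exact MeasurableSet.univ_pi fun l => hI l S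

/-- Fubini with the pivot coordinate `j` outermost: each slice of `E` is a box, so its volume is a
product. -/
lemma volume_eq_lintegral_pivot {n : ℕ} (j : Fin (n + 1)) (E : Set (Fin (n + 1) → ℝ))
    (hE : MeasurableSet E) (D : Set ℝ) (hD : MeasurableSet D) (I : Fin n → ℝ → Set ℝ)
    (h : ∀ g (z : Fin n → ℝ), j.insertNth (α := fun _ => ℝ) g z ∈ E ↔ g ∈ D ∧ ∀ l, z l ∈ I l g) :
    volume E = ∫⁻ g in D, ∏ l, volume (I l g) := by
  have hmp := (volume_preserving_piFinSuccAbove (fun _ : Fin (n + 1) => ℝ) j).symm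
  rw [← hmp.measure_preimage hE.nullMeasurableSet, Measure.volume_eq_prod,
    Measure.prod_apply (hmp.measurable hE), ← lintegral_indicator hD]
  congr 1
  funext g
  by_cases hg : g ∈ D
  · rw [Set.indicator_of_mem hg, ← volume_pi_pi]
    congr 1
    ext z
    have := h g z
    simp only [hg, true_and] at this
    exact Iff.trans this (by simp)
  · rw [Set.indicator_of_notMem hg]
    have : Prod.mk g ⁻¹' ((MeasurableEquiv.piFinSuccAbove (fun _ => ℝ) j).symm ⁻¹' E) = ∅ := by
      ext z
      have := h g z
      simp only [hg, false_and, iff_false] at this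
      exact iff_of_false this (Set.notMem_empty z)
    rw [this, measure_empty]

/-- The window in which the point `l` has to lie when the leftmost point is at `g`, the points
indexed by `S` are the neighbours of the leftmost point, and those indexed by `T ⊆ S` are
further than `r` from the origin. -/
def window {n : ℕ} (r : ℝ) (S T : Finset (Fin n)) (l : Fin n) (g : ℝ) : Set ℝ :=
  if l ∈ T then Set.Ioc r (g + r) else if l ∈ S then Set.Ioc g r else Set.Ioo (g + r) 1

/-- The configurations with leftmost point `j` in `(0, r]` and all others in their windows. -/
def windowEvent {n : ℕ} (r : ℝ) (j : Fin n) (S T : Finset (Fin n)) : Set (Fin n → ℝ) :=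
  {x | x j ∈ Set.Ioc 0 r ∧ ∀ l, l ≠ j → x l ∈ window r S T l (x j)}

lemma measurableSet_windowEvent {n : ℕ} (r : ℝ) (j : Fin n) (S T : Finset (Fin n)) :
    MeasurableSet (windowEvent r j S T) := by
  have : windowEvent r j S T = (fun x => x j) ⁻¹' Set.Ioc 0 r ∩
      ⋂ l, {x | l ≠ j → x l ∈ window r S T l (x j)} := by
    ext x; simp only [windowEvent, Set.mem_inter_iff, Set.mem_iInter]; rfl
  rw [this]
  refine (measurable_pi_apply j measurableSet_Ioc).inter (MeasurableSet.iInter fun l => ?_)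
  by_cases h : l = j
  · simp [h]
  simp only [ne_eq, h, not_false_eq_true, forall_const]
  have hl := measurable_pi_apply (X := fun _ : Fin n => ℝ) l
  have hj := measurable_pi_apply (X := fun _ : Fin n => ℝ) j
  have hjr : Measurable fun x : Fin n → ℝ => x j + r := by fun_prop
  unfold window
  split_ifs
  · exact (measurableSet_lt measurable_const hl).inter (measurableSet_le hl hjr)
  · exact (measurableSet_lt hj hl).inter (measurableSet_le hl measurable_const)
  · exact (measurableSet_lt hjr hl).inter (measurableSet_lt hl measurable_const)

/-- With the leftmost point at `g`, the three kinds of window have lengths `g`, `r - g` and the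
positive part of `1 - (g + r)`. -/
lemma volume_windowEvent {n : ℕ} {r : ℝ} (hr : 0 ≤ r) (j : Fin (n + 1)) (S T : Finset (Fin (n + 1)))
    (hS : S ⊆ {j}ᶜ) (hT : T ⊆ S) :
    volume (windowEvent r j S T) = ENNReal.ofReal (∫ g in (0 : ℝ)..r,
      g ^ T.card * (r - g) ^ (S.card - T.card) * max (1 - (g + r)) 0 ^ (n - S.card)) := by
  classical
  rw [volume_eq_lintegral_pivot j _ (measurableSet_windowEvent r j S T) (Set.Ioc 0 r)
    measurableSet_Ioc (fun l g => window r S T (j.succAbove l) g)]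
  · have hprod : ∀ g ∈ Set.Ioc 0 r, ∏ l, volume (window r S T (j.succAbove l) g) =
        ENNReal.ofReal (g ^ T.card * (r - g) ^ (S.card - T.card) *
          max (1 - (g + r)) 0 ^ (n - S.card)) := by
      intro g hg
      have e1 : ∏ l, volume (window r S T (j.succAbove l) g) =
          ∏ l ∈ {j}ᶜ, volume (window r S T l g) := by
        rw [← Fin.image_succAbove_univ, Finset.prod_image]
        exact fun _ _ _ _ h => Fin.succAbove_right_injective h
      rw [e1, ← Finset.prod_sdiff hS, ← Finset.prod_sdiff hT]
      have f1 : ∏ l ∈ T, volume (window r S T l g) = ENNReal.ofReal g ^ T.card := by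
        rw [← Finset.prod_const]
        refine Finset.prod_congr rfl fun l hl => ?_
        simp [window, hl]
      have f2 : ∏ l ∈ S \ T, volume (window r S T l g) =
          ENNReal.ofReal (r - g) ^ (S.card - T.card) := by
        rw [← Finset.card_sdiff_of_subset hT, ← Finset.prod_const]
        refine Finset.prod_congr rfl fun l hl => ?_
        rw [Finset.mem_sdiff] at hl
        simp [window, hl]
      have f3 : ∏ l ∈ {j}ᶜ \ S, volume (window r S T l g) =
          ENNReal.ofReal (max (1 - (g + r)) 0) ^ (n - S.card) := by
        have : ({j}ᶜ \ S).card = n - S.card := by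
          rw [Finset.card_sdiff_of_subset hS, Finset.card_compl]; simp
        rw [← this, ← Finset.prod_const]
        refine Finset.prod_congr rfl fun l hl => ?_
        rw [Finset.mem_sdiff] at hl
        have : l ∉ T := fun h => hl.2 (hT h)
        have hm : ENNReal.ofReal (max (1 - (g + r)) 0) = ENNReal.ofReal (1 - (g + r)) := by
          simp [ENNReal.ofReal_max]
        simp [window, hl, this, hm]
      rw [f1, f2, f3, ENNReal.ofReal_mul, ENNReal.ofReal_mul, ENNReal.ofReal_pow,
        ENNReal.ofReal_pow, ENNReal.ofReal_pow]
      · ring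
      · exact le_max_right _ _
      · linarith [hg.2]
      · exact hg.1.le
      · exact pow_nonneg hg.1.le _
      · exact mul_nonneg (pow_nonneg hg.1.le _) (pow_nonneg (by linarith [hg.2]) _)
    rw [setLIntegral_congr_fun measurableSet_Ioc hprod, intervalIntegral.integral_of_le hr,
      ofReal_integral_eq_lintegral_ofReal]
    · refine Continuous.integrableOn_Ioc ?_
      fun_prop
    · refine (ae_restrict_iff' measurableSet_Ioc).2 (ae_of_all _ fun g hg => ?_)
      exact mul_nonneg (mul_nonneg (pow_nonneg hg.1.le _) (pow_nonneg (by linarith [hg.2]) _))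
        (pow_nonneg (le_max_right _ _) _)
  · intro g z
    unfold windowEvent
    change (j.insertNth (α := fun _ => ℝ) g z j ∈ _ ∧ _) ↔ _
    rw [Fin.insertNth_apply_same]
    refine and_congr_right fun _ => ⟨fun h l => ?_, fun h l hl => ?_⟩
    · have := h (j.succAbove l) (Fin.succAbove_ne j l)
      rwa [Fin.insertNth_apply_succAbove] at this
    · obtain ⟨l, rfl⟩ := Fin.exists_succAbove_eq hl
      rw [Fin.insertNth_apply_succAbove]
      exact h l

lemma orderStat_zero_le {n : ℕ} (x : Fin n → ℝ) (z : Fin n) (hz : (z : ℕ) = 0) (l : Fin n) :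
    orderStat x z ≤ x l := by
  have := monotone_orderStat x (show z ≤ (Tuple.sort x).symm l from Fin.le_def.2 (by omega))
  simpa [orderStat] using this

/-- The labels `j`, `S` and `T` can be recovered from the configuration; this gives both the counts
and the disjointness of the events. -/
lemma windowEvent_spec {n : ℕ} {r : ℝ} (hr : 0 ≤ r) {j : Fin n} {S T : Finset (Fin n)}
    (hS : S ⊆ {j}ᶜ) (hT : T ⊆ S) {x : Fin n → ℝ} (hx : x ∈ windowEvent r j S T) :
    (∀ l, l ≠ j → x j < x l) ∧ (∀ l, x l ≤ x j + r ↔ l = j ∨ l ∈ S) ∧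
      (∀ l, x l ≤ r ↔ l = j ∨ (l ∈ S ∧ l ∉ T)) := by
  obtain ⟨⟨h0, h1⟩, h2⟩ := hx
  have key : ∀ l, l ≠ j → x j < x l ∧ (x l ≤ x j + r ↔ l ∈ S) ∧ (x l ≤ r ↔ (l ∈ S ∧ l ∉ T)) := by
    intro l hl
    have h := h2 l hl
    unfold window at h
    split_ifs at h with ha hb
    · have := h.1; have := h.2
      exact ⟨by linarith, by simp [hT ha, h.2], by simp [ha, h.1]⟩
    · have := h.1; have := h.2
      exact ⟨h.1, by simp only [hb, iff_true]; linarith, by simp [ha, hb, h.2]⟩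
    · have := h.1; have := h.2
      exact ⟨by linarith, by simp [hb, h.1], by simp only [hb, false_and, iff_false]; linarith⟩
  refine ⟨fun l hl => (key l hl).1, fun l => ?_, fun l => ?_⟩
  · by_cases hl : l = j
    · subst hl; simp [hr]
    · simp [hl, (key l hl).2.1]
  · by_cases hl : l = j
    · subst hl; simp [h1]
    · simp [hl, (key l hl).2.2]

lemma exists_mem_windowEvent_iff {n : ℕ} {r : ℝ} (hr : 0 ≤ r) (z : Fin (n + 1)) (hz : (z : ℕ) = 0)
    {a k : ℕ} (ha : a < n) (hk : k ≤ a) {x : Fin (n + 1) → ℝ} (hx : Function.Injective x) :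
    (∃ j, ∃ S ∈ Finset.powersetCard a {j}ᶜ, ∃ T ∈ Finset.powersetCard k S, x ∈ windowEvent r j S T) ↔
      (countLE x (orderStat x z + r) - 1 = a ∧ countLE x r = a + 1 - k) ∧
        x ∈ Set.univ.pi fun _ => Set.Ioo (0 : ℝ) 1 := by
  classical
  constructor
  · rintro ⟨j, S, hS, T, hT, h⟩
    obtain ⟨hS, cS⟩ := Finset.mem_powersetCard.1 hS
    obtain ⟨hT, cT⟩ := Finset.mem_powersetCard.1 hT
    obtain ⟨h1, h2, h3⟩ := windowEvent_spec hr hS hT h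
    have hjS : j ∉ S := fun hj => by simpa using hS hj
    have hmin : orderStat x z = x j := by
      refine le_antisymm (orderStat_zero_le x z hz j) ?_
      by_cases hj : Tuple.sort x z = j
      · exact le_of_eq (congrArg x hj.symm)
      · exact (h1 _ hj).le
    refine ⟨⟨?_, ?_⟩, ?_⟩
    · have : (Finset.univ.filter fun l => x l ≤ x j + r) = insert j S := by
        ext l; simp [h2]
      rw [hmin, countLE, this, Finset.card_insert_of_notMem hjS, cS]; rfl
    · have : (Finset.univ.filter fun l => x l ≤ r) = insert j (S \ T) := by
        ext l; simp [h3]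
      rw [countLE, this, Finset.card_insert_of_notMem (by simp [hjS]),
        Finset.card_sdiff_of_subset hT, cS, cT]; omega
    · obtain ⟨⟨h0, hjr⟩, h4⟩ := h
      -- Since `a < n`, some point other than `j` lies outside `S`, and its window being nonempty
      -- forces `x j + r < 1`. That keeps the points of `S`, whose windows do not mention `1`,
      -- inside the unit interval.
      obtain ⟨l, hl, hlS⟩ : ∃ l ∈ ({j}ᶜ : Finset (Fin (n + 1))), l ∉ S := by
        by_contra hne
        push Not at hne
        have := Finset.card_le_card (show ({j}ᶜ : Finset (Fin (n + 1))) ⊆ S from hne)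
        rw [Finset.card_compl, cS] at this
        simp at this; omega
      have hl' : l ≠ j := by simpa using hl
      have hw := h4 l hl'
      have hlT : l ∉ T := fun h => hlS (hT h)
      simp only [window, hlT, hlS, if_false, Set.mem_Ioo] at hw
      intro i _
      have h5 : x j ≤ x i := by
        by_cases hi : i = j
        · rw [hi]
        · exact (h1 i hi).le
      refine ⟨h0.trans_le h5, ?_⟩
      by_cases hi : x i ≤ x j + r
      · linarith
      · have hi2 := (h2 i).not.1 hi
        push Not at hi2
        have hw2 := h4 i hi2.1
        have hiT : i ∉ T := fun h => hi2.2 (hT h)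
        simp only [window, hiT, hi2.2, if_false, Set.mem_Ioo] at hw2
        exact hw2.2
  · rintro ⟨⟨h1, h2⟩, h3⟩
    set j := Tuple.sort x z with hj
    have hzj : orderStat x z = x j := rfl
    have hmin : ∀ l, x j ≤ x l := fun l => hzj ▸ orderStat_zero_le x z hz l
    have hlt : ∀ l, l ≠ j → x j < x l := fun l hl =>
      lt_of_le_of_ne (hmin l) fun h => hl (hx h.symm)
    have h0 : 0 < x j := (h3 j trivial).1
    have hjr : x j ≤ r := by
      have : 0 < (Finset.univ.filter fun l => x l ≤ r).card := by
        change 0 < countLE x r; omega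
      obtain ⟨l, hl⟩ := Finset.card_pos.1 this
      exact (hmin l).trans (Finset.mem_filter.1 hl).2
    set S : Finset (Fin (n + 1)) := Finset.univ.filter fun l => l ≠ j ∧ x l ≤ x j + r with hS
    set T : Finset (Fin (n + 1)) := S.filter fun l => r < x l with hT
    have hjS : j ∉ S := by simp [hS]
    have cS : S.card = a := by
      have : (Finset.univ.filter fun l => x l ≤ x j + r) = insert j S := by
        ext l
        by_cases hl : l = j
        · simp [hl, hS, hr]
        · simp [hl, hS]
      rw [hzj, countLE, this, Finset.card_insert_of_notMem hjS] at h1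
      omega
    have cT : T.card = k := by
      have h4 : (Finset.univ.filter fun l => x l ≤ r) = insert j (S.filter fun l => ¬ r < x l) := by
        ext l
        by_cases hl : l = j
        · simp [hl, hjr]
        · simp only [hS, Finset.mem_filter, Finset.mem_univ, true_and, Finset.mem_insert, hl,
            false_or, ne_eq, not_false_eq_true, not_lt]
          constructor
          · intro h; exact ⟨by linarith, h⟩
          · exact fun h => h.2
      rw [countLE, h4, Finset.card_insert_of_notMem (by simp [hS])] at h2
      have := Finset.card_filter_add_card_filter_not (s := S) (fun l => r < x l)
      rw [cS] at this
      change T.card + _ = a at this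
      omega
    refine ⟨j, S, Finset.mem_powersetCard.2 ⟨fun l hl => ?_, cS⟩, T,
      Finset.mem_powersetCard.2 ⟨Finset.filter_subset _ _, cT⟩, ⟨h0, hjr⟩, fun l hl => ?_⟩
    · simp only [Finset.mem_compl, Finset.mem_singleton]
      rintro rfl; exact hjS hl
    · unfold window
      split_ifs with ha hb
      · rw [hT, Finset.mem_filter, hS, Finset.mem_filter] at ha
        exact ⟨ha.2, ha.1.2.2⟩
      · have : ¬ r < x l := fun h => ha (Finset.mem_filter.2 ⟨hb, h⟩)
        exact ⟨hlt l hl, not_lt.1 this⟩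
      · have : ¬ x l ≤ x j + r := fun h => hb (Finset.mem_filter.2 ⟨Finset.mem_univ _, hl, h⟩)
        exact ⟨not_le.1 this, (h3 l trivial).2⟩

/-- There are `n + 1` choices of the leftmost point, then `n.choose a` of its neighbours, then
`a.choose k` of those beyond `r`. The resulting events are disjoint and have equal volume. The
second count is positive here, so the leftmost point lies within `r` of the origin. -/
lemma cubeMeasure_countLE_pair {n : ℕ} {r : ℝ} (hr : 0 ≤ r) (z : Fin (n + 1)) (hz : (z : ℕ) = 0)
    {a k : ℕ} (ha : a < n) (hk : k ≤ a) :
    (cubeMeasure (n + 1)).real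
        {x | countLE x (orderStat x z + r) - 1 = a ∧ countLE x r = a + 1 - k} =
      (n + 1 : ℕ) * n.choose a * a.choose k *
        ∫ g in (0 : ℝ)..r, g ^ k * (r - g) ^ (a - k) * max (1 - (g + r)) 0 ^ (n - a) := by
  classical
  set V := ∫ g in (0 : ℝ)..r, g ^ k * (r - g) ^ (a - k) * max (1 - (g + r)) 0 ^ (n - a) with hV
  have hV0 : 0 ≤ V := by
    refine intervalIntegral.integral_nonneg hr fun g hg => ?_
    exact mul_nonneg (mul_nonneg (pow_nonneg hg.1 _) (pow_nonneg (by linarith [hg.2]) _))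
        (pow_nonneg (le_max_right _ _) _)
  set idx : Finset (Σ _ : Fin (n + 1), Σ _ : Finset (Fin (n + 1)), Finset (Fin (n + 1))) :=
    Finset.univ.sigma fun j => (Finset.powersetCard a {j}ᶜ).sigma fun S => Finset.powersetCard k S
    with hidx
  have hmem : ∀ v ∈ idx, v.2.1 ⊆ {v.1}ᶜ ∧ v.2.1.card = a ∧ v.2.2 ⊆ v.2.1 ∧ v.2.2.card = k := by
    intro v hv
    simp only [hidx, Finset.mem_sigma, Finset.mem_univ, true_and, Finset.mem_powersetCard] at hv
    exact ⟨hv.1.1, hv.1.2, hv.2.1, hv.2.2⟩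
  have hmeas0 : Measurable fun x : Fin (n + 1) → ℝ => countLE x (orderStat x z + r) :=
    measurable_countLE (f := fun x => orderStat x z + r) ((measurable_orderStat z).add measurable_const)
  have hmeas1 : Measurable fun x : Fin (n + 1) → ℝ => countLE x r :=
    measurable_countLE (f := fun _ => r) measurable_const
  have hmeas : MeasurableSet {x : Fin (n + 1) → ℝ |
      countLE x (orderStat x z + r) - 1 = a ∧ countLE x r = a + 1 - k} :=
    ((measurable_from_nat (f := fun k => k - 1)).comp hmeas0 (measurableSet_singleton a)).inter
      (hmeas1 (measurableSet_singleton _))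
  have hae : ({x : Fin (n + 1) → ℝ | countLE x (orderStat x z + r) - 1 = a ∧
      countLE x r = a + 1 - k} ∩ Set.univ.pi fun _ => Set.Ioo (0 : ℝ) 1 : Set (Fin (n + 1) → ℝ))
      =ᵐ[volume] (⋃ v ∈ idx, windowEvent r v.1 v.2.1 v.2.2 : Set (Fin (n + 1) → ℝ)) := by
    filter_upwards [ae_injective] with x hx
    apply propext
    change ((_ ∧ _) ∧ _) ↔ x ∈ (⋃ v ∈ idx, windowEvent r v.1 v.2.1 v.2.2)
    rw [← exists_mem_windowEvent_iff hr z hz ha hk hx]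
    simp only [Set.mem_iUnion, hidx, Finset.mem_sigma, Finset.mem_univ, true_and, exists_prop]
    constructor
    · rintro ⟨j, S, hS, T, hT, h⟩; exact ⟨⟨j, S, T⟩, ⟨hS, hT⟩, h⟩
    · rintro ⟨⟨j, S, T⟩, ⟨hS, hT⟩, h⟩; exact ⟨j, S, hS, T, hT, h⟩
  rw [measureReal_def, cubeMeasure, Measure.restrict_apply hmeas, measure_congr hae,
    measure_biUnion_finset]
  · rw [Finset.sum_congr rfl (g := fun _ => ENNReal.ofReal V)]
    · rw [Finset.sum_const, nsmul_eq_mul, ENNReal.toReal_mul, ENNReal.toReal_ofReal hV0,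
        ENNReal.toReal_natCast]
      congr 1
      rw [hidx, Finset.card_sigma]
      have : ∀ j : Fin (n + 1), ((Finset.powersetCard a ({j}ᶜ : Finset (Fin (n + 1)))).sigma
          fun S => Finset.powersetCard k S).card = n.choose a * a.choose k := by
        intro j
        rw [Finset.card_sigma, Finset.sum_congr rfl (g := fun _ => a.choose k)]
        · rw [Finset.sum_const, Finset.card_powersetCard, Finset.card_compl]; simp
        · intro S hS
          rw [Finset.card_powersetCard, (Finset.mem_powersetCard.1 hS).2]
      rw [Finset.sum_congr rfl fun j _ => this j]
      simp only [Finset.sum_const, Finset.card_univ, Fintype.card_fin, smul_eq_mul]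
      push_cast; ring
    · intro v hv
      obtain ⟨h1, h2, h3, h4⟩ := hmem v hv
      rw [volume_windowEvent hr v.1 _ _ h1 h3, h2, h4]
  · rintro ⟨j, S, T⟩ hv ⟨j', S', T'⟩ hv' hne
    refine Set.disjoint_left.2 fun x hx hx' => hne ?_
    obtain ⟨h1, -, h3, -⟩ := hmem _ hv
    obtain ⟨h1', -, h3', -⟩ := hmem _ hv'
    simp only at h1 h3 h1' h3' hx hx'
    obtain ⟨e1, e2, e3⟩ := windowEvent_spec hr h1 h3 hx
    obtain ⟨e1', e2', e3'⟩ := windowEvent_spec hr h1' h3' hx'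
    have hj : j = j' := by
      by_contra h
      exact lt_asymm (e1 j' (Ne.symm h)) (e1' j h)
    subst hj
    have hjS : j ∉ S := fun h => by simpa using h1 h
    have hjS' : j ∉ S' := fun h => by simpa using h1' h
    have hS : S = S' := by
      ext l
      by_cases hl : l = j
      · subst hl; simp [hjS, hjS']
      · have := (e2 l).symm.trans (e2' l)
        simpa [hl] using this
    subst hS
    have hT : T = T' := by
      ext l
      by_cases hl : l ∈ S
      · have hlj : l ≠ j := fun h => hjS (h ▸ hl)
        have := (e3 l).symm.trans (e3' l)
        simp only [hlj, hl, true_and, false_or] at this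
        exact not_iff_not.1 this
      · exact ⟨fun h => absurd (h3 h) hl, fun h => absurd (h3' h) hl⟩
    rw [hT]
  · exact fun v _ => measurableSet_windowEvent _ _ _ _

end WindowCounts

/-! ### Reduction to Lebesgue measure on the cube -/

section Transfer

variable {Ω : Type*} [MeasurableSpace Ω] {n : ℕ}

lemma measurableSet_leftNeighbors (r : ℝ) (i : ℕ) (z : ℕ) :
    MeasurableSet ((fun x : Fin n → ℝ => leftNeighbors (orderedGraph x r) i) ⁻¹' {z}) :=
  measurableSet_preimage_comp _ (measurableSet_orderedGraph_eq r) (fun G => leftNeighbors G i) z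

lemma chainBound_map (μ : Measure Ω) [IsProbabilityMeasure μ] (X : Ω → Fin n → ℝ)
    (hX : Measurable X) (r : ℝ) :
    chainBound μ (fun ω => orderedGraph (X ω) r) =
      chainBound (μ.map X) (fun x => orderedGraph x r) := by
  have hprob : IsProbabilityMeasure (μ.map X) := Measure.isProbabilityMeasure_map hX.aemeasurable
  have hmap : ∀ {s : Set (Fin n → ℝ)}, MeasurableSet s → (μ.map X).real s = μ.real (X ⁻¹' s) :=
    fun hs => by rw [measureReal_def, measureReal_def, Measure.map_apply hX hs]
  unfold chainBound
  congr 1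
  · rw [entropy_eq_sum μ _ (Finset.range (n + 1))
        (fun ω => Finset.mem_range.2 (leftNeighbors_lt _ _)),
      entropy_eq_sum (μ.map X) _ (Finset.range (n + 1))
        (fun ω => Finset.mem_range.2 (leftNeighbors_lt _ _))]
    refine Finset.sum_congr rfl fun s _ => ?_
    rw [hmap (measurableSet_leftNeighbors r 2 s)]
    rfl
  · refine Finset.sum_congr rfl fun i _ => ?_
    rw [condEntropy_eq_sum μ _ _ (Finset.range (n + 1)) (Finset.range (n + 1))
        (fun ω => Finset.mem_range.2 (leftNeighbors_lt _ _))
        (fun ω => Finset.mem_range.2 (leftNeighbors_lt _ _))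
        (fun z => hX (measurableSet_leftNeighbors r i z)),
      condEntropy_eq_sum (μ.map X) _ _ (Finset.range (n + 1)) (Finset.range (n + 1))
        (fun ω => Finset.mem_range.2 (leftNeighbors_lt _ _))
        (fun ω => Finset.mem_range.2 (leftNeighbors_lt _ _))
        (fun z => measurableSet_leftNeighbors r i z)]
    refine Finset.sum_congr rfl fun z _ => Finset.sum_congr rfl fun s _ => ?_
    rw [hmap (measurableSet_leftNeighbors r i z),
      hmap ((measurableSet_leftNeighbors r i z).inter (measurableSet_leftNeighbors r (i + 1) s))]
    rfl

lemma map_eq_cubeMeasure (μ : Measure Ω) [IsProbabilityMeasure μ] (X : Fin n → Ω → ℝ)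
    (hX_meas : ∀ i, Measurable (X i)) (hX_indep : iIndepFun X μ)
    (hX_unif : ∀ i, pdf.IsUniform (X i) (Set.Icc (0 : ℝ) 1) μ volume) :
    μ.map (fun ω i => X i ω) = cubeMeasure n := by
  rw [(iIndepFun_iff_map_fun_eq_pi_map fun i => (hX_meas i).aemeasurable).1 hX_indep,
    cubeMeasure_eq_pi]
  congr 1; funext i
  have := hX_unif i
  rw [pdf.IsUniform, ProbabilityTheory.cond] at this
  rw [this]; simp

end Transfer

/-! ### Binomial mixtures and the step entropy -/

/-- The mixture of the binomial distributions `Bin(a, u)` with density `f u` on `[0, 1]`. -/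
noncomputable def binomMix (f : ℝ → ℝ) (a k : ℕ) : ℝ :=
  a.choose k * ∫ u in (0 : ℝ)..1, u ^ k * (1 - u) ^ (a - k) * f u

/-- The weight of `a` under the binomial distribution `Bin(n, r)`. -/
noncomputable def binomWeight (n : ℕ) (r : ℝ) (a : ℕ) : ℝ :=
  n.choose a * r ^ a * (1 - r) ^ (n - a)

/-- The density of the rescaled gap to the next point, given `a` points in the window. -/
noncomputable def gapDensity (n : ℕ) (r : ℝ) (a : ℕ) (u : ℝ) : ℝ :=
  (n - a : ℕ) * (r / (1 - r)) * max (1 - r / (1 - r) * u) 0 ^ (n - 1 - a)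

/-- The entropy of one step of the chain of left-neighbour counts, in terms of the gap density. -/
noncomputable def stepEntropy (f : ℝ → ℝ) (a : ℕ) : ℝ :=
  bits (1 - ∫ u in (0 : ℝ)..1, f u) + ∑ k ∈ Finset.range (a + 1), bits (binomMix f a k)

lemma continuous_gapDensity (n : ℕ) (r : ℝ) (a : ℕ) : Continuous (gapDensity n r a) := by
  unfold gapDensity; fun_prop

lemma gapDensity_nonneg {n : ℕ} {r : ℝ} (h0 : 0 ≤ r) (h1 : r < 1) (a : ℕ) (u : ℝ) :
    0 ≤ gapDensity n r a u :=
  mul_nonneg (mul_nonneg (Nat.cast_nonneg _) (div_nonneg h0 (by linarith)))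
    (pow_nonneg (le_max_right _ _) _)

lemma binomMix_nonneg {f : ℝ → ℝ} (hf : ∀ u ∈ Set.Icc (0 : ℝ) 1, 0 ≤ f u) (a k : ℕ) :
    0 ≤ binomMix f a k := by
  refine mul_nonneg (Nat.cast_nonneg _) (intervalIntegral.integral_nonneg zero_le_one fun u hu => ?_)
  exact mul_nonneg (mul_nonneg (pow_nonneg hu.1 _) (pow_nonneg (by linarith [hu.2]) _)) (hf u hu)

/-- The binomial theorem for `(u + (1 - u)) ^ a` under the integral sign. -/
lemma sum_binomMix {f : ℝ → ℝ} (hf : Continuous f) (a : ℕ) :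
    ∑ k ∈ Finset.range (a + 1), binomMix f a k = ∫ u in (0 : ℝ)..1, f u := by
  unfold binomMix
  simp_rw [← intervalIntegral.integral_const_mul]
  rw [← intervalIntegral.integral_finsetSum]
  · refine intervalIntegral.integral_congr fun u _ => ?_
    have := add_pow u (1 - u) a
    simp only [add_sub_cancel, one_pow] at this
    calc _ = (∑ k ∈ Finset.range (a + 1), u ^ k * (1 - u) ^ (a - k) * (a.choose k)) * f u := by
          rw [Finset.sum_mul]; refine Finset.sum_congr rfl fun k _ => ?_; ring
      _ = f u := by rw [← this, one_mul]
  · intro k _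
    exact Continuous.intervalIntegrable (by fun_prop) _ _

/-! ### Joint law of consecutive counts and the chain bound as a weighted sum -/

section CubeLaw

variable {n : ℕ} {r : ℝ}

/-- The condition `a + 1 < i` makes both truncations inactive, so the law does not depend on `i`.
Substituting `g = r u` and factoring `1 - r` out of `1 - r - r u` produces the gap density. -/
lemma real_leftNeighbors_pair (h0 : 0 ≤ r) (h1 : r < 1) {i a k : ℕ} (hi : i < n)
    (ha : a + 1 < i) (hk : k ≤ a) :
    (cubeMeasure n).real ((fun x => leftNeighbors (orderedGraph x r) i) ⁻¹' {a} ∩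
        (fun x => leftNeighbors (orderedGraph x r) (i + 1)) ⁻¹' {a + 1 - k}) =
      binomWeight n r a * binomMix (gapDensity n r a) a k := by
  obtain ⟨m, rfl⟩ : ∃ m, n = m + 1 := ⟨n - 1, by omega⟩
  have hpair := cubeMeasure_leftNeighbors_pair (n := m + 1) h0 ⟨i, hi⟩ ⟨0, by omega⟩
    (by simp only; omega) rfl {(a, a + 1 - k)}
  have hset : {x : Fin (m + 1) → ℝ | (min (i - 1) (countLE x (orderStat x ⟨0, by omega⟩ + r) - 1),
        min i (countLE x r)) ∈ ({(a, a + 1 - k)} : Set (ℕ × ℕ))} =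
      {x | countLE x (orderStat x ⟨0, by omega⟩ + r) - 1 = a ∧ countLE x r = a + 1 - k} := by
    ext x
    change (_, _) = (_, _) ↔ _ ∧ _
    rw [Prod.mk.injEq]
    omega
  have hset' : (fun x : Fin (m + 1) → ℝ => leftNeighbors (orderedGraph x r) i) ⁻¹' {a} ∩
        (fun x => leftNeighbors (orderedGraph x r) (i + 1)) ⁻¹' {a + 1 - k} =
      {x | (leftNeighbors (orderedGraph x r) i, leftNeighbors (orderedGraph x r) (i + 1)) ∈
        ({(a, a + 1 - k)} : Set (ℕ × ℕ))} := by
    ext x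
    change _ = _ ∧ _ = _ ↔ (_, _) = (_, _)
    rw [Prod.mk.injEq]
  simp only at hpair
  rw [hset', measureReal_def, hpair, hset, ← measureReal_def,
    cubeMeasure_countLE_pair h0 ⟨0, by omega⟩ rfl (by omega) hk]
  have hr1 : 0 < 1 - r := by linarith
  have hint : ∫ g in (0 : ℝ)..r, g ^ k * (r - g) ^ (a - k) * max (1 - (g + r)) 0 ^ (m - a) =
      r * ∫ u in (0 : ℝ)..1, r ^ a * (1 - r) ^ (m - a) *
        (u ^ k * (1 - u) ^ (a - k) * max (1 - r / (1 - r) * u) 0 ^ (m - a)) := by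
    have := intervalIntegral.mul_integral_comp_mul_left (a := 0) (b := 1) (c := r)
      (f := fun g => g ^ k * (r - g) ^ (a - k) * max (1 - (g + r)) 0 ^ (m - a))
    rw [mul_zero, mul_one] at this
    rw [← this]
    congr 1
    refine intervalIntegral.integral_congr fun u _ => ?_
    have e1 : max (1 - (r * u + r)) 0 = (1 - r) * max (1 - r / (1 - r) * u) 0 := by
      rw [mul_max_of_nonneg _ _ hr1.le, mul_zero]
      congr 1; field_simp; ring
    have e2 : r - r * u = r * (1 - u) := by ring
    have e3 : r ^ a = r ^ k * r ^ (a - k) := by rw [← pow_add]; congr 1; omega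
    change _ = _
    simp only [e1, e2, e3, mul_pow]
    ring
  have hmix : binomMix (gapDensity (m + 1) r a) a k = a.choose k * ((m + 1 - a : ℕ) * (r / (1 - r)) *
      ∫ u in (0 : ℝ)..1, u ^ k * (1 - u) ^ (a - k) * max (1 - r / (1 - r) * u) 0 ^ (m - a)) := by
    unfold binomMix gapDensity
    congr 1
    rw [← intervalIntegral.integral_const_mul]
    refine intervalIntegral.integral_congr fun u _ => ?_
    simp only [Nat.add_sub_cancel]; ring
  rw [hint, hmix, intervalIntegral.integral_const_mul]
  unfold binomWeight
  -- Trades choosing the leftmost point first for choosing the `a` neighbours first; this splits off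
  -- the binomial weight.
  have hch : ((m + 1 : ℕ) : ℝ) * m.choose a = (m + 1).choose a * (m + 1 - a : ℕ) := by
    have := Nat.choose_mul_succ_eq m a
    rw [mul_comm]; exact_mod_cast this
  have hp : (1 - r) ^ (m + 1 - a) = (1 - r) ^ (m - a) * (1 - r) := by
    rw [← pow_succ]; congr 1; omega
  rw [hp]
  generalize (∫ u in (0 : ℝ)..1, u ^ k * (1 - u) ^ (a - k) * max (1 - r / (1 - r) * u) 0 ^ (m - a)) = V
  calc _ = (((m + 1 : ℕ) : ℝ) * m.choose a) * (a.choose k * (r * (r ^ a * (1 - r) ^ (m - a) * V))) := by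
        ring
    _ = _ := by rw [hch]; field_simp

lemma real_leftNeighbors_succ (h0 : 0 ≤ r) {i : ℕ} (hi : i < n) (b : ℕ) :
    (cubeMeasure n).real ((fun x => leftNeighbors (orderedGraph x r) (i + 1)) ⁻¹' {b}) =
      (cubeMeasure n).real ((fun x => min i (countLE x r)) ⁻¹' {b}) := by
  rcases Nat.eq_zero_or_pos i with rfl | hpos
  · congr 1; ext x
    have := leftNeighbors_le x r hi
    simp only [Set.mem_preimage, Set.mem_singleton_iff]
    omega
  · have := cubeMeasure_leftNeighbors_pair (n := n) h0 ⟨i, hi⟩ ⟨0, by omega⟩ hpos rfl {v | v.2 = b}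
    rw [measureReal_def, measureReal_def]
    exact congrArg ENNReal.toReal this

lemma real_leftNeighbors_eq_binomWeight (h0 : 0 ≤ r) (h1 : r ≤ 1) {i a : ℕ} (hi : i < n)
    (ha : a < i) :
    (cubeMeasure n).real ((fun x => leftNeighbors (orderedGraph x r) (i + 1)) ⁻¹' {a}) =
      binomWeight n r a := by
  rw [real_leftNeighbors_succ h0 hi, binomWeight, ← cubeMeasure_countLE h0 h1]
  congr 1; ext x
  change min _ _ = a ↔ countLE x r = a
  omega

lemma binomWeight_nonneg (h0 : 0 ≤ r) (h1 : r ≤ 1) (a : ℕ) : 0 ≤ binomWeight n r a :=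
  mul_nonneg (mul_nonneg (Nat.cast_nonneg _) (pow_nonneg h0 _)) (pow_nonneg (by linarith) _)

lemma sum_binomWeight : ∑ a ∈ Finset.range (n + 1), binomWeight n r a = 1 := by
  have := add_pow r (1 - r) n
  rw [add_sub_cancel, one_pow] at this
  rw [this]
  refine Finset.sum_congr rfl fun a _ => ?_
  unfold binomWeight; ring

lemma sum_real_inter (i : ℕ) (s : Set (Fin n → ℝ)) (hs : MeasurableSet s) (N : ℕ)
    (hN : ∀ x ∈ s, leftNeighbors (orderedGraph x r) i < N) :
    ∑ b ∈ Finset.range N, (cubeMeasure n).real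
      (s ∩ (fun x => leftNeighbors (orderedGraph x r) i) ⁻¹' {b}) = (cubeMeasure n).real s := by
  rw [← measureReal_biUnion_finset]
  · congr 1; ext x
    simp only [Set.mem_iUnion, Finset.mem_range, Set.mem_inter_iff, Set.mem_preimage,
      Set.mem_singleton_iff, exists_prop, exists_eq_right_right']
    exact ⟨fun h => h.2, fun h => ⟨hN x h, h⟩⟩
  · intro b _ b' _ hb
    refine Set.disjoint_left.2 fun x h1 h2 => hb ?_
    simp only [Set.mem_inter_iff, Set.mem_preimage, Set.mem_singleton_iff] at h1 h2
    rw [← h1.2, ← h2.2]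
  · exact fun b _ => hs.inter (measurableSet_leftNeighbors r i b)

/-- The contribution of the event `L i = a` to the conditional entropy of `L (i + 1)`. -/
noncomputable def condTerm (n : ℕ) (r : ℝ) (i a : ℕ) : ℝ :=
  ∑ b ∈ Finset.range (i + 1),
    (cubeMeasure n).real ((fun x => leftNeighbors (orderedGraph x r) i) ⁻¹' {a}) *
      bits ((cubeMeasure n).real ((fun x => leftNeighbors (orderedGraph x r) i) ⁻¹' {a} ∩
        (fun x => leftNeighbors (orderedGraph x r) (i + 1)) ⁻¹' {b}) /
        (cubeMeasure n).real ((fun x => leftNeighbors (orderedGraph x r) i) ⁻¹' {a}))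

lemma condEntropy_eq_sum_condTerm {i : ℕ} (hi0 : 1 ≤ i) (hi : i < n) :
    condEntropy (cubeMeasure n) (fun x => leftNeighbors (orderedGraph x r) (i + 1))
      (fun x => leftNeighbors (orderedGraph x r) i) =
      ∑ a ∈ Finset.range i, condTerm n r i a := by
  rw [condEntropy_eq_sum (cubeMeasure n) _ _ (Finset.range (i + 1)) (Finset.range i)
    (fun x => Finset.mem_range.2 (Nat.lt_succ_of_le (leftNeighbors_le x r hi)))
    (fun x => Finset.mem_range.2 (by
      have := leftNeighbors_le x r (i := i - 1) (by omega)
      rw [Nat.sub_add_cancel hi0] at this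
      omega)) (fun z => measurableSet_leftNeighbors r i z)]
  rfl

lemma condTerm_nonneg (i a : ℕ) : 0 ≤ condTerm n r i a := by
  refine Finset.sum_nonneg fun b _ => mul_nonneg measureReal_nonneg (bits_nonneg ?_ ?_)
  · exact div_nonneg measureReal_nonneg measureReal_nonneg
  · exact div_le_one_of_le₀ (measureReal_mono Set.inter_subset_left) measureReal_nonneg

lemma condTerm_le (i a : ℕ) : condTerm n r i a ≤ 2 * (i + 1) *
    (cubeMeasure n).real ((fun x => leftNeighbors (orderedGraph x r) i) ⁻¹' {a}) := by
  unfold condTerm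
  rw [← Finset.mul_sum, mul_comm]
  refine mul_le_mul_of_nonneg_right ?_ measureReal_nonneg
  refine (Finset.sum_le_card_nsmul _ _ 2 fun b _ => bits_le_two ?_).trans (le_of_eq ?_)
  · exact div_nonneg measureReal_nonneg measureReal_nonneg
  · simp; ring

lemma sum_range_add_two_eq (F : ℕ → ℝ) (a : ℕ) : ∑ b ∈ Finset.range (a + 2), F b =
    F 0 + ∑ k ∈ Finset.range (a + 1), F (a + 1 - k) := by
  rw [Finset.sum_range_succ', add_comm, ← Finset.sum_range_reflect]
  congr 1
  refine Finset.sum_congr rfl fun k hk => ?_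
  congr 1
  have := Finset.mem_range.1 hk
  omega

/-- Computed as the complement: given `a`, the next count is at most `a + 1`, and the values `1, …,
a + 1` carry total mass `∫ gapDensity`. -/
lemma real_leftNeighbors_pair_zero (h0 : 0 ≤ r) (h1 : r < 1) {i a : ℕ} (hi : i < n)
    (ha : a + 1 < i) :
    (cubeMeasure n).real ((fun x => leftNeighbors (orderedGraph x r) i) ⁻¹' {a} ∩
        (fun x => leftNeighbors (orderedGraph x r) (i + 1)) ⁻¹' {0}) =
      binomWeight n r a * (1 - ∫ u in (0 : ℝ)..1, gapDensity n r a u) := by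
  have hmarg : (cubeMeasure n).real ((fun x => leftNeighbors (orderedGraph x r) i) ⁻¹' {a}) =
      binomWeight n r a := by
    have := real_leftNeighbors_eq_binomWeight h0 h1.le (n := n) (i := i - 1) (a := a)
      (by omega) (by omega)
    rwa [Nat.sub_add_cancel (by omega)] at this
  have hsum := sum_real_inter (n := n) (r := r) (i + 1) _ (measurableSet_leftNeighbors r i a) (a + 2)
    fun x hx => by
      have h2 := leftNeighbors_succ_le x r (i := i) (by omega) hi
      have h3 : leftNeighbors (orderedGraph x r) i = a := hx
      omega
  rw [sum_range_add_two_eq, Finset.sum_congr rfl fun k hk => real_leftNeighbors_pair h0 h1 hi ha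
    (Nat.lt_succ_iff.1 (Finset.mem_range.1 hk)), ← Finset.mul_sum,
    sum_binomMix (continuous_gapDensity n r a), hmarg] at hsum
  linarith

/-- For `r > 0` the deficit `1 - ∫` times a positive binomial weight is a probability, so the
integral need not be evaluated. The hypothesis makes `i = a + 2` an admissible index. -/
lemma integral_gapDensity_le_one (h0 : 0 ≤ r) (h1 : r < 1) {a : ℕ} (ha : a + 2 < n) :
    ∫ u in (0 : ℝ)..1, gapDensity n r a u ≤ 1 := by
  rcases h0.eq_or_lt with rfl | hr
  · simp [gapDensity]
  have h := real_leftNeighbors_pair_zero h0 h1 ha (i := a + 2) (a := a) (by omega)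
  have hw : 0 < binomWeight n r a := by
    have : 0 < n.choose a := Nat.choose_pos (by omega)
    have : 0 < 1 - r := by linarith
    unfold binomWeight; positivity
  have h2 := h ▸ measureReal_nonneg
  have := nonneg_of_mul_nonneg_right h2 hw
  linarith

lemma condTerm_eq (h0 : 0 ≤ r) (h1 : r < 1) {i a : ℕ} (hi : i < n) (ha : a + 1 < i) :
    condTerm n r i a = binomWeight n r a * stepEntropy (gapDensity n r a) a := by
  have hmarg : (cubeMeasure n).real ((fun x => leftNeighbors (orderedGraph x r) i) ⁻¹' {a}) =
      binomWeight n r a := by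
    have := real_leftNeighbors_eq_binomWeight h0 h1.le (n := n) (i := i - 1) (a := a)
      (by omega) (by omega)
    rwa [Nat.sub_add_cancel (by omega)] at this
  set P : ℕ → ℝ := fun b => (cubeMeasure n).real
    ((fun x => leftNeighbors (orderedGraph x r) i) ⁻¹' {a} ∩
        (fun x => leftNeighbors (orderedGraph x r) (i + 1)) ⁻¹' {b}) with hP
  have hbig : ∀ b, a + 2 ≤ b → P b = 0 := by
    intro b hb
    have : (fun x : Fin n → ℝ => leftNeighbors (orderedGraph x r) i) ⁻¹' {a} ∩
        (fun x => leftNeighbors (orderedGraph x r) (i + 1)) ⁻¹' {b} = ∅ := by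
      ext x
      simp only [Set.mem_inter_iff, Set.mem_preimage, Set.mem_singleton_iff,
        Set.mem_empty_iff_false, iff_false, not_and]
      intro h3
      have h2 := leftNeighbors_succ_le x r (i := i) (by omega) hi
      omega
    simp [hP, this]
  have hk : ∀ k ∈ Finset.range (a + 1),
      P (a + 1 - k) = binomWeight n r a * binomMix (gapDensity n r a) a k := fun k hk =>
    real_leftNeighbors_pair h0 h1 hi ha (Nat.lt_succ_iff.1 (Finset.mem_range.1 hk))
  have hP0 : P 0 = binomWeight n r a * (1 - ∫ u in (0 : ℝ)..1, gapDensity n r a u) :=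
    real_leftNeighbors_pair_zero h0 h1 hi ha
  have hterm : condTerm n r i a = ∑ b ∈ Finset.range (a + 2),
      binomWeight n r a * bits (P b / binomWeight n r a) := by
    unfold condTerm
    rw [hmarg]
    symm
    refine Finset.sum_subset (Finset.range_mono (by omega)) fun b _ hb => ?_
    change _ * bits (P b / _) = 0
    rw [hbig b (by simpa using hb)]; simp [bits_zero]
  rw [hterm, sum_range_add_two_eq, hP0, Finset.sum_congr rfl fun k hk' => by rw [hk k hk'],
    stepEntropy, mul_add, Finset.mul_sum]
  rcases eq_or_ne (binomWeight n r a) 0 with hw | hw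
  · simp [hw]
  · rw [mul_div_cancel_left₀ _ hw]
    congr 1
    refine Finset.sum_congr rfl fun k _ => ?_
    rw [mul_div_cancel_left₀ _ hw]

/-- The chain bound as a weighted sum of step entropies plus truncation terms. -/
lemma chainBound_eq (h0 : 0 ≤ r) (h1 : r < 1) :
    chainBound (cubeMeasure n) (fun x => orderedGraph x r) =
      entropy (cubeMeasure n) (fun x => leftNeighbors (orderedGraph x r) 2) +
      (∑ a ∈ Finset.range (n - 2), (n - 2 - a : ℕ) *
        (binomWeight n r a * stepEntropy (gapDensity n r a) a)) +
      ∑ i ∈ Finset.Icc 2 (n - 1), condTerm n r i (i - 1) := by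
  unfold chainBound
  rw [add_assoc]
  congr 1
  have h : ∀ i ∈ Finset.Icc 2 (n - 1), condEntropy (cubeMeasure n)
      (fun x => leftNeighbors (orderedGraph x r) (i + 1))
      (fun x => leftNeighbors (orderedGraph x r) i) =
      ∑ a ∈ Finset.range (i - 1), binomWeight n r a * stepEntropy (gapDensity n r a) a +
        condTerm n r i (i - 1) := by
    intro i hi
    obtain ⟨h2, h3⟩ := Finset.mem_Icc.1 hi
    rw [condEntropy_eq_sum_condTerm (by omega) (by omega)]
    obtain ⟨m, rfl⟩ : ∃ m, i = m + 1 := ⟨i - 1, by omega⟩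
    rw [Finset.sum_range_succ, Nat.add_sub_cancel]
    congr 1
    refine Finset.sum_congr rfl fun a ha => ?_
    have := Finset.mem_range.1 ha
    exact condTerm_eq h0 h1 (by omega) (by omega)
  rw [Finset.sum_congr rfl h, Finset.sum_add_distrib]
  congr 1
  -- The value `a` is untruncated exactly for `a + 2 ≤ i ≤ n - 1`, which is `n - 2 - a` indices. The
  -- remaining value `a = i - 1`, node `i` adjacent to all its predecessors, is the truncation term.
  rw [Finset.sum_comm' (t' := Finset.range (n - 2)) (s' := fun a => Finset.Icc (a + 2) (n - 1))]
  · refine Finset.sum_congr rfl fun a ha => ?_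
    rw [Finset.sum_const, Nat.card_Icc, nsmul_eq_mul]
    congr 2; omega
  · intro i a
    simp only [Finset.mem_Icc, Finset.mem_range]
    omega

end CubeLaw

/-! ### Entropy and tail bounds for a single step -/

section Bounds

variable {n : ℕ} {r : ℝ}

lemma sum_real_leftNeighbors_mul (h0 : 0 ≤ r) (h1 : r ≤ 1) {i : ℕ} (hi : i < n) :
    ∑ a ∈ Finset.range (n + 1),
      (cubeMeasure n).real ((fun x => leftNeighbors (orderedGraph x r) (i + 1)) ⁻¹' {a}) * (a : ℝ) =
      ∑ b ∈ Finset.range (n + 1), binomWeight n r b * (min i b : ℕ) := by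
  have hm : Measurable fun x : Fin n → ℝ => countLE x r :=
    measurable_countLE (f := fun _ => r) measurable_const
  have hW : ∀ s : Fin (n + 1), (fun x : Fin n → ℝ =>
      (⟨countLE x r, Nat.lt_succ_of_le (countLE_le x r)⟩ : Fin (n + 1))) ⁻¹' {s} =
      {x | countLE x r = s} := by
    intro s; ext x
    simp only [Set.mem_preimage, Set.mem_singleton_iff, Fin.ext_iff]
    rfl
  have := sum_real_preimage_comp_mul (cubeMeasure n)
    (fun x : Fin n → ℝ => (⟨countLE x r, Nat.lt_succ_of_le (countLE_le x r)⟩ : Fin (n + 1)))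
    (fun s => by rw [hW]; exact hm (measurableSet_singleton _))
    (fun s => min i (s : ℕ)) (Finset.range (n + 1)) (fun s => Finset.mem_range.2 (by omega))
    (fun a => (a : ℝ))
  rw [Finset.sum_congr rfl fun a _ => by rw [real_leftNeighbors_succ h0 hi a]]
  refine this.trans ?_
  rw [← Fin.sum_univ_eq_sum_range (fun b => binomWeight n r b * ((min i b : ℕ) : ℝ)) (n + 1)]
  refine Finset.sum_congr rfl fun s _ => ?_
  rw [hW, cubeMeasure_countLE h0 h1]
  rfl

lemma sum_real_leftNeighbors (i : ℕ) :
    ∑ a ∈ Finset.range (n + 1),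
      (cubeMeasure n).real ((fun x => leftNeighbors (orderedGraph x r) i) ⁻¹' {a}) = 1 := by
  have := sum_real_inter (n := n) (r := r) i Set.univ MeasurableSet.univ (n + 1)
    (fun x _ => leftNeighbors_lt _ _)
  simpa using this

/-- Comparison of a step of the chain with a geometric distribution. -/
lemma condEntropy_le_geometric (h0 : 0 ≤ r) (h1 : r ≤ 1) {i : ℕ} (hi0 : 1 ≤ i) (hi : i < n)
    {θ : ℝ} (hθ0 : 0 < θ) (hθ1 : θ < 1) :
    condEntropy (cubeMeasure n) (fun x => leftNeighbors (orderedGraph x r) (i + 1))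
      (fun x => leftNeighbors (orderedGraph x r) i) ≤
      -Real.logb 2 (1 - θ) - Real.logb 2 θ * ∑ b ∈ Finset.range i, binomWeight n r b := by
  have hθ : 0 < 1 - θ := by linarith
  set P : ℕ → ℕ → ℝ := fun a b => (cubeMeasure n).real
    ((fun x => leftNeighbors (orderedGraph x r) i) ⁻¹' {a} ∩
        (fun x => leftNeighbors (orderedGraph x r) (i + 1)) ⁻¹' {b}) with hP
  have hbig : ∀ a b, a + 1 < b → P a b = 0 := by
    intro a b hb
    have : (fun x : Fin n → ℝ => leftNeighbors (orderedGraph x r) i) ⁻¹' {a} ∩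
        (fun x => leftNeighbors (orderedGraph x r) (i + 1)) ⁻¹' {b} = ∅ := by
      ext x
      simp only [Set.mem_inter_iff, Set.mem_preimage, Set.mem_singleton_iff,
        Set.mem_empty_iff_false, iff_false, not_and]
      intro h3
      have h2 := leftNeighbors_succ_le x r hi0 hi
      omega
    simp [hP, this]
  have key := condEntropy_le_of_kernel (cubeMeasure n)
    (fun x => leftNeighbors (orderedGraph x r) (i + 1))
    (fun x => leftNeighbors (orderedGraph x r) i) (n + 1) (fun _ => leftNeighbors_lt _ _)
    (fun _ => leftNeighbors_lt _ _) (measurableSet_leftNeighbors r i)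
    (measurableSet_leftNeighbors r (i + 1))
    -- Under this kernel the number `a + 1 - b` of neighbours lost is geometric with ratio `θ`.
    (fun a b => if b ≤ a + 1 then (1 - θ) * θ ^ (a + 1 - b) else 0)
    (fun a b => by
      split_ifs
      · positivity
      · rfl)
    (fun a => by
      rw [← Finset.sum_filter]
      calc _ ≤ ∑ b ∈ Finset.range (a + 2), (1 - θ) * θ ^ (a + 1 - b) := by
            refine Finset.sum_le_sum_of_subset_of_nonneg ?_ fun b _ _ => by positivity
            intro b hb
            have := (Finset.mem_filter.1 hb).2
            exact Finset.mem_range.2 (by omega)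
        _ = (1 - θ) * ∑ k ∈ Finset.range (a + 2), θ ^ k := by
            rw [← Finset.mul_sum, ← Finset.sum_range_reflect]
            congr 1
            refine Finset.sum_congr rfl fun k hk => ?_
            congr 1
            have := Finset.mem_range.1 hk
            omega
        _ = 1 - θ ^ (a + 2) := mul_neg_geom_sum θ (a + 2)
        _ ≤ 1 := by have := pow_pos hθ0 (a + 2); linarith)
    (fun a b h => by
      have : b ≤ a + 1 := by
        by_contra hne
        exact h.ne' (hbig a b (by omega))
      simp only [this, if_true]; positivity)
  refine key.trans (le_of_eq ?_)
  -- The logarithm of the kernel is affine in `a` and `b`, so the cross entropy involves only the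
  -- means of `L i` and `L (i+1)`.
  have hterm : ∀ a b, -(P a b * Real.logb 2 (if b ≤ a + 1 then (1 - θ) * θ ^ (a + 1 - b) else 0)) =
      (-Real.logb 2 (1 - θ) - Real.logb 2 θ) * P a b - Real.logb 2 θ * (P a b * a) +
        Real.logb 2 θ * (P a b * b) := by
    intro a b
    by_cases h : b ≤ a + 1
    · rw [if_pos h, Real.logb_mul hθ.ne' (pow_pos hθ0 _).ne', Real.logb_pow, Nat.cast_sub h]
      push_cast; ring
    · rw [hbig a b (by omega)]; ring
  have s1 : ∀ a, ∑ b ∈ Finset.range (n + 1), P a b =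
      (cubeMeasure n).real ((fun x => leftNeighbors (orderedGraph x r) i) ⁻¹' {a}) := fun a =>
    sum_real_inter (i + 1) _ (measurableSet_leftNeighbors r i a) _ fun _ _ => leftNeighbors_lt _ _
  have s2 : ∀ b, ∑ a ∈ Finset.range (n + 1), P a b =
      (cubeMeasure n).real ((fun x => leftNeighbors (orderedGraph x r) (i + 1)) ⁻¹' {b}) := by
    intro b
    rw [← sum_real_inter i _ (measurableSet_leftNeighbors r (i + 1) b) (n + 1)
      fun _ _ => leftNeighbors_lt _ _]
    exact Finset.sum_congr rfl fun a _ => by rw [Set.inter_comm]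
  have t1 : ∑ a ∈ Finset.range (n + 1), ∑ b ∈ Finset.range (n + 1), P a b = 1 := by
    rw [Finset.sum_congr rfl fun a _ => s1 a, sum_real_leftNeighbors]
  have t2 : ∑ a ∈ Finset.range (n + 1), ∑ b ∈ Finset.range (n + 1), P a b * a =
      ∑ b ∈ Finset.range (n + 1), binomWeight n r b * (min (i - 1) b : ℕ) := by
    have := sum_real_leftNeighbors_mul h0 h1 (n := n) (i := i - 1) (by omega)
    rw [Nat.sub_add_cancel hi0] at this
    rw [← this]
    exact Finset.sum_congr rfl fun a _ => by rw [← Finset.sum_mul, s1]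
  have t3 : ∑ a ∈ Finset.range (n + 1), ∑ b ∈ Finset.range (n + 1), P a b * b =
      ∑ b ∈ Finset.range (n + 1), binomWeight n r b * (min i b : ℕ) := by
    rw [← sum_real_leftNeighbors_mul h0 h1 hi, Finset.sum_comm]
    exact Finset.sum_congr rfl fun a _ => by rw [← Finset.sum_mul, s2]
  -- The means are those of `Bin(n, r)` truncated at `i - 1` and at `i`; the two truncations differ
  -- by `1` exactly when the binomial is at least `i`.
  have t4 : ∑ b ∈ Finset.range i, binomWeight n r b =
      1 + ∑ b ∈ Finset.range (n + 1), binomWeight n r b * (min (i - 1) b : ℕ) -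
        ∑ b ∈ Finset.range (n + 1), binomWeight n r b * (min i b : ℕ) := by
    rw [← sum_binomWeight (n := n) (r := r), ← Finset.sum_add_distrib, ← Finset.sum_sub_distrib]
    have : Finset.range i = (Finset.range (n + 1)).filter (· < i) := by
      ext b; simp only [Finset.mem_range, Finset.mem_filter]; omega
    rw [this, Finset.sum_filter]
    refine Finset.sum_congr rfl fun b _ => ?_
    by_cases h : b < i
    · rw [if_pos h, min_eq_right (by omega), min_eq_right (by omega)]; ring
    · rw [if_neg h, min_eq_left (by omega), min_eq_left (by omega), Nat.cast_sub hi0]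
      push_cast; ring
  rw [Finset.sum_congr rfl fun a _ => Finset.sum_congr rfl fun b _ => hterm a b]
  simp only [Finset.sum_add_distrib, Finset.sum_sub_distrib, ← Finset.mul_sum]
  rw [t1, t2, t3, t4]
  ring

/-- A union bound: at least `j` successes means that one of the `n.choose j` sets of `j` trials
succeeds throughout. -/
lemma sum_binomWeight_tail_le (h0 : 0 ≤ r) (h1 : r ≤ 1) (j : ℕ) :
    1 - ∑ a ∈ Finset.range j, binomWeight n r a ≤ (n * r) ^ j / j.factorial := by
  have hc : 0 ≤ (n * r) ^ j / j.factorial := by positivity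
  by_cases hj : n < j
  · have : ∑ a ∈ Finset.range (n + 1), binomWeight n r a ≤ ∑ a ∈ Finset.range j, binomWeight n r a :=
      Finset.sum_le_sum_of_subset_of_nonneg (Finset.range_mono (by omega))
        fun a _ _ => binomWeight_nonneg h0 h1 a
    rw [sum_binomWeight] at this
    linarith
  push Not at hj
  have hsplit := Finset.sum_range_add_sum_Ico (binomWeight n r) (show j ≤ n + 1 by omega)
  rw [sum_binomWeight] at hsplit
  have h2 : ∑ a ∈ Finset.Ico j (n + 1), binomWeight n r a ≤ n.choose j * r ^ j := by
    rw [Finset.sum_Ico_eq_sum_range, show n + 1 - j = (n - j) + 1 by omega]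
    calc _ ≤ ∑ k ∈ Finset.range (n - j + 1), n.choose j * r ^ j * binomWeight (n - j) r k := by
          refine Finset.sum_le_sum fun k hk => ?_
          have hk' := Finset.mem_range.1 hk
          unfold binomWeight
          have e1 : (n.choose (j + k) : ℝ) ≤ n.choose j * (n - j).choose k := by
            have := Nat.choose_mul (n := n) (k := j + k) (s := j) (by omega)
            have h3 : 1 ≤ (j + k).choose j := Nat.choose_pos (by omega)
            rw [Nat.add_sub_cancel_left] at this
            have h4 : n.choose (j + k) ≤ n.choose j * (n - j).choose k := by nlinarith
            exact_mod_cast h4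
          have e2 : n - (j + k) = n - j - k := by omega
          have hr : 0 ≤ 1 - r := by linarith
          rw [e2, pow_add]
          calc _ ≤ (n.choose j * (n - j).choose k : ℝ) * (r ^ j * r ^ k) * (1 - r) ^ (n - j - k) := by
                gcongr
            _ = _ := by ring
      _ = n.choose j * r ^ j := by rw [← Finset.mul_sum, sum_binomWeight, mul_one]
  have h3 : (n.choose j : ℝ) * r ^ j ≤ (n * r) ^ j / j.factorial := by
    rw [mul_pow, mul_div_right_comm]
    gcongr
    exact Nat.choose_le_pow_div j n
  linarith

lemma real_leftNeighbors_eq_top (h0 : 0 ≤ r) (h1 : r ≤ 1) {i : ℕ} (hi : i < n) :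
    (cubeMeasure n).real ((fun x => leftNeighbors (orderedGraph x r) (i + 1)) ⁻¹' {i}) =
      1 - ∑ a ∈ Finset.range i, binomWeight n r a := by
  have h := sum_real_inter (n := n) (r := r) (i + 1) Set.univ MeasurableSet.univ (i + 1)
    (fun x _ => Nat.lt_succ_of_le (leftNeighbors_le x r hi))
  simp only [Set.univ_inter, probReal_univ] at h
  rw [Finset.sum_range_succ, Finset.sum_congr rfl fun a ha =>
    real_leftNeighbors_eq_binomWeight h0 h1 hi (Finset.mem_range.1 ha)] at h
  linarith

lemma condTerm_top_le (h0 : 0 ≤ r) (h1 : r ≤ 1) {i : ℕ} (hi0 : 1 ≤ i) (hi : i < n) :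
    condTerm n r i (i - 1) ≤ 2 * (i + 1) * ((n * r) ^ (i - 1) / (i - 1).factorial) := by
  refine (condTerm_le i (i - 1)).trans ?_
  have := real_leftNeighbors_eq_top h0 h1 (n := n) (i := i - 1) (by omega)
  rw [Nat.sub_add_cancel hi0] at this
  rw [this]
  have := sum_binomWeight_tail_le (n := n) h0 h1 (i - 1)
  gcongr

/-- `L 2` takes only the values `0` and `1`, and vanishes with the probability `(1 - r) ^ n` that no
point lies within `r` of the origin. -/
lemma entropy_leftNeighbors_two (h0 : 0 ≤ r) (h1 : r ≤ 1) (hn : 2 ≤ n) :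
    entropy (cubeMeasure n) (fun x => leftNeighbors (orderedGraph x r) 2) =
      bits ((1 - r) ^ n) + bits (1 - (1 - r) ^ n) := by
  rw [entropy_eq_sum _ _ (Finset.range 2)
    (fun x => Finset.mem_range.2 (Nat.lt_succ_of_le (leftNeighbors_le x r (by omega))))]
  rw [Finset.sum_range_succ, Finset.sum_range_one]
  have e0 := real_leftNeighbors_eq_binomWeight h0 h1 (n := n) (i := 1) (a := 0) (by omega) (by omega)
  have e1 := real_leftNeighbors_eq_top h0 h1 (n := n) (i := 1) (by omega)
  rw [Finset.sum_range_one] at e1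
  simp only [binomWeight, Nat.choose_zero_right, Nat.cast_one, pow_zero, mul_one, one_mul,
    Nat.sub_zero] at e0 e1
  rw [e0, e1]

lemma entropy_leftNeighbors_two_nonneg (h0 : 0 ≤ r) (h1 : r ≤ 1) (hn : 2 ≤ n) :
    0 ≤ entropy (cubeMeasure n) (fun x => leftNeighbors (orderedGraph x r) 2) := by
  have h2 : 0 ≤ (1 - r) ^ n := pow_nonneg (by linarith) _
  have h3 : (1 - r) ^ n ≤ 1 := pow_le_one₀ (by linarith) (by linarith)
  rw [entropy_leftNeighbors_two h0 h1 hn]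
  exact add_nonneg (bits_nonneg h2 h3) (bits_nonneg (by linarith) (by linarith))

lemma entropy_leftNeighbors_two_le (h0 : 0 ≤ r) (h1 : r ≤ 1) (hn : 2 ≤ n) :
    entropy (cubeMeasure n) (fun x => leftNeighbors (orderedGraph x r) 2) ≤ 4 := by
  have h2 : 0 ≤ (1 - r) ^ n := pow_nonneg (by linarith) _
  have h3 : (1 - r) ^ n ≤ 1 := pow_le_one₀ (by linarith) (by linarith)
  rw [entropy_leftNeighbors_two h0 h1 hn]
  have := bits_le_two h2
  have := bits_le_two (t := 1 - (1 - r) ^ n) (by linarith)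
  linarith

/-- The variance identity for Bernstein polynomials, evaluated at `r`; it feeds Chebyshev's
inequality in the next lemma. -/
lemma sum_binomWeight_variance :
    ∑ a ∈ Finset.range (n + 1), (n * r - a) ^ 2 * binomWeight n r a = n * r * (1 - r) := by
  have := congrArg (Polynomial.eval r) (bernsteinPolynomial.variance ℝ n)
  simp only [Polynomial.eval_finsetSum, Polynomial.eval_mul, Polynomial.eval_pow,
    Polynomial.eval_sub, nsmul_eq_mul, Polynomial.eval_natCast, Polynomial.eval_X,
    bernsteinPolynomial, Polynomial.eval_one] at this
  exact this

lemma sum_binomWeight_far_le (h0 : 0 ≤ r) (h1 : r ≤ 1) {t : ℝ} (ht : 0 < t) (s : Finset ℕ)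
    (hs : s ⊆ Finset.range (n + 1)) (hst : ∀ a ∈ s, t ≤ |n * r - a|) :
    ∑ a ∈ s, binomWeight n r a ≤ n * r / t ^ 2 := by
  rw [le_div_iff₀ (by positivity), Finset.sum_mul]
  calc ∑ a ∈ s, binomWeight n r a * t ^ 2 ≤ ∑ a ∈ s, (n * r - a) ^ 2 * binomWeight n r a := by
        refine Finset.sum_le_sum fun a ha => ?_
        rw [mul_comm]
        refine mul_le_mul_of_nonneg_right ?_ (binomWeight_nonneg h0 h1 a)
        rw [← sq_abs (n * r - a)]
        have := hst a ha
        gcongr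
    _ ≤ ∑ a ∈ Finset.range (n + 1), (n * r - a) ^ 2 * binomWeight n r a :=
        Finset.sum_le_sum_of_subset_of_nonneg hs fun a _ _ =>
          mul_nonneg (sq_nonneg _) (binomWeight_nonneg h0 h1 a)
    _ = n * r * (1 - r) := sum_binomWeight_variance
    _ ≤ n * r := by
        have : 0 ≤ (n : ℝ) * r := by positivity
        nlinarith

end Bounds

/-! ### The limit function as a Poisson average of step entropies -/

section LimitFunction

/-- The density of the rescaled gap in the limit: exponential with rate `x`. -/
noncomputable def expDensity (x u : ℝ) : ℝ := x * Real.exp (-(x * u))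

/-- The Poisson weights. -/
noncomputable def poissonWeight (x : ℝ) (a : ℕ) : ℝ := x ^ a * Real.exp (-x) / a.factorial

lemma continuous_expDensity (x : ℝ) : Continuous (expDensity x) := by
  unfold expDensity; fun_prop

lemma expDensity_nonneg {x : ℝ} (hx : 0 ≤ x) (u : ℝ) : 0 ≤ expDensity x u :=
  mul_nonneg hx (Real.exp_pos _).le

lemma integral_expDensity (x : ℝ) : ∫ u in (0 : ℝ)..1, expDensity x u = 1 - Real.exp (-x) := by
  have h : ∀ u ∈ Set.uIcc (0 : ℝ) 1,
      HasDerivAt (fun u => -Real.exp (-(x * u))) (expDensity x u) u := by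
    intro u _
    have h1 : HasDerivAt (fun u : ℝ => -(x * u)) (-(x * 1)) u := ((hasDerivAt_id u).const_mul x).neg
    exact h1.exp.neg.congr_deriv (by unfold expDensity; ring)
  rw [intervalIntegral.integral_eq_sub_of_hasDerivAt h
    ((continuous_expDensity x).intervalIntegrable _ _)]
  simp; ring

/-- The Gamma quotient is `(a + 1)! / (k! (a - k)!)`; the prefactor `x / (a + 1)` reduces it to `x`
times `a.choose k`. -/
lemma kummerM_eq_binomMix (x : ℝ) {a k : ℕ} (hk : k ≤ a) :
    x / ((a : ℝ) + 1) * kummerM ((k : ℝ) + 1) ((a : ℝ) + 2) (-x) = binomMix (expDensity x) a k := by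
  have hak : ((a : ℝ) + 2) - ((k : ℝ) + 1) = ((a - k : ℕ) : ℝ) + 1 := by
    rw [Nat.cast_sub hk]; ring
  have hG : Real.Gamma ((a : ℝ) + 2) = (a + 1) * a.factorial := by
    have := Real.Gamma_nat_eq_factorial (a + 1)
    rw [Nat.factorial_succ] at this
    push_cast at this
    rw [← this]; congr 1; ring
  have hint : ∫ t in (0 : ℝ)..1, t ^ ((k : ℝ) + 1 - 1) * (1 - t) ^ (((a - k : ℕ) : ℝ) + 1 - 1) *
      Real.exp (-x * t) = ∫ t in (0 : ℝ)..1, t ^ k * (1 - t) ^ (a - k) * Real.exp (-(x * t)) := by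
    refine intervalIntegral.integral_congr fun t _ => ?_
    simp only [add_sub_cancel_right, Real.rpow_natCast, neg_mul]
  have hmix : binomMix (expDensity x) a k = a.choose k * (x *
      ∫ t in (0 : ℝ)..1, t ^ k * (1 - t) ^ (a - k) * Real.exp (-(x * t))) := by
    unfold binomMix expDensity
    congr 1
    rw [← intervalIntegral.integral_const_mul]
    refine intervalIntegral.integral_congr fun t _ => ?_
    ring
  unfold kummerM
  rw [hak, hint, hmix, hG, Real.Gamma_nat_eq_factorial, Real.Gamma_nat_eq_factorial,
    Nat.cast_choose ℝ hk]
  have : (a : ℝ) + 1 ≠ 0 := by positivity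
  field_simp

lemma bits_exp_neg (x : ℝ) : bits (Real.exp (-x)) = x * Real.exp (-x) / Real.log 2 := by
  unfold bits Real.logb; rw [Real.log_exp]; ring

lemma stepEntropy_expDensity (x : ℝ) (a : ℕ) : stepEntropy (expDensity x) a =
    x * Real.exp (-x) / Real.log 2 + ∑ k ∈ Finset.range (a + 1), bits (binomMix (expDensity x) a k) := by
  unfold stepEntropy
  rw [integral_expDensity, sub_sub_cancel, bits_exp_neg]

lemma binomMix_le_one {f : ℝ → ℝ} (hf : Continuous f) (h0 : ∀ u ∈ Set.Icc (0 : ℝ) 1, 0 ≤ f u)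
    (h1 : ∫ u in (0 : ℝ)..1, f u ≤ 1) {a k : ℕ} (hk : k ∈ Finset.range (a + 1)) :
    binomMix f a k ≤ 1 := by
  refine le_trans ?_ h1
  rw [← sum_binomMix hf a]
  exact Finset.single_le_sum (f := fun k => binomMix f a k) (fun k _ => binomMix_nonneg h0 a k) hk

lemma stepEntropy_nonneg {f : ℝ → ℝ} (hf : Continuous f) (h0 : ∀ u ∈ Set.Icc (0 : ℝ) 1, 0 ≤ f u)
    (h1 : ∫ u in (0 : ℝ)..1, f u ≤ 1) (a : ℕ) : 0 ≤ stepEntropy f a := by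
  have h2 := intervalIntegral.integral_nonneg (μ := volume) zero_le_one h0
  refine add_nonneg (bits_nonneg (by linarith) (by linarith)) (Finset.sum_nonneg fun k hk => ?_)
  exact bits_nonneg (binomMix_nonneg h0 a k) (binomMix_le_one hf h0 h1 hk)

lemma stepEntropy_le {f : ℝ → ℝ} (h0 : ∀ u ∈ Set.Icc (0 : ℝ) 1, 0 ≤ f u)
    (h1 : ∫ u in (0 : ℝ)..1, f u ≤ 1) (a : ℕ) : stepEntropy f a ≤ 2 * (a + 2) := by
  have h3 : ∑ k ∈ Finset.range (a + 1), bits (binomMix f a k) ≤ (a + 1) * 2 := by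
    refine (Finset.sum_le_card_nsmul _ _ 2 fun k _ => bits_le_two (binomMix_nonneg h0 a k)).trans ?_
    simp
  have := bits_le_two (t := 1 - ∫ u in (0 : ℝ)..1, f u) (by linarith)
  unfold stepEntropy; linarith

lemma integral_expDensity_le_one (x : ℝ) : ∫ u in (0 : ℝ)..1, expDensity x u ≤ 1 := by
  rw [integral_expDensity]; linarith [Real.exp_pos (-x)]

lemma stepEntropy_expDensity_nonneg {x : ℝ} (hx : 0 ≤ x) (a : ℕ) : 0 ≤ stepEntropy (expDensity x) a :=
  stepEntropy_nonneg (continuous_expDensity x) (fun u _ => expDensity_nonneg hx u)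
    (integral_expDensity_le_one x) a

lemma poissonWeight_nonneg {x : ℝ} (hx : 0 ≤ x) (a : ℕ) : 0 ≤ poissonWeight x a := by
  unfold poissonWeight; positivity

lemma poissonWeight_le {x : ℝ} (hx : 0 ≤ x) (a : ℕ) : poissonWeight x a ≤ x ^ a / a.factorial := by
  unfold poissonWeight
  gcongr
  exact mul_le_of_le_one_right (by positivity) (Real.exp_le_one_iff.2 (by linarith))

lemma hasSum_poissonWeight (x : ℝ) : HasSum (poissonWeight x) 1 := by
  have := (NormedSpace.expSeries_div_hasSum_exp x).mul_right (Real.exp (-x))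
  rw [← Real.exp_eq_exp_ℝ, ← Real.exp_add, add_neg_cancel, Real.exp_zero] at this
  have e : poissonWeight x = fun a : ℕ => x ^ a / a.factorial * Real.exp (-x) := by
    funext a; unfold poissonWeight; ring
  rw [e]; exact this

/-- The limiting step entropy contains `bits (exp (-x))`, whatever `a` is. Averaged over the Poisson
weights this gives the leading term of `hU`, so that term cancels in `hU_eq_tsum`. -/
lemma hUTerm_eq (x : ℝ) (a : ℕ) : hUTerm x a =
    poissonWeight x a * (x * Real.exp (-x) / Real.log 2) -
      poissonWeight x a * stepEntropy (expDensity x) a := by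
  rw [stepEntropy_expDensity]
  unfold hUTerm
  have : ∑ k ∈ Finset.range (a + 1), x / ((a : ℝ) + 1) * kummerM ((k : ℝ) + 1) ((a : ℝ) + 2) (-x) *
        Real.logb 2 (x / ((a : ℝ) + 1) * kummerM ((k : ℝ) + 1) ((a : ℝ) + 2) (-x)) =
      -∑ k ∈ Finset.range (a + 1), bits (binomMix (expDensity x) a k) := by
    rw [← Finset.sum_neg_distrib]
    refine Finset.sum_congr rfl fun k hk => ?_
    rw [kummerM_eq_binomMix x (Nat.lt_succ_iff.1 (Finset.mem_range.1 hk)), bits, neg_neg]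
  rw [this]
  unfold poissonWeight; ring

/-- The common majorant for tails in `a`, where `2 (a + 2)` is the crude bound on a step entropy.
The exponent is `a - 1` because one factor `x` is kept outside, making the tails small relative to
`x`. -/
lemma summable_tail_const (C : ℝ) :
    Summable fun a : ℕ => C ^ (a - 1) * (2 * ((a : ℝ) + 2)) / a.factorial := by
  rw [← summable_nat_add_iff 1]
  refine Summable.of_norm_bounded (g := fun a : ℕ => 6 * (|C| ^ a / a.factorial))
    ((Real.summable_pow_div_factorial |C|).mul_left 6) fun a => ?_
  rw [Nat.add_sub_cancel, norm_div, norm_mul, norm_pow, Real.norm_eq_abs, Nat.factorial_succ,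
    Real.norm_of_nonneg (by positivity), Real.norm_of_nonneg (by positivity)]
  push_cast
  rw [div_le_iff₀ (by positivity)]
  have hf : (0 : ℝ) < a.factorial := by positivity
  have e : 6 * (|C| ^ a / (a.factorial : ℝ)) * (((a : ℝ) + 1) * a.factorial) =
      |C| ^ a * (6 * (a + 1)) := by field_simp
  rw [e]
  refine mul_le_mul_of_nonneg_left ?_ (by positivity)
  have : (0 : ℝ) ≤ a := Nat.cast_nonneg a
  linarith

lemma pow_div_factorial_mul_le {x C : ℝ} (hx : 0 ≤ x) (hC : x ≤ C) {a : ℕ} (ha : 1 ≤ a) :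
    x ^ a / a.factorial * (2 * ((a : ℝ) + 2)) ≤
      x * (C ^ (a - 1) * (2 * ((a : ℝ) + 2)) / a.factorial) := by
  obtain ⟨m, rfl⟩ : ∃ m, a = m + 1 := ⟨a - 1, by omega⟩
  rw [Nat.add_sub_cancel, pow_succ]
  have : x ^ m ≤ C ^ m := pow_le_pow_left₀ hx hC m
  calc _ = x * (x ^ m * (2 * (((m + 1 : ℕ) : ℝ) + 2)) / (m + 1).factorial) := by ring
    _ ≤ _ := by gcongr

lemma poissonWeight_mul_stepEntropy_le {x C : ℝ} (hx : 0 ≤ x) (hC : x ≤ C) {a : ℕ} (ha : 1 ≤ a) :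
    poissonWeight x a * stepEntropy (expDensity x) a ≤
      x * (C ^ (a - 1) * (2 * ((a : ℝ) + 2)) / a.factorial) := by
  refine le_trans ?_ (pow_div_factorial_mul_le hx hC ha)
  exact mul_le_mul (poissonWeight_le hx a) (stepEntropy_le (fun u _ => expDensity_nonneg hx u)
    (integral_expDensity_le_one x) a) (stepEntropy_expDensity_nonneg hx a) (by positivity)

lemma summable_poissonWeight_mul_stepEntropy {x : ℝ} (hx : 0 ≤ x) :
    Summable fun a => poissonWeight x a * stepEntropy (expDensity x) a := by
  rw [← summable_nat_add_iff 1]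
  refine Summable.of_nonneg_of_le (fun a => mul_nonneg (poissonWeight_nonneg hx _)
    (stepEntropy_expDensity_nonneg hx _))
    (fun a => poissonWeight_mul_stepEntropy_le hx le_rfl (by omega)) ?_
  exact ((summable_nat_add_iff 1).2 (summable_tail_const x)).mul_left x

lemma summable_hUTerm {x : ℝ} (hx : 0 ≤ x) : Summable (hUTerm x) := by
  have := ((hasSum_poissonWeight x).summable.mul_right (x * Real.exp (-x) / Real.log 2)).sub
    (summable_poissonWeight_mul_stepEntropy hx)
  exact this.congr fun a => (hUTerm_eq x a).symm

lemma hU_eq_tsum {x : ℝ} (hx : 0 ≤ x) :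
    hU x = ∑' a, poissonWeight x a * stepEntropy (expDensity x) a := by
  have h1 := (hasSum_poissonWeight x).mul_right (x * Real.exp (-x) / Real.log 2)
  have h2 := (summable_poissonWeight_mul_stepEntropy hx).hasSum
  have h3 := (h1.sub h2).tsum_eq
  unfold hU
  rw [show hUTerm x = fun a => _ from funext fun a => hUTerm_eq x a, h3]
  ring

lemma hU_nonneg {x : ℝ} (hx : 0 ≤ x) : 0 ≤ hU x := by
  rw [hU_eq_tsum hx]
  exact tsum_nonneg fun a => mul_nonneg (poissonWeight_nonneg hx _) (stepEntropy_expDensity_nonneg hx _)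

/-- Every step entropy is at least `bits (exp (-x))`. For bounded `x` this turns errors of order `x`
into errors relative to `hU x`. -/
lemma mul_exp_neg_le_hU {x : ℝ} (hx : 0 ≤ x) : x * Real.exp (-x) ≤ hU x := by
  have hl : 0 < Real.log 2 := Real.log_pos (by norm_num)
  have h1 := (hasSum_poissonWeight x).mul_right (x * Real.exp (-x) / Real.log 2)
  rw [one_mul] at h1
  have h2 : x * Real.exp (-x) / Real.log 2 ≤ hU x := by
    rw [hU_eq_tsum hx]
    refine hasSum_le (fun a => ?_) h1 (summable_poissonWeight_mul_stepEntropy hx).hasSum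
    refine mul_le_mul_of_nonneg_left ?_ (poissonWeight_nonneg hx a)
    rw [stepEntropy_expDensity]
    refine le_add_of_nonneg_right (Finset.sum_nonneg fun k hk => bits_nonneg ?_ ?_)
    · exact binomMix_nonneg (fun u _ => expDensity_nonneg hx u) a k
    · exact binomMix_le_one (continuous_expDensity x) (fun u _ => expDensity_nonneg hx u)
        (integral_expDensity_le_one x) hk
  refine le_trans ?_ h2
  rw [le_div_iff₀ hl]
  have : Real.log 2 ≤ 1 := by have := Real.log_two_lt_d9; linarith
  exact mul_le_of_le_one_right (by positivity) this

/-- Keeps only the term `a = 0` of the series. It is needed because `H(L 2)` behaves like `x log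
(1/x)` near `0`, which the linear lower bound does not control. -/
lemma exp_neg_mul_bits_le_hU {x : ℝ} (hx : 0 ≤ x) :
    Real.exp (-x) * bits (1 - Real.exp (-x)) ≤ hU x := by
  have h1 : poissonWeight x 0 * stepEntropy (expDensity x) 0 ≤ hU x := by
    rw [hU_eq_tsum hx]
    exact (summable_poissonWeight_mul_stepEntropy hx).le_tsum 0 fun a _ =>
      mul_nonneg (poissonWeight_nonneg hx _) (stepEntropy_expDensity_nonneg hx _)
  refine le_trans ?_ h1
  have e1 : poissonWeight x 0 = Real.exp (-x) := by simp [poissonWeight]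
  have e2 : binomMix (expDensity x) 0 0 = 1 - Real.exp (-x) := by
    have := sum_binomMix (continuous_expDensity x) 0
    rw [integral_expDensity] at this
    simpa using this
  rw [e1, stepEntropy_expDensity, zero_add, Finset.sum_range_one, e2]
  refine mul_le_mul_of_nonneg_left ?_ (Real.exp_pos _).le
  refine le_add_of_nonneg_left (div_nonneg (by positivity) (Real.log_nonneg (by norm_num)))

end LimitFunction

/-! ### The sparse regime, with relative errors uniform in `n r ≤ C` -/

section Sparse

open Topology

/-- With `s = c t` one has `bits s - bits t = (c - 1) * bits t + t * bits c`, and `bits c` is at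
most of order `|c - 1|` near `c = 1`. -/
lemma bits_sub_le {s t δ : ℝ} (ht0 : 0 ≤ t) (hδ0 : 0 ≤ δ) (hδ : δ ≤ 1 / 2)
    (ht1 : t ≤ 1) (h : |s - t| ≤ δ * t) : |bits s - bits t| ≤ δ * bits t + 4 * δ * t := by
  have hl := log_two_gt_half
  rcases ht0.eq_or_lt with rfl | ht
  · have : s = 0 := by simpa using h
    simp [this, bits_zero]
  obtain ⟨c, rfl⟩ : ∃ c, s = c * t := ⟨s / t, by field_simp⟩
  have hc : |c - 1| ≤ δ := by
    have e : c * t - t = (c - 1) * t := by ring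
    rw [e, abs_mul, abs_of_pos ht] at h
    exact le_of_mul_le_mul_right h ht
  obtain ⟨hc1, hc2⟩ := abs_le.1 hc
  have hc0 : 0 < c := by linarith
  have e : bits (c * t) - bits t = (c - 1) * bits t + t * bits c := by
    unfold bits; rw [Real.logb_mul hc0.ne' ht.ne']; ring
  have hb : |bits c| ≤ 4 * δ := by
    have h1 := Real.log_le_sub_one_of_pos hc0
    have h2 := Real.one_sub_inv_le_log_of_pos hc0
    have h3 : c * (1 - c⁻¹) = c - 1 := by field_simp
    have h4 : c - 1 ≤ c * Real.log c := h3 ▸ mul_le_mul_of_nonneg_left h2 hc0.le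
    have h5 : c * Real.log c ≤ c * (c - 1) := mul_le_mul_of_nonneg_left h1 hc0.le
    have h6 : |c * Real.log c| ≤ 2 * δ := abs_le.2 ⟨by linarith, by nlinarith⟩
    have h7 : bits c = -(c * Real.log c) / Real.log 2 := by unfold bits Real.logb; ring
    rw [h7, abs_div, abs_neg, abs_of_pos (show 0 < Real.log 2 by linarith),
      div_le_iff₀ (by linarith)]
    nlinarith
  rw [e]
  have hbt := bits_nonneg ht.le ht1
  calc _ ≤ |(c - 1) * bits t| + |t * bits c| := abs_add_le _ _
    _ = |c - 1| * bits t + t * |bits c| := by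
        rw [abs_mul, abs_mul, abs_of_nonneg hbt, abs_of_pos ht]
    _ ≤ δ * bits t + t * (4 * δ) := by gcongr
    _ = _ := by ring

lemma pow_mul_exp_le {s : ℝ} (h1 : s ≤ 1) {n b : ℕ} (hb : b ≤ n) :
    (1 - s) ^ (n - b) * Real.exp (n * s) ≤ Real.exp (s * b) := by
  have h2 : (1 - s) ^ (n - b) ≤ Real.exp (-s) ^ (n - b) :=
    pow_le_pow_left₀ (by linarith) (by linarith [Real.add_one_le_exp (-s)]) _
  calc _ ≤ Real.exp (-s) ^ (n - b) * Real.exp (n * s) := by gcongr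
    _ = Real.exp (s * b) := by
        rw [← Real.exp_nat_mul, ← Real.exp_add, Nat.cast_sub hb]; congr 1; ring

lemma le_pow_mul_exp {s : ℝ} (h0 : 0 ≤ s) (h1 : s ≤ 1) {n b : ℕ} :
    1 - n * s ^ 2 ≤ (1 - s) ^ (n - b) * Real.exp (n * s) := by
  have h2 : (1 - s) ^ n ≤ (1 - s) ^ (n - b) :=
    pow_le_pow_of_le_one (by linarith) (by linarith) (Nat.sub_le _ _)
  have h3 : 1 - s ^ 2 ≤ (1 - s) * Real.exp s := by
    have := Real.add_one_le_exp s
    nlinarith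
  have h4 : 1 + n * (-s ^ 2) ≤ (1 + -s ^ 2) ^ n := one_add_mul_le_pow (by nlinarith) n
  calc 1 - n * s ^ 2 ≤ (1 - s ^ 2) ^ n := by
        rw [sub_eq_add_neg, sub_eq_add_neg, ← mul_neg]; exact h4
    _ ≤ ((1 - s) * Real.exp s) ^ n := pow_le_pow_left₀ (by nlinarith) h3 n
    _ = (1 - s) ^ n * Real.exp (n * s) := by rw [mul_pow, ← Real.exp_nat_mul]
    _ ≤ _ := by gcongr

lemma abs_mul_sub_self_le {p ρ L U δ : ℝ} (hp : 0 ≤ p) (hL : L ≤ ρ) (hU : ρ ≤ U) (hL1 : 1 - δ ≤ L)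
    (hU1 : U ≤ 1 + δ) : |p * ρ - p| ≤ δ * p := by
  have e : p * ρ - p = p * (ρ - 1) := by ring
  rw [e, abs_mul, abs_of_nonneg hp, mul_comm]
  exact mul_le_mul_of_nonneg_right (abs_le.2 ⟨by linarith, by linarith⟩) hp

lemma eventually_gapDensity_close {C : ℝ} (hC : 0 ≤ C) (a : ℕ) {δ : ℝ} (hδ : 0 < δ) :
    ∀ᶠ n : ℕ in atTop, ∀ r : ℝ, 0 ≤ r → n * r ≤ C → ∀ u ∈ Set.Icc (0 : ℝ) 1,
      |gapDensity n r a u - expDensity (n * r) u| ≤ δ * expDensity (n * r) u := by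
  have hd : Tendsto (fun n : ℕ => C / (n : ℝ)) atTop (𝓝 0) := tendsto_const_div_atTop_nhds_zero_nat C
  have ha : Tendsto (fun n : ℕ => (a : ℝ) / (n : ℝ)) atTop (𝓝 0) :=
    tendsto_const_div_atTop_nhds_zero_nat _
  -- The ratio of the two densities is a product of three factors. The functions in `hL` and `hU`
  -- bound it below and above, depend on `r` and `u` only through `C`, and tend to `1`.
  have hL : Tendsto (fun n : ℕ => (1 - (a : ℝ) / n) * (1 - 4 * C * (C / n)) *
      Real.exp (-(2 * C * (C / n)))) atTop (𝓝 ((1 - 0) * (1 - 4 * C * 0) * Real.exp (-(2 * C * 0)))) :=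
    ((tendsto_const_nhds.sub ha).mul (tendsto_const_nhds.sub (hd.const_mul _))).mul
      ((Real.continuous_exp.tendsto _).comp (hd.const_mul _).neg)
  have hU : Tendsto (fun n : ℕ => (1 - C / n)⁻¹ * Real.exp (2 * (C / n) * ((a + 1 : ℕ) : ℝ))) atTop
      (𝓝 ((1 - 0)⁻¹ * Real.exp (2 * 0 * ((a + 1 : ℕ) : ℝ)))) :=
    ((tendsto_const_nhds.sub hd).inv₀ (by norm_num)).mul
      ((Real.continuous_exp.tendsto _).comp ((hd.const_mul _).mul_const _))
  have hd4 : Tendsto (fun n : ℕ => 4 * C * (C / n)) atTop (𝓝 (4 * C * 0)) := hd.const_mul _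
  simp only [sub_zero, mul_zero, neg_zero, Real.exp_zero, mul_one, inv_one, zero_mul] at hL hU hd4
  filter_upwards [hL.eventually_const_le (show 1 - δ < 1 by linarith),
    hU.eventually_le_const (show 1 < 1 + δ by linarith),
    hd.eventually_le_const (show (0 : ℝ) < 1 / 2 by norm_num),
    hd4.eventually_le_const (show (0 : ℝ) < 1 by norm_num), eventually_ge_atTop (a + 1)]
    with n hLn hUn hdn hd4n hn r hr hnr u hu
  have hn0 : (0 : ℝ) < n := by
    have : 0 < n := by omega
    exact_mod_cast this
  set d := C / (n : ℝ) with hd_def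
  have hd0 : 0 ≤ d := by positivity
  have hrd : r ≤ d := by rw [hd_def, le_div_iff₀ hn0]; linarith
  have hr1 : 0 < 1 - r := by linarith
  set l := r / (1 - r) with hl
  have hl0 : 0 ≤ l := by positivity
  have hrl : l - r = r * l := by rw [hl]; field_simp; ring
  have hld : l ≤ 2 * d := by rw [hl, div_le_iff₀ hr1]; nlinarith
  have hlr : r ≤ l := by nlinarith
  have hnd : n * d = C := by rw [hd_def]; field_simp
  set s := l * u with hs
  have hs0 : 0 ≤ s := mul_nonneg hl0 hu.1
  have hsd : s ≤ 2 * d := (mul_le_of_le_one_right hl0 hu.2).trans hld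
  have hs1 : s ≤ 1 := by linarith
  have hna : ((n - a : ℕ) : ℝ) = n - a := Nat.cast_sub (by omega)
  have hgap : gapDensity n r a u = expDensity (n * r) u *
      (((n - a) / (n * (1 - r))) * ((1 - s) ^ (n - (a + 1)) * Real.exp (n * s)) *
        Real.exp (n * r * u - n * s)) := by
    unfold gapDensity expDensity
    rw [max_eq_left (by linarith), hna, show n - 1 - a = n - (a + 1) by omega, Real.exp_sub,
      Real.exp_neg]
    have h1 := (Real.exp_pos (n * r * u)).ne'
    have h2 := (Real.exp_pos (n * s)).ne'
    change (n - a) * (r / (1 - r)) * (1 - s) ^ (n - (a + 1)) = _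
    field_simp
  rw [hgap]
  have b1 : 1 - (a : ℝ) / n ≤ (n - a) / (n * (1 - r)) := by
    have e : 1 - (a : ℝ) / n = (n - a) / n := by field_simp
    rw [e]
    have : (a : ℝ) ≤ n := by exact_mod_cast (show a ≤ n by omega)
    apply div_le_div_of_nonneg_left (by linarith) (by positivity)
    nlinarith
  have b1' : 0 ≤ 1 - (a : ℝ) / n := by
    have : (a : ℝ) ≤ n := by exact_mod_cast (show a ≤ n by omega)
    rw [sub_nonneg, div_le_one hn0]; exact this
  have b2 : (n - a) / (n * (1 - r)) ≤ (1 - d)⁻¹ := by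
    rw [inv_eq_one_div, div_le_div_iff₀ (by positivity) (by linarith)]
    have : (0 : ℝ) ≤ a := Nat.cast_nonneg a
    nlinarith
  have b3 : 1 - 4 * C * d ≤ (1 - s) ^ (n - (a + 1)) * Real.exp (n * s) := by
    refine le_trans ?_ (le_pow_mul_exp hs0 hs1)
    have : s ^ 2 ≤ (2 * d) ^ 2 := pow_le_pow_left₀ hs0 hsd 2
    have : n * s ^ 2 ≤ n * (2 * d) ^ 2 := by gcongr
    have e : n * (2 * d) ^ 2 = 4 * C * d := by rw [← hnd]; ring
    linarith
  have b4 : (1 - s) ^ (n - (a + 1)) * Real.exp (n * s) ≤ Real.exp (2 * d * ((a + 1 : ℕ) : ℝ)) := by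
    refine (pow_mul_exp_le hs1 hn).trans (Real.exp_le_exp.2 ?_)
    gcongr
  have hexp : n * r * u - n * s = -(n * r * l * u) := by
    rw [hs]; linear_combination -(n * u) * hrl
  have b5 : Real.exp (-(2 * C * d)) ≤ Real.exp (n * r * u - n * s) := by
    rw [hexp]
    refine Real.exp_le_exp.2 (neg_le_neg ?_)
    calc n * r * l * u ≤ C * (2 * d) * 1 :=
          mul_le_mul (mul_le_mul hnr hld hl0 hC) hu.2 hu.1 (by positivity)
      _ = _ := by ring
  have b6 : Real.exp (n * r * u - n * s) ≤ 1 := by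
    rw [hexp]
    refine Real.exp_le_one_iff.2 (neg_nonpos.2 ?_)
    have := hu.1
    positivity
  have h0 : 0 ≤ (n - a) / (n * (1 - r)) := b1'.trans b1
  have h1 : 0 ≤ (1 - s) ^ (n - (a + 1)) * Real.exp (n * s) :=
    mul_nonneg (pow_nonneg (by linarith) _) (Real.exp_pos _).le
  refine abs_mul_sub_self_le (expDensity_nonneg (by positivity) u) ?_ ?_ hLn hUn
  · have h4 : (0 : ℝ) ≤ 1 - 4 * C * d := by linarith
    gcongr
  · have hd1 : 0 ≤ (1 - d)⁻¹ := h0.trans b2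
    calc _ ≤ (1 - d)⁻¹ * Real.exp (2 * d * ((a + 1 : ℕ) : ℝ)) * 1 := by gcongr
      _ = _ := mul_one _

lemma eventually_binomWeight_close {C : ℝ} (hC : 0 ≤ C) (a : ℕ) {δ : ℝ} (hδ : 0 < δ) :
    ∀ᶠ n : ℕ in atTop, ∀ r : ℝ, 0 ≤ r → n * r ≤ C →
      |binomWeight n r a - poissonWeight (n * r) a| ≤ δ * poissonWeight (n * r) a := by
  have hd : Tendsto (fun n : ℕ => C / (n : ℝ)) atTop (𝓝 0) := tendsto_const_div_atTop_nhds_zero_nat C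
  have hκ : Tendsto (fun n : ℕ => (n.choose a : ℝ) / ((n : ℝ) ^ a / a.factorial)) atTop (𝓝 1) := by
    refine (isEquivalent_iff_tendsto_one ?_).1 (isEquivalent_choose a)
    filter_upwards [eventually_gt_atTop 0] with n hn
    positivity
  have hL : Tendsto (fun n : ℕ => (n.choose a : ℝ) / ((n : ℝ) ^ a / a.factorial) *
      (1 - C * (C / n))) atTop (𝓝 (1 * (1 - C * 0))) :=
    hκ.mul (tendsto_const_nhds.sub (hd.const_mul _))
  have hU : Tendsto (fun n : ℕ => (n.choose a : ℝ) / ((n : ℝ) ^ a / a.factorial) *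
      Real.exp (C / n * a)) atTop (𝓝 (1 * Real.exp (0 * a))) :=
    hκ.mul ((Real.continuous_exp.tendsto _).comp (hd.mul_const _))
  simp only [sub_zero, mul_zero, Real.exp_zero, mul_one, zero_mul] at hL hU
  filter_upwards [hL.eventually_const_le (show 1 - δ < 1 by linarith),
    hU.eventually_le_const (show 1 < 1 + δ by linarith),
    hd.eventually_le_const (show (0 : ℝ) < 1 / 2 by norm_num), eventually_ge_atTop (a + 1)]
    with n hLn hUn hdn hn r hr hnr
  have hn0 : (0 : ℝ) < n := by
    have : 0 < n := by omega
    exact_mod_cast this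
  set d := C / (n : ℝ) with hd_def
  have hrd : r ≤ d := by rw [hd_def, le_div_iff₀ hn0]; linarith
  have hnd : n * d = C := by rw [hd_def]; field_simp
  have hw : binomWeight n r a = poissonWeight (n * r) a *
      ((n.choose a : ℝ) / ((n : ℝ) ^ a / a.factorial) *
        ((1 - r) ^ (n - a) * Real.exp (n * r))) := by
    unfold binomWeight poissonWeight
    rw [Real.exp_neg, mul_pow]
    have h1 := (Real.exp_pos (n * r)).ne'
    field_simp
  rw [hw]
  refine abs_mul_sub_self_le (poissonWeight_nonneg (by positivity) a) ?_ ?_ hLn hUn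
  · refine mul_le_mul_of_nonneg_left ?_ (by positivity)
    refine le_trans ?_ (le_pow_mul_exp hr (by linarith))
    have : n * r ^ 2 ≤ C * d := by
      rw [sq, ← mul_assoc]; exact mul_le_mul hnr hrd hr hC
    linarith
  · refine mul_le_mul_of_nonneg_left ?_ (by positivity)
    refine (pow_mul_exp_le (by linarith) (by omega)).trans (Real.exp_le_exp.2 ?_)
    gcongr

lemma binomMix_close {f g : ℝ → ℝ} (hf : Continuous f) (hg : Continuous g) {δ : ℝ}
    (h : ∀ u ∈ Set.Icc (0 : ℝ) 1, |g u - f u| ≤ δ * f u) (a k : ℕ) :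
    |binomMix g a k - binomMix f a k| ≤ δ * binomMix f a k := by
  have hpos : ∀ u ∈ Set.Icc (0 : ℝ) 1, 0 ≤ u ^ k * (1 - u) ^ (a - k) := fun u hu =>
    mul_nonneg (pow_nonneg hu.1 _) (pow_nonneg (by linarith [hu.2]) _)
  have h1 : ∫ u in (0 : ℝ)..1, u ^ k * (1 - u) ^ (a - k) * g u ≤
      ∫ u in (0 : ℝ)..1, (1 + δ) * (u ^ k * (1 - u) ^ (a - k) * f u) := by
    refine intervalIntegral.integral_mono_on zero_le_one
      (Continuous.intervalIntegrable (by fun_prop) _ _)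
      (Continuous.intervalIntegrable (by fun_prop) _ _) fun u hu => ?_
    have := mul_le_mul_of_nonneg_left (abs_le.1 (h u hu)).2 (hpos u hu)
    linarith
  have h2 : ∫ u in (0 : ℝ)..1, (1 - δ) * (u ^ k * (1 - u) ^ (a - k) * f u) ≤
      ∫ u in (0 : ℝ)..1, u ^ k * (1 - u) ^ (a - k) * g u := by
    refine intervalIntegral.integral_mono_on zero_le_one
      (Continuous.intervalIntegrable (by fun_prop) _ _)
      (Continuous.intervalIntegrable (by fun_prop) _ _) fun u hu => ?_
    have := mul_le_mul_of_nonneg_left (abs_le.1 (h u hu)).1 (hpos u hu)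
    linarith
  rw [intervalIntegral.integral_const_mul] at h1 h2
  unfold binomMix
  have hc : (0 : ℝ) ≤ a.choose k := Nat.cast_nonneg _
  have h3 := mul_le_mul_of_nonneg_left h1 hc
  have h4 := mul_le_mul_of_nonneg_left h2 hc
  exact abs_le.2 ⟨by linarith, by linarith⟩

lemma binomMix_zero_zero (f : ℝ → ℝ) : binomMix f 0 0 = ∫ u in (0 : ℝ)..1, f u := by
  simp [binomMix]

/-- A relative error in the density passes to each mixture probability and then through
`bits_sub_le`. The additive errors sum to order `δ x`, since the mixture probabilities have total
mass `1 - exp (-x) ≤ x`. -/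
lemma abs_stepEntropy_sub_le {x C δ : ℝ} (hx : 0 ≤ x) (hxC : x ≤ C) (hδ0 : 0 ≤ δ)
    (hδ : δ ≤ 1 / 2) (hδC : δ * (C * Real.exp C) ≤ 1 / 2) {g : ℝ → ℝ} (hg : Continuous g)
    (h : ∀ u ∈ Set.Icc (0 : ℝ) 1, |g u - expDensity x u| ≤ δ * expDensity x u) (a : ℕ) :
    |stepEntropy g a - stepEntropy (expDensity x) a| ≤
      δ * stepEntropy (expDensity x) a + (6 * Real.exp C + 4) * δ * x := by
  have hf := continuous_expDensity x
  have hf0 : ∀ u ∈ Set.Icc (0 : ℝ) 1, 0 ≤ expDensity x u := fun u _ => expDensity_nonneg hx u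
  have hf1 := integral_expDensity_le_one x
  have hx1 : 1 - Real.exp (-x) ≤ x := by linarith [Real.add_one_le_exp (-x)]
  have hq0 : |bits (1 - ∫ u in (0 : ℝ)..1, g u) - bits (1 - ∫ u in (0 : ℝ)..1, expDensity x u)| ≤
      6 * Real.exp C * δ * x := by
    have h1 := binomMix_close hf hg h 0 0
    rw [binomMix_zero_zero, binomMix_zero_zero, integral_expDensity] at h1
    rw [integral_expDensity, sub_sub_cancel]
    set t := Real.exp (-x) with ht
    have ht0 : 0 < t := Real.exp_pos _
    have ht1 : t ≤ 1 := Real.exp_le_one_iff.2 (by linarith)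
    have hxe : x * Real.exp x ≤ C * Real.exp C :=
      mul_le_mul hxC (Real.exp_le_exp.2 hxC) (Real.exp_pos _).le (hx.trans hxC)
    have hδ' : δ * (x * Real.exp x) ≤ 1 / 2 := (mul_le_mul_of_nonneg_left hxe hδ0).trans hδC
    -- The mass at `0` is a complement, so its error is at most `δ x` in absolute terms. Relative to
    -- `exp (-x)` this is `δ x exp x`, which explains the hypothesis `hδC`.
    have h2 : |(1 - ∫ u in (0 : ℝ)..1, g u) - t| ≤ δ * (x * Real.exp x) * t := by
      have e : δ * (x * Real.exp x) * t = δ * x := by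
        rw [ht, mul_assoc, mul_assoc, ← Real.exp_add]; simp
      rw [e, abs_sub_comm, show t - (1 - ∫ u in (0 : ℝ)..1, g u) =
        (∫ u in (0 : ℝ)..1, g u) - (1 - t) by ring]
      exact h1.trans (mul_le_mul_of_nonneg_left hx1 hδ0)
    have h3 := bits_sub_le ht0.le (by positivity) hδ' ht1 h2
    refine h3.trans ?_
    have h4 := bits_le_two ht0.le
    have h5 : 0 ≤ δ * (x * Real.exp x) := by positivity
    calc _ ≤ δ * (x * Real.exp x) * 2 + 4 * (δ * (x * Real.exp x)) * 1 := by gcongr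
      _ = 6 * Real.exp x * δ * x := by ring
      _ ≤ _ := by gcongr
  have hk : ∀ k ∈ Finset.range (a + 1), |bits (binomMix g a k) - bits (binomMix (expDensity x) a k)| ≤
      δ * bits (binomMix (expDensity x) a k) + 4 * δ * binomMix (expDensity x) a k := fun k hk =>
    bits_sub_le (binomMix_nonneg hf0 a k) hδ0 hδ (binomMix_le_one hf hf0 hf1 hk)
      (binomMix_close hf hg h a k)
  have hsum := (Finset.abs_sum_le_sum_abs _ _).trans (Finset.sum_le_sum hk)
  rw [Finset.sum_sub_distrib, Finset.sum_add_distrib, ← Finset.mul_sum, ← Finset.mul_sum,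
    sum_binomMix hf, integral_expDensity] at hsum
  have hb0 : 0 ≤ bits (1 - ∫ u in (0 : ℝ)..1, expDensity x u) := by
    rw [integral_expDensity, sub_sub_cancel]
    exact bits_nonneg (Real.exp_pos _).le (Real.exp_le_one_iff.2 (by linarith))
  unfold stepEntropy
  calc _ = |(bits (1 - ∫ u in (0 : ℝ)..1, g u) - bits (1 - ∫ u in (0 : ℝ)..1, expDensity x u)) +
        (∑ k ∈ Finset.range (a + 1), bits (binomMix g a k) -
          ∑ k ∈ Finset.range (a + 1), bits (binomMix (expDensity x) a k))| := by congr 1; ring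
    _ ≤ _ := abs_add_le _ _
    _ ≤ 6 * Real.exp C * δ * x +
        (δ * ∑ k ∈ Finset.range (a + 1), bits (binomMix (expDensity x) a k) + 4 * δ * x) := by
        have := mul_le_mul_of_nonneg_left hx1 (show 0 ≤ 4 * δ by positivity)
        linarith
    _ ≤ _ := by
        have := mul_nonneg hδ0 hb0
        linarith

lemma poissonWeight_le_one {x : ℝ} (hx : 0 ≤ x) (a : ℕ) : poissonWeight x a ≤ 1 :=
  le_hasSum (hasSum_poissonWeight x) a fun b _ => poissonWeight_nonneg hx b

lemma eventually_term_close {C : ℝ} (hC : 0 ≤ C) (a : ℕ) {ε : ℝ} (hε : 0 < ε) :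
    ∀ᶠ n : ℕ in atTop, ∀ r : ℝ, 0 ≤ r → n * r ≤ C →
      |binomWeight n r a * stepEntropy (gapDensity n r a) a -
        poissonWeight (n * r) a * stepEntropy (expDensity (n * r)) a| ≤
      ε * (poissonWeight (n * r) a * stepEntropy (expDensity (n * r)) a + n * r) := by
  set K := 6 * Real.exp C + 4 with hK
  have hK0 : 0 < K := by positivity
  -- The first two entries meet the hypotheses of `abs_stepEntropy_sub_le`; the third absorbs the
  -- constant `2 * K + 3` produced by the final estimate.
  set δ := min (1 / 2) (min (1 / (2 * (C * Real.exp C + 1))) (ε / (2 * K + 3))) with hδ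
  have hδ0 : 0 < δ := by positivity
  have hδ1 : δ ≤ 1 / 2 := min_le_left _ _
  have hδ2 : δ * (C * Real.exp C) ≤ 1 / 2 := by
    have : δ ≤ 1 / (2 * (C * Real.exp C + 1)) := (min_le_right _ _).trans (min_le_left _ _)
    rw [le_div_iff₀ (by positivity)] at this
    nlinarith
  have hδ3 : δ * (2 * K + 3) ≤ ε := by
    have : δ ≤ ε / (2 * K + 3) := (min_le_right _ _).trans (min_le_right _ _)
    rwa [le_div_iff₀ (by positivity)] at this
  filter_upwards [eventually_gapDensity_close hC a hδ0, eventually_binomWeight_close hC a hδ0]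
    with n h1 h2 r hr hnr
  have hx : 0 ≤ n * r := by positivity
  have h3 := abs_stepEntropy_sub_le hx hnr hδ0.le hδ1 hδ2 (continuous_gapDensity n r a) (h1 r hr hnr) a
  have h4 := h2 r hr hnr
  set x := n * r
  set w := binomWeight n r a
  set W := poissonWeight x a
  set h' := stepEntropy (gapDensity n r a) a
  set h := stepEntropy (expDensity x) a
  have hW0 : 0 ≤ W := poissonWeight_nonneg hx a
  have hW1 : W ≤ 1 := poissonWeight_le_one hx a
  have hh : 0 ≤ h := stepEntropy_expDensity_nonneg hx a
  have hh' : |h'| ≤ 2 * h + K * x := by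
    have e1 : |h'| ≤ |h' - h| + |h| := by
      have := abs_add_le (h' - h) h
      rwa [sub_add_cancel] at this
    rw [abs_of_nonneg hh] at e1
    have e2 : δ * h ≤ 1 * h := by gcongr; linarith
    have e3 : K * δ * x ≤ K * 1 * x := by gcongr; linarith
    linarith
  calc _ = |(w - W) * h' + W * (h' - h)| := by congr 1; ring
    _ ≤ |w - W| * |h'| + W * |h' - h| := by
        refine (abs_add_le _ _).trans ?_
        rw [abs_mul, abs_mul, abs_of_nonneg hW0]
    _ ≤ (δ * W) * (2 * h + K * x) + W * (δ * h + K * δ * x) := by gcongr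
    _ = δ * (3 * (W * h) + 2 * K * (W * x)) := by ring
    _ ≤ δ * (3 * (W * h) + 2 * K * (1 * x)) := by gcongr
    _ ≤ δ * ((2 * K + 3) * (W * h + x)) := by
        refine mul_le_mul_of_nonneg_left ?_ hδ0.le
        have : 0 ≤ K * (W * h) := by positivity
        nlinarith
    _ ≤ ε * (W * h + x) := by
        rw [← mul_assoc]; gcongr

lemma binomWeight_le {n : ℕ} {r : ℝ} (h0 : 0 ≤ r) (h1 : r ≤ 1) (a : ℕ) :
    binomWeight n r a ≤ (n * r) ^ a / a.factorial := by
  unfold binomWeight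
  have h2 : (1 - r) ^ (n - a) ≤ 1 := pow_le_one₀ (by linarith) (by linarith)
  calc _ ≤ (n.choose a : ℝ) * r ^ a * 1 := by gcongr
    _ ≤ (n : ℝ) ^ a / a.factorial * r ^ a * 1 := by
        gcongr
        exact Nat.choose_le_pow_div a n
    _ = _ := by rw [mul_pow]; ring

lemma stepEntropy_gapDensity_nonneg {n : ℕ} {r : ℝ} (h0 : 0 ≤ r) (h1 : r < 1) {a : ℕ}
    (ha : a + 2 < n) : 0 ≤ stepEntropy (gapDensity n r a) a :=
  stepEntropy_nonneg (continuous_gapDensity n r a) (fun u _ => gapDensity_nonneg h0 h1 a u)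
    (integral_gapDensity_le_one h0 h1 ha) a

lemma binomWeight_mul_stepEntropy_le {n : ℕ} {r C : ℝ} (h0 : 0 ≤ r) (h1 : r < 1) (hC : n * r ≤ C)
    {a : ℕ} (ha : 1 ≤ a) (han : a + 2 < n) :
    binomWeight n r a * stepEntropy (gapDensity n r a) a ≤
      n * r * (C ^ (a - 1) * (2 * ((a : ℝ) + 2)) / a.factorial) := by
  refine le_trans ?_ (pow_div_factorial_mul_le (by positivity) hC ha)
  exact mul_le_mul (binomWeight_le h0 h1.le a) (stepEntropy_le (fun u _ => gapDensity_nonneg h0 h1 a u)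
    (integral_gapDensity_le_one h0 h1 han) a) (stepEntropy_gapDensity_nonneg h0 h1 han) (by positivity)

/-- Only a constant multiple of `hU` is needed, because this entropy is later divided by `n`. -/
lemma entropy_leftNeighbors_two_le_hU {n : ℕ} {r C : ℝ} (h0 : 0 ≤ r) (h1 : r ≤ 1) (hn : 2 ≤ n)
    (hC : n * r ≤ C) :
    entropy (cubeMeasure n) (fun x => leftNeighbors (orderedGraph x r) 2) ≤
      (2 * Real.exp C + Real.exp C * Real.exp C) * hU (n * r) := by
  rw [entropy_leftNeighbors_two h0 h1 hn]
  set x := n * r with hx_def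
  have hx : 0 ≤ x := by positivity
  set p := (1 - r) ^ n with hp
  have hp0 : 0 ≤ p := pow_nonneg (by linarith) _
  have hpx : 1 - x ≤ p := by
    have := one_add_mul_le_pow (show -2 ≤ -r by linarith) n
    rw [hp, hx_def]; rw [← sub_eq_add_neg] at this; linarith
  have hpe : p ≤ Real.exp (-x) := by
    have h2 : (1 - r) ^ n ≤ Real.exp (-r) ^ n :=
      pow_le_pow_left₀ (by linarith) (by linarith [Real.add_one_le_exp (-r)]) _
    rw [← Real.exp_nat_mul] at h2
    rw [hp, hx_def]; refine h2.trans (le_of_eq ?_); congr 1; ring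
  have hU0 := mul_exp_neg_le_hU hx
  have hU1 := exp_neg_mul_bits_le_hU hx
  have hxC : Real.exp x ≤ Real.exp C := Real.exp_le_exp.2 hC
  have hxx : Real.exp x * Real.exp (-x) = 1 := by rw [← Real.exp_add]; simp
  have hhU := hU_nonneg hx
  have hxU : x ≤ Real.exp C * hU x := by
    calc x = Real.exp x * (x * Real.exp (-x)) := by linear_combination -x * hxx
      _ ≤ Real.exp C * hU x := by gcongr
  have b1 : bits p ≤ 2 * x := by
    refine (bits_le hp0).trans ?_
    have := log_two_gt_half
    rw [div_le_iff₀ (by linarith)]; nlinarith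
  -- Here `1 - p` lies between `1 - exp (-x)` and `exp C` times it: the lower bound controls the
  -- logarithm, the upper bound the prefactor.
  have b2 : bits (1 - p) ≤ Real.exp C * bits (1 - Real.exp (-x)) := by
    have hc0 : 0 ≤ 1 - Real.exp (-x) := by linarith [Real.exp_le_one_iff.2 (show -x ≤ 0 by linarith)]
    have hc1 : 1 - p ≤ Real.exp C * (1 - Real.exp (-x)) := by
      have h3 : x ≤ Real.exp x * (1 - Real.exp (-x)) := by
        have := Real.add_one_le_exp x
        linarith
      have := mul_le_mul_of_nonneg_right hxC hc0
      linarith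
    rcases hc0.eq_or_lt with h | h
    · have : 1 - p = 0 := le_antisymm (by rw [← h, mul_zero] at hc1; exact hc1) (by linarith)
      rw [this, ← h, bits_zero, mul_zero]
    · have hlog : Real.logb 2 (1 - Real.exp (-x)) ≤ Real.logb 2 (1 - p) :=
        Real.logb_le_logb_of_le (by norm_num) h (by linarith)
      have hlog0 : Real.logb 2 (1 - Real.exp (-x)) ≤ 0 :=
        Real.logb_nonpos (by norm_num) h.le (by linarith [Real.exp_pos (-x)])
      unfold bits
      calc _ ≤ -((1 - p) * Real.logb 2 (1 - Real.exp (-x))) :=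
            neg_le_neg (mul_le_mul_of_nonneg_left hlog (by linarith))
        _ = (1 - p) * -Real.logb 2 (1 - Real.exp (-x)) := by ring
        _ ≤ Real.exp C * (1 - Real.exp (-x)) * -Real.logb 2 (1 - Real.exp (-x)) :=
            mul_le_mul_of_nonneg_right hc1 (by linarith)
        _ = _ := by ring
  have b3 : bits (1 - Real.exp (-x)) ≤ Real.exp C * hU x := by
    calc bits (1 - Real.exp (-x)) = Real.exp x * (Real.exp (-x) * bits (1 - Real.exp (-x))) := by
          linear_combination -bits (1 - Real.exp (-x)) * hxx
      _ ≤ Real.exp C * hU x := mul_le_mul hxC hU1 (mul_nonneg (Real.exp_pos _).le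
          (bits_nonneg (by linarith [Real.exp_le_one_iff.2 (show -x ≤ 0 by linarith)])
            (by linarith [Real.exp_pos (-x)]))) (Real.exp_pos _).le
  have := mul_le_mul_of_nonneg_left b3 (Real.exp_pos C).le
  linarith

/-- Truncation at `i` requires at least `i - 1` points in one window, whose probability decays
factorially. The sum over `i` is therefore of order `x`, without a factor `n`. -/
lemma sum_condTerm_top_le {n : ℕ} {r C : ℝ} (h0 : 0 ≤ r) (h1 : r ≤ 1) (hC : n * r ≤ C)
    (hC0 : 0 ≤ C) :
    ∑ i ∈ Finset.Icc 2 (n - 1), condTerm n r i (i - 1) ≤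
      n * r * ∑' a : ℕ, C ^ (a - 1) * (2 * ((a : ℝ) + 2)) / a.factorial := by
  calc _ ≤ ∑ i ∈ Finset.Icc 2 (n - 1), n * r * (C ^ (i - 1 - 1) * (2 * (((i - 1 : ℕ) : ℝ) + 2)) /
        (i - 1).factorial) := by
        refine Finset.sum_le_sum fun i hi => ?_
        obtain ⟨hi1, hi2⟩ := Finset.mem_Icc.1 hi
        refine (condTerm_top_le h0 h1 (by omega) (by omega)).trans ?_
        refine le_trans (le_of_eq ?_) (pow_div_factorial_mul_le (by positivity) hC (by omega))
        rw [Nat.cast_sub (by omega)]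
        push_cast; ring
    _ = n * r * ∑ a ∈ Finset.Ico 1 (n - 1), C ^ (a - 1) * (2 * ((a : ℝ) + 2)) / a.factorial := by
        rw [← Finset.mul_sum]
        congr 1
        refine Finset.sum_bij (fun i _ => i - 1) ?_ ?_ ?_ ?_
        · intro i hi
          obtain ⟨hi1, hi2⟩ := Finset.mem_Icc.1 hi
          exact Finset.mem_Ico.2 ⟨by omega, by omega⟩
        · intro i hi j hj h
          have := Finset.mem_Icc.1 hi
          have := Finset.mem_Icc.1 hj
          omega
        · intro a ha
          have := Finset.mem_Ico.1 ha
          exact ⟨a + 1, Finset.mem_Icc.2 ⟨by omega, by omega⟩, by omega⟩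
        · intro i _; rfl
    _ ≤ _ := by
        refine mul_le_mul_of_nonneg_left ?_ (by positivity)
        exact (summable_tail_const C).sum_le_tsum _ fun a _ => by positivity

/-- In the sparse regime the normalized chain bound is uniformly close to `hU`, in relative
terms. -/
lemma eventually_chainBound_close {C : ℝ} (hC : 0 ≤ C) {ε : ℝ} (hε : 0 < ε) :
    ∀ᶠ n : ℕ in atTop, ∀ r : ℝ, 0 ≤ r → n * r ≤ C →
      |1 / (n : ℝ) * chainBound (cubeMeasure n) (fun x => orderedGraph x r) - hU (n * r)| ≤
        ε * hU (n * r) := by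
  set K := Real.exp C with hK
  have hK0 : 0 < K := Real.exp_pos C
  set c : ℕ → ℝ := fun a => C ^ (a - 1) * (2 * ((a : ℝ) + 2)) / a.factorial with hc
  have hc0 : ∀ a, 0 ≤ c a := fun a => by simp only [hc]; positivity
  have hcs : Summable c := summable_tail_const C
  set S := ∑' a, c a with hS
  have hS0 : 0 ≤ S := tsum_nonneg hc0
  -- Since `x ≤ K * hU x`, each of the two tails beyond `M` costs at most `ε / 8` relative to `hU
  -- x`. The `M` leading terms and the `H(L 2)` and truncation part cost at most `ε / 4` each.
  set η := ε / (8 * K) with hη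
  have hη0 : 0 < η := by positivity
  obtain ⟨M, hM1, hMη⟩ : ∃ M, 1 ≤ M ∧ ∑' a, c (a + M) ≤ η := by
    have h := (tendsto_sum_nat_add c).eventually_le_const hη0
    obtain ⟨M, h1, h2⟩ := ((eventually_ge_atTop 1).and h).exists
    exact ⟨M, h1, h2⟩
  set ε1 := min 1 (ε / (8 * (1 + M * K))) with hε1
  have hε10 : 0 < ε1 := by positivity
  have hε11 : ε1 ≤ 1 := min_le_left _ _
  have hε12 : ε1 * (8 * (1 + M * K)) ≤ ε := by
    have : ε1 ≤ ε / (8 * (1 + M * K)) := min_le_right _ _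
    rwa [le_div_iff₀ (by positivity)] at this
  have hlim1 : Tendsto (fun n : ℕ => ((M : ℝ) + 2) / n) atTop (𝓝 0) :=
    tendsto_const_div_atTop_nhds_zero_nat _
  have hlim2 : Tendsto (fun n : ℕ => (2 * K + K * K + S * K) / n) atTop (𝓝 0) :=
    tendsto_const_div_atTop_nhds_zero_nat _
  have hlim3 : Tendsto (fun n : ℕ => C / n) atTop (𝓝 0) := tendsto_const_div_atTop_nhds_zero_nat _
  have hterms : ∀ᶠ n : ℕ in atTop, ∀ a ∈ Finset.range M, ∀ r : ℝ, 0 ≤ r → n * r ≤ C →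
      |binomWeight n r a * stepEntropy (gapDensity n r a) a -
        poissonWeight (n * r) a * stepEntropy (expDensity (n * r)) a| ≤
      ε1 * (poissonWeight (n * r) a * stepEntropy (expDensity (n * r)) a + n * r) :=
    (Finset.eventually_all _).2 fun a _ => eventually_term_close hC a hε10
  filter_upwards [hterms, hlim1.eventually_le_const (show 0 < ε1 / 2 by positivity),
    hlim2.eventually_le_const (show 0 < ε / 4 by positivity),
    hlim3.eventually_le_const (show (0 : ℝ) < 1 / 2 by norm_num), eventually_ge_atTop (M + 3)]
    with n hT hn1 hn2 hn3 hn r hr hnr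
  have hn0 : (0 : ℝ) < n := by
    have : 0 < n := by omega
    exact_mod_cast this
  have hr1 : r ≤ 1 / 2 := by
    refine le_trans ?_ hn3
    rw [le_div_iff₀ hn0]; linarith
  have hx : 0 ≤ n * r := by positivity
  set x := n * r with hx_def
  have hUx := hU_nonneg hx
  have hxU : x ≤ K * hU x := by
    have hxx : Real.exp x * Real.exp (-x) = 1 := by rw [← Real.exp_add]; simp
    calc x = Real.exp x * (x * Real.exp (-x)) := by linear_combination -x * hxx
      _ ≤ K * hU x := by
        have := mul_exp_neg_le_hU hx
        have := Real.exp_le_exp.2 hnr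
        gcongr
  set T : ℕ → ℝ := fun a => poissonWeight x a * stepEntropy (expDensity x) a with hTdef
  set Tn : ℕ → ℝ := fun a => binomWeight n r a * stepEntropy (gapDensity n r a) a with hTndef
  have hT0 : ∀ a, 0 ≤ T a := fun a =>
    mul_nonneg (poissonWeight_nonneg hx a) (stepEntropy_expDensity_nonneg hx a)
  have hTn0 : ∀ a, a + 2 < n → 0 ≤ Tn a := fun a ha =>
    mul_nonneg (binomWeight_nonneg hr (by linarith) a)
      (stepEntropy_gapDensity_nonneg hr (by linarith) ha)
  have hTs : Summable T := summable_poissonWeight_mul_stepEntropy hx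
  have hUsplit : hU x = ∑ a ∈ Finset.range M, T a + ∑' a, T (a + M) := by
    rw [hU_eq_tsum hx]; exact (hTs.sum_add_tsum_nat_add M).symm
  have htail : ∑' a, T (a + M) ≤ x * η := by
    calc _ ≤ ∑' a, x * c (a + M) := by
          refine ((summable_nat_add_iff M).2 hTs).tsum_le_tsum (fun a => ?_)
            (((summable_nat_add_iff M).2 hcs).mul_left x)
          exact poissonWeight_mul_stepEntropy_le hx hnr (by omega)
      _ = x * ∑' a, c (a + M) := tsum_mul_left
      _ ≤ x * η := by gcongr
  have htail0 : 0 ≤ ∑' a, T (a + M) := tsum_nonneg fun a => hT0 _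
  -- The normalized multiplicity of `a` differs from `1` by a vanishing amount for the finitely many
  -- `a < M`.
  have hcoef : ∀ a, a + 2 ≤ n → 1 / (n : ℝ) * (n - 2 - a : ℕ) = 1 - (a + 2) / n := by
    intro a ha
    rw [Nat.cast_sub (by omega), Nat.cast_sub (by omega)]
    field_simp
    push_cast; ring
  have hmain : ∑ a ∈ Finset.range M, |1 / (n : ℝ) * ((n - 2 - a : ℕ) * Tn a) - T a| ≤
      2 * ε1 * (hU x + M * x) := by
    calc _ ≤ ∑ a ∈ Finset.range M, 2 * ε1 * (T a + x) := by
          refine Finset.sum_le_sum fun a ha => ?_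
          have ha' := Finset.mem_range.1 ha
          have h1 := hT a ha r hr hnr
          have h2 : 0 ≤ Tn a := hTn0 a (by omega)
          have h3 : 1 / (n : ℝ) * ((n - 2 - a : ℕ) * Tn a) - T a =
              (Tn a - T a) - (a + 2) / n * Tn a := by
            rw [← mul_assoc, hcoef a (by omega)]; ring
          have h4 : ((a : ℝ) + 2) / n ≤ ε1 / 2 := by
            refine le_trans ?_ hn1
            have : (a : ℝ) ≤ M := by exact_mod_cast ha'.le
            gcongr
          have h5 : Tn a ≤ 2 * (T a + x) := by
            have h6 := (abs_le.1 h1).2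
            have h7 : ε1 * (T a + x) ≤ 1 * (T a + x) :=
              mul_le_mul_of_nonneg_right hε11 (add_nonneg (hT0 a) hx)
            simp only [hTndef, hTdef] at h6 h7 ⊢
            linarith
          rw [h3]
          calc _ ≤ |Tn a - T a| + |(a + 2) / n * Tn a| := abs_sub _ _
            _ ≤ ε1 * (T a + x) + ε1 / 2 * (2 * (T a + x)) := by
                refine add_le_add h1 ?_
                rw [abs_of_nonneg (by positivity)]
                exact mul_le_mul h4 h5 h2 (by positivity)
            _ = _ := by ring
      _ = 2 * ε1 * (∑ a ∈ Finset.range M, T a + M * x) := by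
          rw [← Finset.mul_sum, Finset.sum_add_distrib, Finset.sum_const, Finset.card_range,
            nsmul_eq_mul]
      _ ≤ _ := by
          have : ∑ a ∈ Finset.range M, T a ≤ hU x := by linarith
          gcongr
  have hmid0 : 0 ≤ ∑ a ∈ Finset.Ico M (n - 2), 1 / (n : ℝ) * ((n - 2 - a : ℕ) * Tn a) := by
    refine Finset.sum_nonneg fun a ha => ?_
    have := Finset.mem_Ico.1 ha
    have := hTn0 a (by omega)
    positivity
  have hmid : ∑ a ∈ Finset.Ico M (n - 2), 1 / (n : ℝ) * ((n - 2 - a : ℕ) * Tn a) ≤ x * η := by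
    calc _ ≤ ∑ a ∈ Finset.Ico M (n - 2), x * c a := by
          refine Finset.sum_le_sum fun a ha => ?_
          have ha' := Finset.mem_Ico.1 ha
          rw [← mul_assoc, hcoef a (by omega)]
          have h1 : Tn a ≤ x * c a :=
            binomWeight_mul_stepEntropy_le hr (by linarith) hnr (by omega) (by omega)
          have h2 := hTn0 a (by omega)
          have h3 : 0 ≤ ((a : ℝ) + 2) / n := by positivity
          nlinarith
      _ = x * ∑ k ∈ Finset.range (n - 2 - M), c (k + M) := by
          rw [← Finset.mul_sum, Finset.sum_Ico_eq_sum_range]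
          simp only [add_comm]
      _ ≤ x * ∑' a, c (a + M) := by
          refine mul_le_mul_of_nonneg_left ?_ hx
          exact ((summable_nat_add_iff M).2 hcs).sum_le_tsum _ fun a _ => hc0 _
      _ ≤ x * η := by gcongr
  have hH0 := entropy_leftNeighbors_two_nonneg (n := n) hr (by linarith) (by omega)
  have hH := entropy_leftNeighbors_two_le_hU (n := n) hr (by linarith) (by omega) hnr
  have hR := sum_condTerm_top_le (n := n) hr (by linarith) hnr hC
  have hR0 : 0 ≤ ∑ i ∈ Finset.Icc 2 (n - 1), condTerm n r i (i - 1) :=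
    Finset.sum_nonneg fun i _ => condTerm_nonneg i _
  rw [chainBound_eq hr (by linarith)]
  set H2 := entropy (cubeMeasure n) (fun x => leftNeighbors (orderedGraph x r) 2)
  set R := ∑ i ∈ Finset.Icc 2 (n - 1), condTerm n r i (i - 1)
  have hHR : 1 / (n : ℝ) * (H2 + R) ≤ ε / 4 * hU x := by
    have h1 : H2 + R ≤ (2 * K + K * K + S * K) * hU x := by
      have : x * S ≤ K * hU x * S := by gcongr
      have h2 : R ≤ x * S := hR
      linarith
    calc _ ≤ 1 / (n : ℝ) * ((2 * K + K * K + S * K) * hU x) := by gcongr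
      _ = (2 * K + K * K + S * K) / n * hU x := by ring
      _ ≤ _ := by gcongr
  have hHR0 : 0 ≤ 1 / (n : ℝ) * (H2 + R) := by positivity
  have hsplit : 1 / (n : ℝ) * (H2 + ∑ a ∈ Finset.range (n - 2), (n - 2 - a : ℕ) * Tn a + R) =
      1 / (n : ℝ) * (H2 + R) + ∑ a ∈ Finset.range M, 1 / (n : ℝ) * ((n - 2 - a : ℕ) * Tn a) +
        ∑ a ∈ Finset.Ico M (n - 2), 1 / (n : ℝ) * ((n - 2 - a : ℕ) * Tn a) := by
    rw [add_assoc (1 / (n : ℝ) * (H2 + R)), Finset.sum_range_add_sum_Ico _ (show M ≤ n - 2 by omega),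
      ← Finset.mul_sum]
    ring
  have hmain' := (Finset.abs_sum_le_sum_abs _ _).trans hmain
  rw [Finset.sum_sub_distrib] at hmain'
  have hxη : x * η ≤ ε / 8 * hU x := by
    calc x * η ≤ K * hU x * η := by gcongr
      _ = ε / 8 * hU x := by rw [hη]; field_simp
  have hmainε : 2 * ε1 * (hU x + M * x) ≤ ε / 4 * hU x := by
    calc 2 * ε1 * (hU x + M * x) ≤ 2 * ε1 * (hU x + M * (K * hU x)) := by gcongr
      _ = ε1 * (8 * (1 + M * K)) / 4 * hU x := by ring
      _ ≤ ε / 4 * hU x := by gcongr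
  have hbase : |1 / (n : ℝ) * (H2 + ∑ a ∈ Finset.range (n - 2), (n - 2 - a : ℕ) * Tn a + R) - hU x| ≤
      ε * hU x := by
    obtain ⟨m1, m2⟩ := abs_le.1 hmain'
    have hεU : 0 ≤ ε * hU x := by positivity
    rw [hsplit]
    exact abs_le.2 ⟨by linarith, by linarith⟩
  exact hbase

end Sparse

/-! ### The dense regimes: geometric limit, lower and upper bounds -/

section Dense

open Topology

/-- Squeezes `(1 - s) ^ e` between `exp (-e s / (1 - s))` and `exp (-e s)`. -/
lemma tendsto_max_pow_exp {ι : Type*} {l : Filter ι} {s : ι → ℝ} {e : ι → ℕ} {t : ℝ}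
    (hs : Tendsto s l (𝓝 0))
    (h : Tendsto (fun i => (e i : ℝ) * s i) l (𝓝 t)) :
    Tendsto (fun i => max (1 - s i) 0 ^ e i) l (𝓝 (Real.exp (-t))) := by
  have hlow : Tendsto (fun i => Real.exp (-((e i : ℝ) * s i / (1 - s i)))) l
      (𝓝 (Real.exp (-(t / (1 - 0))))) :=
    (Real.continuous_exp.tendsto _).comp
      (h.div (tendsto_const_nhds.sub hs) (by norm_num)).neg
  have hup : Tendsto (fun i => Real.exp (-((e i : ℝ) * s i))) l (𝓝 (Real.exp (-t))) :=
    (Real.continuous_exp.tendsto _).comp h.neg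
  rw [sub_zero, div_one] at hlow
  have hlt := hs.eventually_lt_const (show (0 : ℝ) < 1 by norm_num)
  refine tendsto_of_tendsto_of_tendsto_of_le_of_le' hlow hup ?_ ?_
  · filter_upwards [hlt] with i hi
    have h1 : 0 < 1 - s i := by linarith
    rw [max_eq_left h1.le]
    have h2 : Real.exp (-(s i / (1 - s i))) ≤ 1 - s i := by
      rw [← Real.le_log_iff_exp_le h1]
      have := Real.one_sub_inv_le_log_of_pos h1
      refine le_trans (le_of_eq ?_) this
      field_simp; ring
    calc Real.exp (-((e i : ℝ) * s i / (1 - s i))) = Real.exp (-(s i / (1 - s i))) ^ e i := by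
          rw [← Real.exp_nat_mul]; congr 1; ring
      _ ≤ _ := pow_le_pow_left₀ (Real.exp_pos _).le h2 _
  · filter_upwards [hlt] with i hi
    rw [max_eq_left (by linarith)]
    calc (1 - s i) ^ e i ≤ Real.exp (-s i) ^ e i :=
          pow_le_pow_left₀ (by linarith) (by linarith [Real.add_one_le_exp (-s i)]) _
      _ = _ := by rw [← Real.exp_nat_mul]; congr 1; ring

/-- Substituting `v = a u` puts the integrals for all `n` and `a` on one domain, as dominated
convergence requires. The truncated factor vanishes beyond `v = a`; this uses `k < a`. -/
lemma binomMix_gapDensity_eq_integral_Ioi {n a k : ℕ} {r : ℝ} (hk : k < a) :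
    binomMix (gapDensity n r a) a k = ∫ v in Set.Ioi (0 : ℝ),
      (a.choose k : ℝ) / (a : ℝ) ^ k * ((n - a : ℕ) * (r / (1 - r)) / a) *
        (v ^ k * max (1 - v / a) 0 ^ (a - k) * max (1 - r / (1 - r) * (v / a)) 0 ^ (n - 1 - a)) := by
  have ha : (0 : ℝ) < a := by exact_mod_cast (show 0 < a by omega)
  set G : ℝ → ℝ := fun v => (a.choose k : ℝ) / (a : ℝ) ^ k * ((n - a : ℕ) * (r / (1 - r)) / a) *
    (v ^ k * max (1 - v / a) 0 ^ (a - k) * max (1 - r / (1 - r) * (v / a)) 0 ^ (n - 1 - a)) with hG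
  have h1 : ∫ v in Set.Ioi (0 : ℝ), G v = ∫ v in Set.Ioc (0 : ℝ) a, G v := by
    refine setIntegral_eq_of_subset_of_forall_sdiff_eq_zero measurableSet_Ioi
      Set.Ioc_subset_Ioi_self fun v hv => ?_
    have hva : (a : ℝ) < v := by
      by_contra h
      exact hv.2 ⟨hv.1, not_lt.1 h⟩
    have : max (1 - v / a) 0 = 0 := by
      refine max_eq_right ?_
      rw [sub_nonpos, le_div_iff₀ ha]; linarith
    simp only [hG, this]
    rw [zero_pow (by omega)]; ring
  have h2 := intervalIntegral.mul_integral_comp_mul_left (a := 0) (b := 1) (c := (a : ℝ)) (f := G)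
  rw [mul_zero, mul_one, intervalIntegral.integral_of_le ha.le] at h2
  change _ = ∫ v in Set.Ioi (0 : ℝ), G v
  rw [h1, ← h2]
  unfold binomMix gapDensity
  rw [← intervalIntegral.integral_const_mul, ← intervalIntegral.integral_const_mul]
  refine intervalIntegral.integral_congr fun u hu => ?_
  rw [Set.uIcc_of_le zero_le_one] at hu
  have e : (a : ℝ) * u / a = u := by field_simp
  simp only [hG, e]
  rw [max_eq_left (show (0 : ℝ) ≤ 1 - u by linarith [hu.2]), mul_pow]
  field_simp

/-- The filter of pairs `(n, a)` with `n → ∞` and `a / (n r n) → 1`. -/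
noncomputable def typicalFilter (r : ℕ → ℝ) : Filter (ℕ × ℕ) :=
  comap Prod.fst atTop ⊓ comap (fun p : ℕ × ℕ => (p.2 : ℝ) / (p.1 * r p.1)) (𝓝 1)

instance (r : ℕ → ℝ) : (typicalFilter r).IsCountablyGenerated := by
  unfold typicalFilter; infer_instance

section Typical

variable {r : ℕ → ℝ} {ρ : ℝ}

lemma tendsto_fst_typical : Tendsto Prod.fst (typicalFilter r) atTop :=
  tendsto_comap.mono_left inf_le_left

lemma tendsto_ratio_typical :
    Tendsto (fun p : ℕ × ℕ => (p.2 : ℝ) / (p.1 * r p.1)) (typicalFilter r) (𝓝 1) :=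
  tendsto_comap.mono_left inf_le_right

lemma tendsto_mul_typical (hX : Tendsto (fun n : ℕ => n * r n) atTop atTop) :
    Tendsto (fun p : ℕ × ℕ => (p.1 : ℝ) * r p.1) (typicalFilter r) atTop :=
  hX.comp tendsto_fst_typical

lemma tendsto_snd_typical (hX : Tendsto (fun n : ℕ => n * r n) atTop atTop) :
    Tendsto (fun p : ℕ × ℕ => (p.2 : ℝ)) (typicalFilter r) atTop := by
  refine (tendsto_ratio_typical.pos_mul_atTop one_pos (tendsto_mul_typical hX)).congr' ?_
  filter_upwards [(tendsto_mul_typical hX).eventually_gt_atTop 0] with p hp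
  exact div_mul_cancel₀ _ hp.ne'

lemma tendsto_div_typical (hr : Tendsto r atTop (𝓝 ρ))
    (hX : Tendsto (fun n : ℕ => n * r n) atTop atTop) :
    Tendsto (fun p : ℕ × ℕ => (p.2 : ℝ) / p.1) (typicalFilter r) (𝓝 ρ) := by
  have := tendsto_ratio_typical.mul (hr.comp (tendsto_fst_typical (r := r)))
  rw [one_mul] at this
  refine this.congr' ?_
  filter_upwards [(tendsto_mul_typical hX).eventually_gt_atTop 0] with p hp
  have h1 : r p.1 ≠ 0 := fun h => by simp [h] at hp
  simp only [Function.comp]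
  rw [div_mul_eq_mul_div, mul_div_mul_right _ _ h1]

lemma eventually_typical_lt (hρ : ρ < 1) (hr : Tendsto r atTop (𝓝 ρ))
    (hX : Tendsto (fun n : ℕ => n * r n) atTop atTop) {c : ℝ} (hc : c < 1 - ρ) :
    ∀ᶠ p in typicalFilter r, p.2 + 2 < p.1 ∧ c ≤ 1 / (p.1 : ℝ) * (p.1 - 2 - p.2 : ℕ) := by
  have h1 : Tendsto (fun p : ℕ × ℕ => 1 - ((p.2 : ℝ) / p.1 + 3 / p.1)) (typicalFilter r)
      (𝓝 (1 - (ρ + 0))) := by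
    refine tendsto_const_nhds.sub ((tendsto_div_typical hr hX).add ?_)
    exact (tendsto_const_div_atTop_nhds_zero_nat 3).comp tendsto_fst_typical
  rw [add_zero] at h1
  filter_upwards [h1.eventually_const_lt (show max c 0 < 1 - ρ by
      exact max_lt hc (by linarith)), tendsto_fst_typical.eventually_gt_atTop 0] with p hp hp0
  have hp0' : (0 : ℝ) < p.1 := by exact_mod_cast hp0
  obtain ⟨hp1, hp2⟩ := max_lt_iff.1 hp
  have e : 1 - ((p.2 : ℝ) / p.1 + 3 / p.1) = 1 / p.1 * (p.1 - 3 - p.2) := by field_simp; ring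
  rw [e] at hp1 hp2
  have h3 : (0 : ℝ) < p.1 - 3 - p.2 := pos_of_mul_pos_right hp2 (by positivity)
  have h4 : p.2 + 3 < p.1 := by
    have : ((p.2 + 3 : ℕ) : ℝ) < p.1 := by push_cast; linarith
    exact_mod_cast this
  refine ⟨by omega, hp1.le.trans ?_⟩
  rw [Nat.cast_sub (by omega), Nat.cast_sub (by omega)]
  gcongr
  norm_num

/-- With `a ≈ n r` and `n - a ≈ n (1 - r)`, the rate of the gap in the variable `v` tends to `1`:
points enter and leave the window at the same rate. -/
lemma tendsto_rate_typical (hρ : ρ < 1) (hr : Tendsto r atTop (𝓝 ρ))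
    (hX : Tendsto (fun n : ℕ => n * r n) atTop atTop) :
    Tendsto (fun p : ℕ × ℕ => (p.1 - p.2 : ℕ) * (r p.1 / (1 - r p.1)) / p.2) (typicalFilter r)
      (𝓝 1) := by
  have hr' := hr.comp (tendsto_fst_typical (r := r))
  have h := (((tendsto_const_nhds (x := (1 : ℝ))).sub (tendsto_div_typical hr hX)).div
    (tendsto_const_nhds.sub hr') (show 1 - ρ ≠ 0 by linarith)).mul
    (tendsto_ratio_typical.inv₀ one_ne_zero)
  rw [div_self (show 1 - ρ ≠ 0 by linarith), one_mul, inv_one] at h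
  refine h.congr' ?_
  filter_upwards [(tendsto_mul_typical hX).eventually_gt_atTop 0,
    eventually_typical_lt hρ hr hX (show (1 - ρ) / 2 < 1 - ρ by linarith),
    (tendsto_snd_typical hX).eventually_gt_atTop 0,
    hr'.eventually_lt_const hρ] with p hp hlt hp2 hr1
  have h1 : r p.1 ≠ 0 := fun h => by simp [h] at hp
  have h2 : (p.1 : ℝ) ≠ 0 := fun h => by simp [h] at hp
  simp only [Function.comp] at hr1
  have h3 : 1 - r p.1 ≠ 0 := by linarith
  simp only [Function.comp, Pi.div_apply]
  rw [Nat.cast_sub (by omega)]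
  field_simp

/-- In the limit the gap is a unit exponential and the number lost is Poisson with mean the gap, so
the probability of `k` is `∫ v ^ k / k! * exp (-2 v)`, which is `(1/2) ^ (k+1)`. -/
lemma tendsto_binomMix_typical (hr0 : ∀ n, 0 ≤ r n) (hρ : ρ < 1) (hr : Tendsto r atTop (𝓝 ρ))
    (hX : Tendsto (fun n : ℕ => n * r n) atTop atTop) (k : ℕ) :
    Tendsto (fun p : ℕ × ℕ => binomMix (gapDensity p.1 (r p.1) p.2) p.2 k) (typicalFilter r)
      (𝓝 ((1 / 2) ^ (k + 1))) := by
  have hr' := hr.comp (tendsto_fst_typical (r := r))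
  have hA := tendsto_snd_typical hX
  have hAn : Tendsto Prod.snd (typicalFilter r) atTop := tendsto_natCast_atTop_iff.1 hA
  have hrate := tendsto_rate_typical hρ hr hX
  have hinv : Tendsto (fun p : ℕ × ℕ => ((p.2 : ℝ))⁻¹) (typicalFilter r) (𝓝 0) :=
    tendsto_inv_atTop_zero.comp hA
  have hlam : Tendsto (fun p : ℕ × ℕ => r p.1 / (1 - r p.1) * (p.2 : ℝ)⁻¹) (typicalFilter r)
      (𝓝 0) := by
    have := (hr'.div (tendsto_const_nhds.sub hr') (show 1 - ρ ≠ 0 by linarith)).mul hinv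
    rwa [mul_zero] at this
  have hκ : Tendsto (fun p : ℕ × ℕ => (p.2.choose k : ℝ) / (p.2 : ℝ) ^ k) (typicalFilter r)
      (𝓝 (1 / k.factorial)) := by
    have h1 : Tendsto (fun n : ℕ => (n.choose k : ℝ) / ((n : ℝ) ^ k / k.factorial)) atTop (𝓝 1) := by
      refine (isEquivalent_iff_tendsto_one ?_).1 (isEquivalent_choose k)
      filter_upwards [eventually_gt_atTop 0] with n hn
      positivity
    have h2 := (h1.comp hAn).div_const (k.factorial : ℝ)
    refine h2.congr fun p => ?_
    simp only [Function.comp]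
    field_simp
  have hr1 := hr'.eventually_lt_const hρ
  have hlim := tendsto_integral_filter_of_dominated_convergence (l := typicalFilter r)
    (μ := volume.restrict (Set.Ioi (0 : ℝ)))
    (F := fun p v => (p.2.choose k : ℝ) / (p.2 : ℝ) ^ k *
      ((p.1 - p.2 : ℕ) * (r p.1 / (1 - r p.1)) / p.2) *
        (v ^ k * max (1 - v / p.2) 0 ^ (p.2 - k) *
          max (1 - r p.1 / (1 - r p.1) * (v / p.2)) 0 ^ (p.1 - 1 - p.2)))
    (f := fun v => 1 / k.factorial * 1 * (v ^ k * Real.exp (-v) * Real.exp (-v)))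
    (fun v => 2 * (v ^ k * Real.exp (-(1 / 2 * v)))) ?_ ?_ ?_ ?_
  · have hval : ∫ v in Set.Ioi (0 : ℝ), 1 / (k.factorial : ℝ) * 1 *
        (v ^ k * Real.exp (-v) * Real.exp (-v)) = (1 / 2) ^ (k + 1) := by
      have h := Real.integral_rpow_mul_exp_neg_mul_Ioi (a := (k : ℝ) + 1) (r := 2) (by positivity)
        (by norm_num)
      rw [integral_const_mul]
      have e : ∀ v : ℝ, v ^ k * Real.exp (-v) * Real.exp (-v) =
          v ^ ((k : ℝ) + 1 - 1) * Real.exp (-(2 * v)) := by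
        intro v
        rw [add_sub_cancel_right, Real.rpow_natCast, mul_assoc, ← Real.exp_add]
        congr 2; ring
      simp_rw [e]
      rw [h, Real.Gamma_nat_eq_factorial, show (k : ℝ) + 1 = ((k + 1 : ℕ) : ℝ) by push_cast; rfl,
        Real.rpow_natCast]
      field_simp
    rw [hval] at hlim
    refine hlim.congr' ?_
    filter_upwards [hAn.eventually_gt_atTop k] with p hp
    exact (binomMix_gapDensity_eq_integral_Ioi hp).symm
  · refine Eventually.of_forall fun p => Continuous.aestronglyMeasurable ?_
    fun_prop
  -- For such `a` the exponent `a - k` is at least `a / 2`, whence the decay `exp (-v / 2)`; the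
  -- factor `2` of the majorant bounds the rate.
  · filter_upwards [hAn.eventually_ge_atTop (2 * k + 1),
      hrate.eventually_le_const (show (1 : ℝ) < 2 by norm_num), hr1] with p hp hp2 hp1
    simp only [Function.comp] at hp1
    refine (ae_restrict_iff' measurableSet_Ioi).2 (ae_of_all _ fun v hv => ?_)
    have hv0 : (0 : ℝ) < v := hv
    have ha : (0 : ℝ) < p.2 := by exact_mod_cast (show 0 < p.2 by omega)
    have hl0 : 0 ≤ r p.1 / (1 - r p.1) := div_nonneg (hr0 _) (by linarith)
    have hrate0 : 0 ≤ (p.1 - p.2 : ℕ) * (r p.1 / (1 - r p.1)) / (p.2 : ℝ) := by positivity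
    have b1 : (p.2.choose k : ℝ) / (p.2 : ℝ) ^ k ≤ 1 := by
      rw [div_le_one (by positivity)]
      exact_mod_cast Nat.choose_le_pow p.2 k
    have b2 : max (1 - v / p.2) 0 ^ (p.2 - k) ≤ Real.exp (-(1 / 2 * v)) := by
      calc _ ≤ Real.exp (-(v / p.2)) ^ (p.2 - k) := by
            refine pow_le_pow_left₀ (le_max_right _ _) (max_le ?_ (Real.exp_pos _).le) _
            linarith [Real.add_one_le_exp (-(v / p.2))]
        _ = Real.exp (-((p.2 - k : ℕ) * (v / p.2))) := by rw [← Real.exp_nat_mul]; congr 1; ring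
        _ ≤ _ := by
            refine Real.exp_le_exp.2 (neg_le_neg ?_)
            rw [mul_div_assoc', le_div_iff₀ ha, Nat.cast_sub (by omega)]
            have : (2 * k + 1 : ℝ) ≤ p.2 := by exact_mod_cast hp
            nlinarith
    have b3 : max (1 - r p.1 / (1 - r p.1) * (v / p.2)) 0 ^ (p.1 - 1 - p.2) ≤ 1 := by
      refine pow_le_one₀ (le_max_right _ _) (max_le ?_ zero_le_one)
      have : 0 ≤ r p.1 / (1 - r p.1) * (v / p.2) := by positivity
      linarith
    have n1 : 0 ≤ max (1 - v / p.2) 0 ^ (p.2 - k) := pow_nonneg (le_max_right _ _) _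
    have n2 : 0 ≤ max (1 - r p.1 / (1 - r p.1) * (v / p.2)) 0 ^ (p.1 - 1 - p.2) :=
      pow_nonneg (le_max_right _ _) _
    rw [Real.norm_of_nonneg (by positivity)]
    calc _ ≤ 1 * 2 * (v ^ k * Real.exp (-(1 / 2 * v)) * 1) := by gcongr
      _ = _ := by ring
  · have h := integrableOn_rpow_mul_exp_neg_mul_rpow (s := (k : ℝ)) (p := 1) (b := 1 / 2)
      (by have : (0 : ℝ) ≤ k := Nat.cast_nonneg k
          linarith) (by norm_num) (by norm_num)
    refine Integrable.const_mul ?_ 2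
    refine h.congr_fun (fun v _ => ?_) measurableSet_Ioi
    simp
  · refine (ae_restrict_iff' measurableSet_Ioi).2 (ae_of_all _ fun v hv => ?_)
    have hv0 : (0 : ℝ) < v := hv
    refine (hκ.mul hrate).mul ((tendsto_const_nhds.mul ?_).mul ?_)
    · refine tendsto_max_pow_exp ?_ ?_
      · simpa [div_eq_mul_inv] using hinv.const_mul v
      · have h1 : Tendsto (fun p : ℕ × ℕ => v - k * v * (p.2 : ℝ)⁻¹) (typicalFilter r)
            (𝓝 (v - k * v * 0)) := tendsto_const_nhds.sub (hinv.const_mul _)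
        rw [mul_zero, sub_zero] at h1
        refine h1.congr' ?_
        filter_upwards [hAn.eventually_gt_atTop k] with p hp
        have : (p.2 : ℝ) ≠ 0 := by
          have : p.2 ≠ 0 := by omega
          exact_mod_cast this
        rw [Nat.cast_sub hp.le]
        field_simp
    · refine tendsto_max_pow_exp ?_ ?_
      · have := hlam.mul_const v
        rw [zero_mul] at this
        refine this.congr fun p => ?_
        rw [div_eq_mul_inv v]; ring
      · have h1 := (hrate.sub hlam).mul_const v
        rw [sub_zero, one_mul] at h1
        refine h1.congr' ?_
        filter_upwards [eventually_typical_lt hρ hr hX (show (1 - ρ) / 2 < 1 - ρ by linarith)]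
          with p hp
        rw [Nat.cast_sub (by omega), Nat.cast_sub (by omega), Nat.cast_sub (by omega)]
        push_cast
        ring

lemma bits_half_pow (k : ℕ) : bits ((1 / 2) ^ (k + 1)) = ((k + 1 : ℕ) : ℝ) * (1 / 2) ^ (k + 1) := by
  unfold bits
  rw [Real.logb_pow, one_div, Real.logb_inv, Real.logb_self_eq_one (by norm_num)]
  ring

/-- The entropy of the geometric law is `∑ j / 2 ^ j = 2` bits; this is the source of the constant
in the theorem. -/
lemma tendsto_sum_bits_half_pow :
    Tendsto (fun K : ℕ => ∑ k ∈ Finset.range K, bits ((1 / 2) ^ (k + 1))) atTop (𝓝 2) := by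
  have h := (hasSum_coe_mul_geometric_of_norm_lt_one (r := (1 / 2 : ℝ)) (by norm_num)).tendsto_sum_nat
  have h2 := (tendsto_add_atTop_iff_nat 1).2 h
  norm_num at h2
  refine h2.congr fun K => ?_
  rw [Finset.sum_range_succ']
  simp only [bits_half_pow]
  simp

/-- Only a lower bound is asked for, so finitely many `k` suffice and termwise convergence is
enough; the other summands are nonnegative. -/
lemma eventually_stepEntropy_typical (hr0 : ∀ n, 0 ≤ r n) (hρ : ρ < 1) (hr : Tendsto r atTop (𝓝 ρ))
    (hX : Tendsto (fun n : ℕ => n * r n) atTop atTop) {ε : ℝ} (hε : 0 < ε) :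
    ∀ᶠ p in typicalFilter r, 2 - ε ≤ stepEntropy (gapDensity p.1 (r p.1) p.2) p.2 := by
  obtain ⟨K, hK⟩ := (tendsto_sum_bits_half_pow.eventually_const_lt
    (show 2 - ε < 2 by linarith)).exists
  have h1 : Tendsto (fun p : ℕ × ℕ => ∑ k ∈ Finset.range K,
      bits (binomMix (gapDensity p.1 (r p.1) p.2) p.2 k)) (typicalFilter r)
      (𝓝 (∑ k ∈ Finset.range K, bits ((1 / 2) ^ (k + 1)))) :=
    tendsto_finsetSum _ fun k _ => (continuous_bits.tendsto _).comp
      (tendsto_binomMix_typical hr0 hρ hr hX k)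
  have hAn : Tendsto Prod.snd (typicalFilter r) atTop :=
    tendsto_natCast_atTop_iff.1 (tendsto_snd_typical hX)
  filter_upwards [h1.eventually_const_lt hK, hAn.eventually_ge_atTop K,
    eventually_typical_lt hρ hr hX (show (1 - ρ) / 2 < 1 - ρ by linarith),
    (hr.comp (tendsto_fst_typical (r := r))).eventually_lt_const hρ] with p hp hpK hlt hp1
  have hf0 : ∀ u ∈ Set.Icc (0 : ℝ) 1, 0 ≤ gapDensity p.1 (r p.1) p.2 u := fun u _ =>
    gapDensity_nonneg (hr0 _) hp1 p.2 u
  have hf1 := integral_gapDensity_le_one (hr0 p.1) hp1 hlt.1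
  have hi0 := intervalIntegral.integral_nonneg (μ := volume) zero_le_one hf0
  refine hp.le.trans ?_
  unfold stepEntropy
  refine le_trans ?_ (le_add_of_nonneg_left (bits_nonneg (by linarith) (by linarith)))
  refine Finset.sum_le_sum_of_subset_of_nonneg (Finset.range_mono (by omega)) fun k hk _ => ?_
  exact bits_nonneg (binomMix_nonneg hf0 _ _) (binomMix_le_one (continuous_gapDensity _ _ _) hf0 hf1 hk)

lemma exists_of_eventually_typical {P : ℕ × ℕ → Prop} (h : ∀ᶠ p in typicalFilter r, P p) :
    ∃ N : ℕ, ∃ δ > 0, ∀ n ≥ N, ∀ a : ℕ, |(a : ℝ) / (n * r n) - 1| < δ → P (n, a) := by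
  obtain ⟨s, hs, t, ht, hst⟩ := mem_inf_iff.1 h
  obtain ⟨A, hA, hAs⟩ := mem_comap.1 hs
  obtain ⟨B, hB, hBt⟩ := mem_comap.1 ht
  obtain ⟨N, hN⟩ := mem_atTop_sets.1 hA
  obtain ⟨δ, hδ, hδB⟩ := Metric.mem_nhds_iff.1 hB
  refine ⟨N, δ, hδ, fun n hn a ha => ?_⟩
  have : (n, a) ∈ s ∩ t := by
    refine ⟨hAs (hN n hn), hBt (hδB ?_)⟩
    rw [Metric.mem_ball, Real.dist_eq]; exact ha
  rw [← hst] at this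
  exact this

/-- By Chebyshev nearly all the binomial mass sits on typical `a`, each of which has step entropy
near `2` and normalized multiplicity near `1 - ρ`. The other contributions are nonnegative and
dropped. -/
lemma eventually_le_chainBound (hr0 : ∀ n, 0 ≤ r n) (hρ0 : 0 ≤ ρ) (hρ : ρ < 1)
    (hr : Tendsto r atTop (𝓝 ρ)) (hX : Tendsto (fun n : ℕ => n * r n) atTop atTop) {ε : ℝ}
    (hε : 0 < ε) :
    ∀ᶠ n : ℕ in atTop, 2 * (1 - ρ) - ε ≤
      1 / (n : ℝ) * chainBound (cubeMeasure n) (fun x => orderedGraph x (r n)) := by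
  -- The product `(1 - ρ - e) * (2 - e) * (1 - e)` falls short of `2 (1 - ρ)` by at most `5 e`.
  set e := min (ε / 5) (min ((1 - ρ) / 2) (1 / 2)) with he
  have he0 : 0 < e := lt_min (by positivity) (lt_min (by linarith) (by norm_num))
  have he1 : e ≤ ε / 5 := min_le_left _ _
  have he2 : e ≤ (1 - ρ) / 2 := (min_le_right _ _).trans (min_le_left _ _)
  have he3 : e ≤ 1 / 2 := (min_le_right _ _).trans (min_le_right _ _)
  obtain ⟨N, δ, hδ, hNδ⟩ := exists_of_eventually_typical
    ((eventually_stepEntropy_typical hr0 hρ hr hX he0).and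
      (eventually_typical_lt hρ hr hX (show 1 - ρ - e < 1 - ρ by linarith)))
  have hfar : Tendsto (fun n : ℕ => (n * r n)⁻¹ / δ ^ 2) atTop (𝓝 (0 / δ ^ 2)) :=
    (tendsto_inv_atTop_zero.comp hX).div_const _
  rw [zero_div] at hfar
  filter_upwards [eventually_ge_atTop N, eventually_ge_atTop 3, hr.eventually_lt_const hρ,
    hfar.eventually_le_const he0, hX.eventually_gt_atTop 0] with n hnN hn3 hr1 hnfar hx0
  have hn0 : (0 : ℝ) < n := by exact_mod_cast (show 0 < n by omega)
  have hx0' : (n : ℝ) * r n ≠ 0 := hx0.ne'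
  set good : ℕ → Prop := fun a => |(a : ℝ) / (n * r n) - 1| < δ with hgood
  have hgood_spec : ∀ a, good a → a + 2 < n ∧
      (1 - ρ - e) * (2 - e) * binomWeight n (r n) a ≤
        1 / (n : ℝ) * ((n - 2 - a : ℕ) *
          (binomWeight n (r n) a * stepEntropy (gapDensity n (r n) a) a)) := by
    intro a ha
    obtain ⟨h1, h2, h3⟩ := hNδ n hnN a ha
    refine ⟨h2, ?_⟩
    have hw := binomWeight_nonneg (n := n) (hr0 n) hr1.le a
    simp only at h1 h3
    calc _ ≤ (1 / (n : ℝ) * (n - 2 - a : ℕ)) * stepEntropy (gapDensity n (r n) a) a *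
          binomWeight n (r n) a := by
          refine mul_le_mul_of_nonneg_right ?_ hw
          exact mul_le_mul h3 h1 (by linarith) (by positivity)
      _ = _ := by ring
  classical
  have hbad : ∑ a ∈ Finset.range (n + 1) with ¬ good a, binomWeight n (r n) a ≤ e := by
    refine (sum_binomWeight_far_le (hr0 n) hr1.le (t := δ * (n * r n)) (by positivity) _
      (Finset.filter_subset _ _) fun a ha => ?_).trans ?_
    · have h1 := not_lt.1 (Finset.mem_filter.1 ha).2
      have h2 : (a : ℝ) / (n * r n) - 1 = (a - n * r n) / (n * r n) := by
        rw [sub_div, div_self hx0']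
      rw [h2, abs_div, abs_of_pos hx0, le_div_iff₀ hx0] at h1
      rwa [abs_sub_comm]
    · refine le_trans (le_of_eq ?_) hnfar
      rw [mul_pow]
      field_simp
  have hgoodsum : 1 - e ≤ ∑ a ∈ Finset.range (n + 1) with good a, binomWeight n (r n) a := by
    have := Finset.sum_filter_add_sum_filter_not (Finset.range (n + 1)) good
      (binomWeight n (r n))
    rw [sum_binomWeight] at this
    linarith
  rw [chainBound_eq (hr0 n) hr1]
  have hH0 := entropy_leftNeighbors_two_nonneg (n := n) (hr0 n) hr1.le (by omega)
  have hR0 : 0 ≤ ∑ i ∈ Finset.Icc 2 (n - 1), condTerm n (r n) i (i - 1) :=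
    Finset.sum_nonneg fun i _ => condTerm_nonneg i _
  have hmain : (1 - ρ - e) * (2 - e) * (1 - e) ≤ 1 / (n : ℝ) * ∑ a ∈ Finset.range (n - 2),
      (n - 2 - a : ℕ) * (binomWeight n (r n) a * stepEntropy (gapDensity n (r n) a) a) := by
    calc _ ≤ (1 - ρ - e) * (2 - e) *
          ∑ a ∈ Finset.range (n + 1) with good a, binomWeight n (r n) a :=
          mul_le_mul_of_nonneg_left hgoodsum (mul_nonneg (by linarith) (by linarith))
      _ ≤ ∑ a ∈ Finset.range (n + 1) with good a, 1 / (n : ℝ) * ((n - 2 - a : ℕ) *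
          (binomWeight n (r n) a * stepEntropy (gapDensity n (r n) a) a)) := by
          rw [Finset.mul_sum]
          exact Finset.sum_le_sum fun a ha => (hgood_spec a (Finset.mem_filter.1 ha).2).2
      _ ≤ ∑ a ∈ Finset.range (n - 2), 1 / (n : ℝ) * ((n - 2 - a : ℕ) *
          (binomWeight n (r n) a * stepEntropy (gapDensity n (r n) a) a)) := by
          refine Finset.sum_le_sum_of_subset_of_nonneg (fun a ha => ?_) fun a ha _ => ?_
          · have := (hgood_spec a (Finset.mem_filter.1 ha).2).1
            exact Finset.mem_range.2 (by omega)
          · have h1 := Finset.mem_range.1 ha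
            have h2 := binomWeight_nonneg (n := n) (hr0 n) hr1.le a
            have h3 := stepEntropy_gapDensity_nonneg (hr0 n) hr1 (show a + 2 < n by omega)
            positivity
      _ = _ := by rw [Finset.mul_sum]
  have hnum : 2 * (1 - ρ) - ε ≤ (1 - ρ - e) * (2 - e) * (1 - e) := by
    have h1 : 2 - 3 * e ≤ (2 - e) * (1 - e) := by nlinarith
    have h2 : (1 - ρ - e) * (2 - 3 * e) ≤ (1 - ρ - e) * ((2 - e) * (1 - e)) :=
      mul_le_mul_of_nonneg_left h1 (by linarith)
    have h3 : 0 ≤ ρ * e := by positivity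
    nlinarith
  have hn1 : 0 ≤ 1 / (n : ℝ) := by positivity
  have := mul_nonneg hn1 hH0
  have := mul_nonneg hn1 hR0
  rw [mul_add, mul_add]
  linarith

lemma neg_logb_one_sub_le {θ : ℝ} (h0 : 0 ≤ θ) (h1 : θ ≤ 1 / 2) : -Real.logb 2 (1 - θ) ≤ 4 * θ := by
  have hl := log_two_gt_half
  have h2 := Real.one_sub_inv_le_log_of_pos (show 0 < 1 - θ by linarith)
  have h3 : (1 - θ)⁻¹ ≤ 1 + 2 * θ := by
    rw [inv_le_iff_one_le_mul₀ (by linarith)]; nlinarith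
  have h4 : -Real.logb 2 (1 - θ) = -Real.log (1 - θ) / Real.log 2 := by unfold Real.logb; ring
  rw [h4, div_le_iff₀ (by linarith)]
  nlinarith

lemma condEntropy_le_two {n : ℕ} {s : ℝ} (h0 : 0 ≤ s) (h1 : s ≤ 1) {i : ℕ} (hi0 : 1 ≤ i)
    (hi : i < n) :
    condEntropy (cubeMeasure n) (fun x => leftNeighbors (orderedGraph x s) (i + 1))
      (fun x => leftNeighbors (orderedGraph x s) i) ≤ 2 := by
  have h := condEntropy_le_geometric h0 h1 hi0 hi (show (0 : ℝ) < 1 / 2 by norm_num) (by norm_num)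
  have hlog : Real.logb 2 (1 / 2) = -1 := by
    rw [one_div, Real.logb_inv, Real.logb_self_eq_one (by norm_num)]
  rw [show (1 : ℝ) - 1 / 2 = 1 / 2 by norm_num, hlog] at h
  have h2 : ∑ b ∈ Finset.range i, binomWeight n s b ≤ 1 := by
    rw [← sum_binomWeight (n := n) (r := s)]
    exact Finset.sum_le_sum_of_subset_of_nonneg (Finset.range_mono (by omega))
      fun a _ _ => binomWeight_nonneg h0 h1 a
  linarith

/-- For `i` below `(ρ - e) n` the counts are almost surely truncated, so the next count is nearly
deterministic and a geometric kernel with small ratio shows negligible entropy. The other roughly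
`(1 - ρ) n` steps cost at most `2` each. -/
lemma eventually_chainBound_le (hr0 : ∀ n, 0 ≤ r n) (hρ : ρ < 1)
    (hr : Tendsto r atTop (𝓝 ρ)) {ε : ℝ} (hε : 0 < ε) :
    ∀ᶠ n : ℕ in atTop,
      1 / (n : ℝ) * chainBound (cubeMeasure n) (fun x => orderedGraph x (r n)) ≤
        2 * (1 - ρ) + ε := by
  set e := min ε 1 / 8 with he
  have he0 : 0 < e := by positivity
  have he1 : 8 * e ≤ ε := by
    have : min ε 1 ≤ ε := min_le_left _ _
    rw [he]; linarith
  have he2 : e ≤ 1 / 8 := by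
    have : min ε 1 ≤ 1 := min_le_right _ _
    rw [he]; linarith
  -- Makes the fixed cost `-log₂ (1 - θ)` at most `e / 2`. The large factor `-log₂ θ` multiplies a
  -- probability of order `1 / n`, which takes the other `e / 2`.
  set θ := e / 8 with hθ
  have hθ0 : 0 < θ := by positivity
  have hθ1 : θ < 1 := by linarith
  have hθlog : -Real.logb 2 (1 - θ) ≤ e / 2 := by
    have := neg_logb_one_sub_le hθ0.le (by linarith)
    linarith
  have hlogθ : Real.logb 2 θ ≤ 0 := Real.logb_nonpos (by norm_num) hθ0.le hθ1.le
  have hlim1 : Tendsto (fun n : ℕ => (-Real.logb 2 θ * (4 / e ^ 2)) / (n : ℝ)) atTop (𝓝 0) :=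
    tendsto_const_div_atTop_nhds_zero_nat _
  have hlim2 : Tendsto (fun n : ℕ => (6 : ℝ) / n) atTop (𝓝 0) :=
    tendsto_const_div_atTop_nhds_zero_nat _
  filter_upwards [hr.eventually_lt_const hρ, hr.eventually_const_lt (show ρ - e / 2 < ρ by linarith),
    hlim1.eventually_le_const (show 0 < e / 2 by positivity), hlim2.eventually_le_const he0,
    eventually_ge_atTop 3] with n hr1 hr2 hn1 hn2 hn
  have hn0 : (0 : ℝ) < n := by exact_mod_cast (show 0 < n by omega)
  have hsmall : ∀ i ∈ Finset.Icc 2 (n - 1), (i : ℝ) ≤ (ρ - e) * n →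
      condEntropy (cubeMeasure n) (fun x => leftNeighbors (orderedGraph x (r n)) (i + 1))
      (fun x => leftNeighbors (orderedGraph x (r n)) i) ≤ e := by
    intro i hi hin
    obtain ⟨hi1, hi2⟩ := Finset.mem_Icc.1 hi
    have h := condEntropy_le_geometric (n := n) (hr0 n) hr1.le (i := i) (by omega) (by omega) hθ0 hθ1
    have hfar : ∑ b ∈ Finset.range i, binomWeight n (r n) b ≤ 4 / e ^ 2 / n := by
      refine (sum_binomWeight_far_le (hr0 n) hr1.le (t := e / 2 * n) (by positivity) _
        (Finset.range_mono (by omega)) fun b hb => ?_).trans ?_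
      · have hb' : (b : ℝ) ≤ i := by exact_mod_cast (Finset.mem_range.1 hb).le
        refine le_trans ?_ (le_abs_self _)
        nlinarith
      · have : n * r n / (e / 2 * n) ^ 2 = 4 / e ^ 2 / n * r n := by field_simp; ring
        rw [this]
        exact mul_le_of_le_one_right (by positivity) hr1.le
    have h2 : -Real.logb 2 θ * ∑ b ∈ Finset.range i, binomWeight n (r n) b ≤ e / 2 := by
      refine le_trans ?_ hn1
      calc _ ≤ -Real.logb 2 θ * (4 / e ^ 2 / n) := mul_le_mul_of_nonneg_left hfar (by linarith)
        _ = _ := by ring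
    linarith
  classical
  -- If `ρ < e` the cutoff is negative and its natural floor is `0`; all indices then count here,
  -- and the bound still holds.
  have hcard : ((Finset.Icc 2 (n - 1)).filter fun i : ℕ => ¬ (i : ℝ) ≤ (ρ - e) * n).card ≤
      n - (ρ - e) * n + 1 := by
    have h1 : ((Finset.Icc 2 (n - 1)).filter fun i : ℕ => ¬ (i : ℝ) ≤ (ρ - e) * n) ⊆
        Finset.Ico ⌊(ρ - e) * n⌋₊ n := by
      intro i hi
      obtain ⟨hi1, hi2⟩ := Finset.mem_filter.1 hi
      have := Finset.mem_Icc.1 hi1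
      exact Finset.mem_Ico.2 ⟨Nat.floor_le_of_le (not_le.1 hi2).le, by omega⟩
    have h2 := Finset.card_le_card h1
    rw [Nat.card_Ico] at h2
    have h3 : ⌊(ρ - e) * n⌋₊ ≤ n := Nat.floor_le_of_le (by nlinarith)
    have h4 := Nat.lt_floor_add_one ((ρ - e) * n)
    have h5 : (((Finset.Icc 2 (n - 1)).filter fun i : ℕ => ¬ (i : ℝ) ≤ (ρ - e) * n).card : ℝ) ≤
        ((n - ⌊(ρ - e) * n⌋₊ : ℕ) : ℝ) := by exact_mod_cast h2
    rw [Nat.cast_sub h3] at h5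
    linarith
  have hsum : ∑ i ∈ Finset.Icc 2 (n - 1),
      condEntropy (cubeMeasure n) (fun x => leftNeighbors (orderedGraph x (r n)) (i + 1))
      (fun x => leftNeighbors (orderedGraph x (r n)) i) ≤ n * e + (n - (ρ - e) * n + 1) * 2 := by
    rw [← Finset.sum_filter_add_sum_filter_not _ fun i : ℕ => (i : ℝ) ≤ (ρ - e) * n]
    refine add_le_add ?_ ?_
    · refine (Finset.sum_le_card_nsmul _ _ e fun i hi => ?_).trans ?_
      · obtain ⟨hi1, hi2⟩ := Finset.mem_filter.1 hi
        exact hsmall i hi1 hi2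
      · rw [nsmul_eq_mul]
        refine mul_le_mul_of_nonneg_right ?_ he0.le
        have := (Finset.card_filter_le (Finset.Icc 2 (n - 1)) fun i : ℕ => (i : ℝ) ≤ (ρ - e) * n)
        rw [Nat.card_Icc] at this
        exact_mod_cast this.trans (by omega)
    · refine (Finset.sum_le_card_nsmul _ _ 2 fun i hi => ?_).trans ?_
      · have := Finset.mem_Icc.1 (Finset.mem_filter.1 hi).1
        exact condEntropy_le_two (hr0 n) hr1.le (by omega) (by omega)
      · rw [nsmul_eq_mul]
        exact mul_le_mul_of_nonneg_right hcard (by norm_num)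
  have hH := entropy_leftNeighbors_two_le (n := n) (hr0 n) hr1.le (by omega)
  have hall : chainBound (cubeMeasure n) (fun x => orderedGraph x (r n)) ≤
      4 + (n * e + (n - (ρ - e) * n + 1) * 2) := add_le_add hH hsum
  calc _ ≤ 1 / (n : ℝ) * (4 + (n * e + (n - (ρ - e) * n + 1) * 2)) := by gcongr
    _ = 6 / n + e + 2 * (1 - ρ) + 2 * e := by field_simp; ring
    _ ≤ _ := by linarith

lemma tendsto_chainBound (hr0 : ∀ n, 0 ≤ r n) (hρ0 : 0 ≤ ρ) (hρ : ρ < 1)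
    (hr : Tendsto r atTop (𝓝 ρ)) (hX : Tendsto (fun n : ℕ => n * r n) atTop atTop) :
    Tendsto (fun n : ℕ => 1 / (n : ℝ) *
      chainBound (cubeMeasure n) (fun x => orderedGraph x (r n))) atTop (𝓝 (2 * (1 - ρ))) := by
  rw [Metric.tendsto_nhds]
  intro ε hε
  filter_upwards [eventually_le_chainBound hr0 hρ0 hρ hr hX (half_pos hε),
    eventually_chainBound_le hr0 hρ hr (half_pos hε)] with n h1 h2
  rw [Real.dist_eq, abs_lt]
  constructor <;> linarith

end Typical

end Dense

end RGG

/-! ### The main theorem -/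

theorem proposition4
    {Ω : ℕ → Type*} [∀ n, MeasurableSpace (Ω n)]
    (μ : ∀ n, Measure (Ω n)) [∀ n, IsProbabilityMeasure (μ n)]
    (X : ∀ n, Fin n → Ω n → ℝ)
    (hX_meas : ∀ n i, Measurable (X n i))
    (hX_indep : ∀ n, iIndepFun (X n) (μ n))
    (hX_unif : ∀ n i, pdf.IsUniform (X n i) (Set.Icc (0 : ℝ) 1) (μ n) volume)
    (r : ℕ → ℝ) (hr : ∀ n, 0 ≤ r n) :
    -- the series defining `h_U` converges and `h_U` maps `[0, ∞)` to `[0, ∞)`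
    (∀ x : ℝ, 0 ≤ x → Summable (RGG.hUTerm x) ∧ 0 ≤ RGG.hU x) ∧
    -- the upper bound on the normalized entropy of the ordered graph
    (∀ n : ℕ, 2 ≤ n →
      1 / (n : ℝ) * RGG.entropy (μ n) (fun ω => RGG.orderedGraph (fun i => X n i ω) (r n)) ≤
        1 / (n : ℝ) *
          RGG.chainBound (μ n) (fun ω => RGG.orderedGraph (fun i => X n i ω) (r n))) ∧
    -- the asymptotics of the upper bound
    (r =O[atTop] (fun n : ℕ => 1 / (n : ℝ)) →
      (fun n : ℕ => 1 / (n : ℝ) *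
          RGG.chainBound (μ n) (fun ω => RGG.orderedGraph (fun i => X n i ω) (r n)))
        ~[atTop] (fun n : ℕ => RGG.hU ((n : ℝ) * r n))) ∧
    ((fun n : ℕ => 1 / (n : ℝ)) =o[atTop] r → r =o[atTop] (fun _ : ℕ => (1 : ℝ)) →
      (fun n : ℕ => 1 / (n : ℝ) *
          RGG.chainBound (μ n) (fun ω => RGG.orderedGraph (fun i => X n i ω) (r n)))
        ~[atTop] (fun _ : ℕ => (2 : ℝ))) ∧
    (∀ ρ : ℝ, 0 < ρ → ρ < 1 → (∀ n, r n = ρ) →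
      (fun n : ℕ => 1 / (n : ℝ) *
          RGG.chainBound (μ n) (fun ω => RGG.orderedGraph (fun i => X n i ω) (r n)))
        ~[atTop] (fun _ : ℕ => 2 * (1 - ρ))) := by
  have hX : ∀ n, Measurable fun ω i => X n i ω := fun n => measurable_pi_lambda _ (hX_meas n)
  have hlaw : ∀ n, RGG.chainBound (μ n) (fun ω => RGG.orderedGraph (fun i => X n i ω) (r n)) =
      RGG.chainBound (RGG.cubeMeasure n) (fun x => RGG.orderedGraph x (r n)) := fun n => by
    rw [RGG.chainBound_map (μ n) (fun ω i => X n i ω) (hX n) (r n),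
      RGG.map_eq_cubeMeasure (μ n) (X n) (hX_meas n) (hX_indep n) (hX_unif n)]
  refine ⟨fun x hx => ⟨RGG.summable_hUTerm hx, RGG.hU_nonneg hx⟩, fun n hn => ?_, ?_, ?_, ?_⟩
  · exact mul_le_mul_of_nonneg_left (RGG.entropy_le_chainBound (μ n) _ (hX n) (r n) hn)
      (by positivity)
  -- `r n` and `hU (n * r n)` may vanish, so equivalence is checked through the uniform estimate
  -- relative to `hU` and not through a quotient.
  · intro hO
    simp only [hlaw]
    obtain ⟨C, hC, hb⟩ := hO.exists_nonneg
    refine isLittleO_iff.2 fun ε hε => ?_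
    filter_upwards [RGG.eventually_chainBound_close hC hε, hb.bound, eventually_gt_atTop 0]
      with n hn hbn hn0
    have hn0' : (0 : ℝ) < n := by exact_mod_cast hn0
    rw [Real.norm_of_nonneg (hr n), Real.norm_of_nonneg (by positivity), mul_one_div,
      le_div_iff₀ hn0', mul_comm] at hbn
    rw [Pi.sub_apply, Real.norm_eq_abs, Real.norm_of_nonneg
      (RGG.hU_nonneg (mul_nonneg hn0'.le (hr n)))]
    exact hn (r n) (hr n) hbn
  · intro hω ho
    simp only [hlaw]
    refine (isEquivalent_const_iff_tendsto (two_ne_zero (α := ℝ))).2 ?_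
    have h0 := (isLittleO_one_iff ℝ).1 ho
    have h1 : Tendsto (fun n : ℕ => n * r n) atTop atTop := by
      refine tendsto_atTop.2 fun M => ?_
      filter_upwards [isLittleO_iff.1 hω (show 0 < 1 / (|M| + 1) by positivity),
        eventually_gt_atTop 0] with n hn hn0
      have hn0' : (0 : ℝ) < n := by exact_mod_cast hn0
      rw [Real.norm_of_nonneg (hr n), Real.norm_of_nonneg (by positivity), one_div_mul_eq_div,
        div_le_div_iff₀ hn0' (by positivity)] at hn
      linarith [le_abs_self M]
    simpa using RGG.tendsto_chainBound hr le_rfl zero_lt_one h0 h1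
  · intro ρ hρ0 hρ1 hρ
    simp only [hlaw]
    refine (isEquivalent_const_iff_tendsto (show 2 * (1 - ρ) ≠ 0 by linarith)).2 ?_
    have h0 : Tendsto r atTop (nhds ρ) := tendsto_const_nhds.congr fun n => (hρ n).symm
    refine RGG.tendsto_chainBound hr hρ0.le hρ1 h0 ?_
    exact (tendsto_natCast_atTop_atTop.atTop_mul_const hρ0).congr fun n => by rw [hρ n]
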